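/- **Setting.** Let $T>0$, $r\ge 0$, and let $(\Omega,\mathcal F,\mathbf P)$ be a probability space with a standard $d$-dimensional Brownian motion $W$ on $[0,T]$ and its augmented filtration $\mathbb F=(\mathcal F(t))_{t\in[0,T]}$. Let $\Sigma=\sigma\sigma'\in\mathbb R^{d\times d}$ be positive definite, let $\Lambda\in\mathbb R^{d\times d}$ be diagonal and positive definite, and consider investors $m=1,\dots,N$ with common risk tolerance $\delta_m=\bar\delta>0$. Write $\lambda_m=\delta_m/\sum_{j}\delta_j$ and $\lambda_{-m}=1-\lambda_m$. Let $\mathcal H^\infty$ be the set of optional $X:[0,T]\times\Omega\to\mathbb R^d$ with $\operatorname{ess\,sup}_{\omega}\operatorname{ess\,sup}_{t}\|X(t)\|_2<\infty$. Let $\mathcal A\subset\mathcal H^\infty$ be the class of continuous semimartingales $X$ with $X(T)=0$ and $dX(t)=a^X(t)\,dt+dM^X(t)$, where $a^X\in\mathcal H^\infty$ and $M^X$ is a continuous $\mathbb F$-martingale in $\mathcal H^\infty$. Let $\mathcal W_{\mathcal A}$ be the class of $X$ with $dX(t)=\dot X(t)\,dt$, $X(0)=0$ and $\dot X\in\mathcal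 A$. Let $\zeta_m\in\mathcal H^\infty$ for $m=1,\dots,N$, let $\psi\in\mathcal W_{\mathcal A}$ with $d\dot\psi(t)=a^{\dot\psi}(t)\,dt+dM^{\dot\psi}(t)$, and fix an investor $n$. Put $\zeta_{-n}=\sum_{m\ne n}\zeta_m$ and $$B:=\frac{\Lambda^{-1}\Sigma}{2\bar\delta},\qquad \mathbb{TP}_n:=\frac{\lambda_n(\zeta_{-n}-\psi)-\lambda_{-n}\zeta_n}{\lambda_n+1}+\frac{2\bar\delta\,\Sigma^{-1}\Lambda}{N+1}\big(a^{\dot\psi}-r\dot\psi\big),$$ $$\Delta:=B+\tfrac{r^2}{4}I_d,\quad G(t):=\cosh\big(\sqrt\Delta\,(T-t)\big),\quad K(t):=\Delta G(t)-\tfrac r2\dot G(t),\quad F(t):=-K(t)^{-1}B\,\dot G(t),$$ where $\sqrt\Delta$ is the principal square root (all eigenvalues have positive real part). **Proposition.** The principal square root $\sqrt\Delta$ exists, $K(t)$ is invertible for all $t\in[0,T]$, and the process $$\widetilde{\mathbb{TP}}_n(t):=K(t)^{-1}\,\mathbb E\Big[\int_t^T K(s)\,B\,e^{-\frac r2(s-t)}\,\mathbb{TP}_n(s)\,ds\,\Big|\,\mathcal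 F(t)\Big],\qquad t\in[0,T],$$ has a continuous adapted version. The frictional best-response FBSDE $$d\varphi(t)=\dot\varphi(t)\,dt,\quad \varphi(0)=0,$$ $$d\dot\varphi(t)=d\widetilde M(t)+B\big(\varphi(t)-\mathbb{TP}_n(t)\big)\,dt+r\,\dot\varphi(t)\,dt,\quad \dot\varphi(T)=0,$$ in which the continuous $\mathbb F$-martingale $\widetilde M\in\mathcal H^\infty$ is part of the solution, has a solution with $\varphi\in\mathcal W_{\mathcal A}$. This solution is pathwise unique: for two such solutions, $\varphi$, $\dot\varphi$ and the increments of $\widetilde M$ agree for all times, almost surely. With $\widetilde{\mathbb{TP}}_n$ denoting any continuous adapted version, almost surely, for all $t\in[0,T]$, $$\varphi(t)=\int_0^t e^{-\int_s^t F(u)\,du}\;\widetilde{\mathbb{TP}}_n(s)\,ds .$$ -/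

import Mathlib

open MeasureTheory ProbabilityTheory Filter Topology
open scoped ENNReal

noncomputable section

namespace FrictionalMarket

/-! ### Matrix functions -/

/-- `S` is the principal square root of the real matrix `A`: its square is `A` and all its complex
eigenvalues lie in the open right half-plane. -/
def IsPrincipalSqrt {d : ℕ} (A S : Matrix (Fin d) (Fin d) ℝ) : Prop :=
  S * S = A ∧ ∀ z ∈ spectrum ℂ (S.map (algebraMap ℝ ℂ)), 0 < z.re

open Classical in
/-- The principal square root of a real matrix (`0` if there is none). -/
def principalSqrt {d : ℕ} (A : Matrix (Fin d) (Fin d) ℝ) : Matrix (Fin d) (Fin d) ℝ :=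
  if h : ∃ S, IsPrincipalSqrt A S then h.choose else 0

/-- The hyperbolic cosine of a matrix. -/
def matrixCosh {d : ℕ} (A : Matrix (Fin d) (Fin d) ℝ) : Matrix (Fin d) (Fin d) ℝ :=
  (1 / 2 : ℝ) • (NormedSpace.exp A + NormedSpace.exp (-A))

/-- Entrywise derivative of a matrix-valued function of time. -/
def matrixDeriv {d : ℕ} (A : ℝ → Matrix (Fin d) (Fin d) ℝ) (t : ℝ) : Matrix (Fin d) (Fin d) ℝ :=
  Matrix.of fun i j => deriv (fun u => A u i j) t

/-- Entrywise integral `∫ₛᵗ A(u) du` of a matrix-valued function of time. -/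
def matrixIntegral {d : ℕ} (A : ℝ → Matrix (Fin d) (Fin d) ℝ) (s t : ℝ) :
    Matrix (Fin d) (Fin d) ℝ :=
  Matrix.of fun i j => ∫ u in s..t, A u i j

/-- `B = Λ⁻¹ Σ / (2 δ)`. -/
def matB {d : ℕ} (S L : Matrix (Fin d) (Fin d) ℝ) (δ : ℝ) : Matrix (Fin d) (Fin d) ℝ :=
  (1 / (2 * δ)) • (L⁻¹ * S)

/-- `Δ = B + (r² / 4) I`. -/
def matDelta {d : ℕ} (B : Matrix (Fin d) (Fin d) ℝ) (r : ℝ) : Matrix (Fin d) (Fin d) ℝ :=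
  B + (r ^ 2 / 4) • (1 : Matrix (Fin d) (Fin d) ℝ)

/-- `G(t) = cosh(√Δ (T - t))`. -/
def matG {d : ℕ} (B : Matrix (Fin d) (Fin d) ℝ) (r T t : ℝ) : Matrix (Fin d) (Fin d) ℝ :=
  matrixCosh ((T - t) • principalSqrt (matDelta B r))

/-- `K(t) = Δ G(t) - (r / 2) G'(t)`, the matrix that is inverted in the explicit formula. -/
def matK {d : ℕ} (B : Matrix (Fin d) (Fin d) ℝ) (r T t : ℝ) : Matrix (Fin d) (Fin d) ℝ :=
  matDelta B r * matG B r T t - (r / 2) • matrixDeriv (matG B r T) t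

/-- `F(t) = -(Δ G(t) - (r / 2) G'(t))⁻¹ B G'(t)`. -/
def matF {d : ℕ} (B : Matrix (Fin d) (Fin d) ℝ) (r T t : ℝ) : Matrix (Fin d) (Fin d) ℝ :=
  -((matK B r T t)⁻¹ * B * matrixDeriv (matG B r T) t)

/-! ### Processes on the time interval `[0, T]` -/

/-- The time interval `[0, T]`, with Lebesgue measure as its `volume`. -/
abbrev Time (T : ℝ) : Type := Set.Icc (0 : ℝ) T

instance instMeasureSpaceTime (T : ℝ) : MeasureSpace (Time T) :=
  Measure.Subtype.measureSpace

/-- `ℝᵈ` with the Euclidean norm. -/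
abbrev Vec (d : ℕ) : Type := EuclideanSpace ℝ (Fin d)

/-- Action of a matrix on `ℝᵈ`. -/
abbrev act {d : ℕ} (A : Matrix (Fin d) (Fin d) ℝ) (x : Vec d) : Vec d :=
  Matrix.toEuclideanLin A x

/-- Standard `d`-dimensional Brownian motion on `[0, T]`. -/
structure IsBrownianMotion {Ω : Type*} [MeasurableSpace Ω] {T : ℝ} {d : ℕ}
    (W : Time T → Ω → Fin d → ℝ) (P : Measure Ω) : Prop where
  measurable : ∀ t, Measurable (W t)
  start : ∀ t : Time T, (t : ℝ) = 0 → ∀ᵐ ω ∂P, W t ω = 0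
  indep_increments : HasIndepIncrements W P
  law : ∀ s t : Time T, s ≤ t →
    HasLaw (W t - W s)
      (Measure.pi fun _ : Fin d => gaussianReal 0 (Real.toNNReal ((t : ℝ) - (s : ℝ)))) P
  continuous_paths : ∀ᵐ ω ∂P, Continuous fun t => W t ω

/-- The augmented filtration generated by a Brownian motion: at time `t` it is generated by the
`W(s)` with `s ≤ t` and by all `P`-null events. -/
def brownianFiltration {Ω : Type*} [mΩ : MeasurableSpace Ω] {T : ℝ} {d : ℕ}
    {W : Time T → Ω → Fin d → ℝ} {P : Measure Ω} (hW : IsBrownianMotion W P) :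
    Filtration (Time T) mΩ :=
  Filtration.natural W (fun t => (hW.measurable t).stronglyMeasurable) ⊔
    Filtration.const (Time T) (MeasurableSpace.generateFrom {A | MeasurableSet A ∧ P A = 0})
      (MeasurableSpace.generateFrom_le fun _ hA => hA.1)

/-- A right-continuous path with left limits. -/
def IsCadlag {T : ℝ} (f : Time T → ℝ) : Prop :=
  ∀ t, ContinuousWithinAt f (Set.Ici t) t ∧ ∃ l, Tendsto f (𝓝[<] t) (𝓝 l)

/-- The optional σ-algebra, generated by the real adapted càdlàg processes. -/
@[reducible]
def optionalSigma {Ω : Type*} [mΩ : MeasurableSpace Ω] {T : ℝ} (𝓕 : Filtration (Time T) mΩ) :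
    MeasurableSpace (Time T × Ω) :=
  ⨆ Y : {Y : Time T → Ω → ℝ // Adapted 𝓕 Y ∧ ∀ ω, IsCadlag fun t => Y t ω},
    MeasurableSpace.comap (fun p : Time T × Ω => Y.1 p.1 p.2) (borel ℝ)

/-- `X` is an optional process. -/
def IsOptional {Ω : Type*} [mΩ : MeasurableSpace Ω] {T : ℝ} {d : ℕ}
    (𝓕 : Filtration (Time T) mΩ) (X : Time T → Ω → Vec d) : Prop :=
  Measurable[optionalSigma 𝓕] fun p : Time T × Ω => X p.1 p.2

/-- `X` is in `ℋ^∞`: optional with `esssup_ω esssup_t ‖X(t)‖₂ < ∞`. -/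
def MemHInfty {Ω : Type*} [mΩ : MeasurableSpace Ω] {T : ℝ} {d : ℕ}
    (𝓕 : Filtration (Time T) mΩ) (P : Measure Ω) (X : Time T → Ω → Vec d) : Prop :=
  IsOptional 𝓕 X ∧ essSup (fun ω => essSup (fun t => ‖X t ω‖ₑ) volume) P < ∞

/-- `M` is a continuous martingale in `ℋ^∞`. -/
structure IsBddContMartingale {Ω : Type*} [mΩ : MeasurableSpace Ω] {T : ℝ} {d : ℕ}
    (𝓕 : Filtration (Time T) mΩ) (P : Measure Ω) (M : Time T → Ω → Vec d) : Prop where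
  martingale : Martingale M 𝓕 P
  mem : MemHInfty 𝓕 P M
  continuous_paths : ∀ᵐ ω ∂P, Continuous fun t => M t ω

/-- `dX(t) = a(t) dt + dM(t)` on `[0, T]`, almost surely. -/
def HasDynamics {Ω : Type*} [MeasurableSpace Ω] {T : ℝ} {d : ℕ}
    (P : Measure Ω) (X a M : Time T → Ω → Vec d) : Prop :=
  ∀ᵐ ω ∂P, ∀ s t : Time T, s ≤ t →
    X t ω - X s ω = (∫ u in Set.Ioc s t, a u ω) + (M t ω - M s ω)

/-- `X(T) = 0`, almost surely. -/
def VanishesAtEnd {Ω : Type*} [MeasurableSpace Ω] {T : ℝ} {d : ℕ}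
    (P : Measure Ω) (X : Time T → Ω → Vec d) : Prop :=
  ∀ t : Time T, (t : ℝ) = T → ∀ᵐ ω ∂P, X t ω = 0

/-- `X` is in the class `𝒜` of continuous semimartingales, with drift `a = a^X` and martingale
part `M = M^X`. -/
structure IsClassADecomp {Ω : Type*} [mΩ : MeasurableSpace Ω] {T : ℝ} {d : ℕ}
    (𝓕 : Filtration (Time T) mΩ) (P : Measure Ω) (X a M : Time T → Ω → Vec d) : Prop where
  mem : MemHInfty 𝓕 P X
  continuous_paths : ∀ᵐ ω ∂P, Continuous fun t => X t ω
  drift_mem : MemHInfty 𝓕 P a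
  martingale_part : IsBddContMartingale 𝓕 P M
  dynamics : HasDynamics P X a M
  terminal : VanishesAtEnd P X

/-- Membership in the class `𝒜`. -/
def MemA {Ω : Type*} [mΩ : MeasurableSpace Ω] {T : ℝ} {d : ℕ}
    (𝓕 : Filtration (Time T) mΩ) (P : Measure Ω) (X : Time T → Ω → Vec d) : Prop :=
  ∃ a M : Time T → Ω → Vec d, IsClassADecomp 𝓕 P X a M

/-- `dX(t) = X'(t) dt` and `X(0) = 0`, almost surely; `X'` is written `Xdot`. -/
def HasRate {Ω : Type*} [MeasurableSpace Ω] {T : ℝ} {d : ℕ}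
    (P : Measure Ω) (X Xdot : Time T → Ω → Vec d) : Prop :=
  ∀ᵐ ω ∂P, ∀ t : Time T, X t ω = ∫ u in Set.Iic t, Xdot u ω

/-- `X` is in the class `𝒲_𝒜`, with rate `Xdot`. -/
def MemWA {Ω : Type*} [mΩ : MeasurableSpace Ω] {T : ℝ} {d : ℕ}
    (𝓕 : Filtration (Time T) mΩ) (P : Measure Ω) (X Xdot : Time T → Ω → Vec d) : Prop :=
  HasRate P X Xdot ∧ MemA 𝓕 P Xdot

/-! ### The best-response problem with transaction costs -/

/-- The frictionless best response of investor `n`: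
`(λₙ (ζ₋ₙ - ψ) - λ₋ₙ ζₙ) / (λₙ + 1)` with `λₙ = δₙ / ∑ₘ δₘ` and `λ₋ₙ = 1 - λₙ`. -/
def frictionlessBestResponse {Ω : Type*} {T : ℝ} {d N : ℕ} (δ : Fin N → ℝ)
    (ζ : Fin N → Time T → Ω → Vec d) (ψ : Time T → Ω → Vec d) (n : Fin N) :
    Time T → Ω → Vec d := fun t ω =>
  let lam : ℝ := δ n / ∑ m, δ m
  (1 / (lam + 1)) •
    (lam • ((∑ m ∈ Finset.univ.erase n, ζ m t ω) - ψ t ω) - (1 - lam) • ζ n t ω)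

/-- The target process: the frictionless best response plus
`(2 δbar / (N + 1)) Σ⁻¹ Λ (a^{ψ'} - r ψ')`. -/
def targetProcess {Ω : Type*} {T : ℝ} {d N : ℕ} (S L : Matrix (Fin d) (Fin d) ℝ) (r δbar : ℝ)
    (δ : Fin N → ℝ) (ζ : Fin N → Time T → Ω → Vec d) (ψ ψdot aψ : Time T → Ω → Vec d)
    (n : Fin N) : Time T → Ω → Vec d := fun t ω =>
  frictionlessBestResponse δ ζ ψ n t ω +
    (2 * δbar / ((N : ℝ) + 1)) • act (S⁻¹ * L) (aψ t ω - r • ψdot t ω)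

/-- `(φ, φ', M)` solves the FBSDE with target `TP`:
`dφ = φ' dt`, `φ(0) = 0` and `dφ' = dM + B (φ - TP) dt + r φ' dt`, `φ'(T) = 0`, where `M` is a
continuous martingale in `ℋ^∞` that is part of the solution. -/
structure SolvesFBSDE {Ω : Type*} [mΩ : MeasurableSpace Ω] {T : ℝ} {d : ℕ}
    (𝓕 : Filtration (Time T) mΩ) (P : Measure Ω) (B : Matrix (Fin d) (Fin d) ℝ) (r : ℝ)
    (TP : Time T → Ω → Vec d) (φ φdot M : Time T → Ω → Vec d) : Prop where
  forward : HasRate P φ φdot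
  martingale : IsBddContMartingale 𝓕 P M
  backward : HasDynamics P φdot
    (fun t ω => act B (φ t ω - TP t ω) + r • φdot t ω) M
  terminal : VanishesAtEnd P φdot

/-- `ξ` is a continuous adapted version of the process
`K(t)⁻¹ 𝔼[∫ₜᵀ K(s) B e^{-(r/2)(s-t)} TP(s) ds | ℱ(t)]`, where `K = Δ G - (r / 2) G'`. -/
structure IsDiscountedTarget {Ω : Type*} [mΩ : MeasurableSpace Ω] {T : ℝ} {d : ℕ}
    (𝓕 : Filtration (Time T) mΩ) (P : Measure Ω) (B : Matrix (Fin d) (Fin d) ℝ) (r : ℝ)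
    (TP ξ : Time T → Ω → Vec d) : Prop where
  adapted : StronglyAdapted 𝓕 ξ
  continuous_paths : ∀ᵐ ω ∂P, Continuous fun t => ξ t ω
  version : ∀ t : Time T, ξ t =ᵐ[P] fun ω =>
    act (matK B r T t)⁻¹
      ((P[fun ω' => ∫ s in Set.Ici t,
          act (Real.exp (-(r / 2) * ((s : ℝ) - (t : ℝ))) • (matK B r T s * B)) (TP s ω')
        | 𝓕 t]) ω)

end FrictionalMarket

end

open FrictionalMarket

/-! The only matrix in the system is `B`, a multiple of `Λ⁻¹ Σ`. It is similar to the symmetric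
positive definite matrix `Λ^(-1/2) Σ Λ^(-1/2)`, hence `B = V diag(b) U` with `U = V⁻¹` and all `b i
> 0` (`exists_matB_eq_conjDiag`). Then `G`, `K`, `F` and `exp (-∫ F)` are diagonal in the same
basis, and the equation splits into `d` scalar systems `x' = y`, `dy = dm + b (x - θ) dt + r y dt`,
`y(T) = 0`, all over the same filtration.

A scalar system is decoupled by a linear feedback. If `F' = F² + r F - b` and `F(T) = 0`, the
residual `z = y + F x` satisfies `dz = dm + ((r + F) z - b θ) dt` and `z(T) = 0`. With a positive
weight `p' = -(r + F) p` this becomes `d(p z) = p dm - p b θ dt`, so `p(t) z(t)` must be the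
conditional expectation of `∫ₜᵀ p b θ`. Hence `z` is the discounted target `η`, and `x' = η - F x`
gives the explicit formula by variation of constants (`IsFeedback.ae_eq_feedback`). This also proves
uniqueness; the increments of the martingale are then read off from the dynamics. Explicitly `F = -b
G' / K` and `p = e^{-r t / 2} K` (`isFeedback_scalar`).

For existence the argument is run backwards: `N` is a continuous version of the martingale closed by
`∫₀ᵀ p b θ`, `η = p⁻¹ (N - ∫₀ᵗ p b θ)`, `x` is given by the formula, `y = η - F x`, and `m = ∫ p⁻¹
dN` (`IsFeedback.exists_solution`). No stochastic integral occurs: the weights are deterministic and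
continuously differentiable, so `∫ c dM` means `c M - ∫ c' M` up to a constant, and
`martingale_weighted` shows by Fubini that this is a martingale.

Continuity of `N` is where the Brownian filtration enters (`hasContVersion_brownianFiltration`). For
bounded continuous functions of finitely many values of `W`, independence of increments gives an
explicit continuous version. Such functions lead, through a monotone class argument and `L¹`
approximation, to every closed martingale, and Doob's maximal inequality makes continuity survive
`L¹` limits.

Measurability rests on two facts: optional processes are progressive, so their time integrals are
adapted; and the filtration contains all null events, so almost surely continuous processes can be
corrected on a null event without losing adaptedness. -/

namespace FrictionalMarket

/-! ### Integrals over the time interval -/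

section TimeIntegrals

variable {T : ℝ}

instance isFiniteMeasure_volume_time : IsFiniteMeasure (volume : Measure (Time T)) :=
  ⟨by
    have h : (volume : Measure (Time T)) Set.univ = volume (Set.Icc 0 T) :=
      (comap_subtype_coe_apply measurableSet_Icc volume Set.univ).trans
        (by rw [Set.image_univ, Subtype.range_coe])
    rw [h, Real.volume_Icc]; exact ENNReal.ofReal_lt_top⟩

instance noAtoms_volume_time : NullSingletonClass (volume : Measure (Time T)) :=
  ⟨fun x => by
    have h : (volume : Measure (Time T)) {x} = volume ((↑) '' ({x} : Set (Time T)) : Set ℝ) :=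
      comap_subtype_coe_apply measurableSet_Icc volume {x}
    rw [h]; simp⟩

lemma map_coe_volume_time :
    Measure.map ((↑) : Time T → ℝ) volume = volume.restrict (Set.Icc 0 T) :=
  map_comap_subtype_coe measurableSet_Icc volume

/-- The constant extension of a function of time to the real line. -/
noncomputable def extend (hT : 0 ≤ T) {E : Type*} (f : Time T → E) : ℝ → E := Set.IccExtend hT f

@[simp] lemma extend_coe (hT : 0 ≤ T) {E : Type*} (f : Time T → E) (t : Time T) :
    extend hT f (t : ℝ) = f t := by
  simp [extend]

variable {E : Type*} [NormedAddCommGroup E] [NormedSpace ℝ E]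

lemma setIntegral_coe_time (f : ℝ → E) (A : Set ℝ) (hA : MeasurableSet A) :
    ∫ u in ((↑) : Time T → ℝ) ⁻¹' A, f u = ∫ u in A ∩ Set.Icc 0 T, f u := by
  rw [← Measure.restrict_restrict hA, ← map_coe_volume_time,
    (MeasurableEmbedding.subtype_coe measurableSet_Icc).setIntegral_map]

lemma setIntegral_time_Ioc (f : ℝ → E) {s t : Time T} (hst : s ≤ t) :
    ∫ u in Set.Ioc s t, f u = ∫ u in (s : ℝ)..t, f u := by
  have h : (Set.Ioc s t : Set (Time T)) = ((↑) : Time T → ℝ) ⁻¹' Set.Ioc (s : ℝ) t := by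
    ext u; simp
  rw [h, setIntegral_coe_time _ _ measurableSet_Ioc, intervalIntegral.integral_of_le hst,
    Set.inter_eq_left.2]
  intro u hu
  exact ⟨s.2.1.trans hu.1.le, hu.2.trans t.2.2⟩

lemma setIntegral_time_Iic (f : ℝ → E) (t : Time T) :
    ∫ u in Set.Iic t, f u = ∫ u in (0 : ℝ)..t, f u := by
  have h : (Set.Iic t : Set (Time T)) = ((↑) : Time T → ℝ) ⁻¹' Set.Iic (t : ℝ) := by
    ext u; simp
  rw [h, setIntegral_coe_time _ _ measurableSet_Iic, intervalIntegral.integral_of_le t.2.1,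
    ← integral_Icc_eq_integral_Ioc]
  congr 2
  ext u
  simp only [Set.mem_inter_iff, Set.mem_Iic, Set.mem_Icc]
  exact ⟨fun h => ⟨h.2.1, h.1⟩, fun h => ⟨h.2, h.1, h.2.trans t.2.2⟩⟩

lemma setIntegral_Iic_sub {f : Time T → E} (hf : Integrable f) {s t : Time T} (hst : s ≤ t) :
    ∫ u in Set.Iic t, f u = (∫ u in Set.Iic s, f u) + ∫ u in Set.Ioc s t, f u := by
  rw [← Set.Iic_union_Ioc_eq_Iic hst, setIntegral_union (Set.Iic_disjoint_Ioc le_rfl)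
    measurableSet_Ioc hf.integrableOn hf.integrableOn]

lemma setIntegral_Ici_eq {f : Time T → E} (s t : Time T) (ht : (t : ℝ) = T) :
    ∫ u in Set.Ici s, f u = ∫ u in Set.Ioc s t, f u := by
  rw [integral_Ici_eq_integral_Ioi]
  congr 2
  ext u
  have : u ≤ t := by
    change (u : ℝ) ≤ t
    rw [ht]; exact u.2.2
  simp [this]

lemma setIntegral_Iic_zero {f : Time T → E} (t : Time T) (ht : (t : ℝ) = 0) :
    ∫ u in Set.Iic t, f u = 0 := by
  have : (Set.Iic t : Set (Time T)) = {t} := by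
    ext u
    simp only [Set.mem_Iic, Set.mem_singleton_iff]
    refine ⟨fun h => le_antisymm h ?_, fun h => h.le⟩
    change (t : ℝ) ≤ u
    rw [ht]; exact u.2.1
  rw [this]
  simp


lemma integrable_extend (hT : 0 ≤ T) {G : Type*} [NormedAddCommGroup G] {f : Time T → G} (hf : Integrable f) :
    IntegrableOn (extend hT f) (Set.Icc 0 T) := by
  have h : Integrable (extend hT f ∘ ((↑) : Time T → ℝ)) volume := by
    refine hf.congr (ae_of_all _ fun t => ?_)
    simp
  rw [IntegrableOn, ← map_coe_volume_time]
  exact ((MeasurableEmbedding.subtype_coe measurableSet_Icc).integrable_map_iff).2 h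

lemma intervalIntegrable_extend (hT : 0 ≤ T) {G : Type*} [NormedAddCommGroup G] {f : Time T → G} (hf : Integrable f) :
    IntervalIntegrable (extend hT f) volume 0 T := by
  rw [intervalIntegrable_iff_integrableOn_Icc_of_le hT]
  exact integrable_extend hT hf

lemma continuous_extend (hT : 0 ≤ T) {F : Type*} [TopologicalSpace F] {f : Time T → F}
    (hf : Continuous f) : Continuous (extend hT f) :=
  hf.Icc_extend'

lemma integrable_of_continuous {G : Type*} [NormedAddCommGroup G] {f : Time T → G} (hf : Continuous f) : Integrable f := by
  have := hf.continuousOn.integrableOn_compact (μ := volume) (isCompact_univ (X := Time T))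
  simpa using this

lemma continuous_setIntegral_Iic (hT : 0 ≤ T) {f : Time T → E} (hf : Integrable f) :
    Continuous fun t => ∫ u in Set.Iic t, f u := by
  have h1 : ContinuousOn (fun t => ∫ u in (0 : ℝ)..t, extend hT f u) (Set.uIcc 0 T) :=
    intervalIntegral.continuousOn_primitive_interval'
      (intervalIntegrable_extend hT hf) Set.left_mem_uIcc
  rw [Set.uIcc_of_le hT, continuousOn_iff_continuous_domRestrict] at h1
  refine h1.congr fun t => ?_
  simp only [Set.domRestrict_apply]
  rw [← setIntegral_time_Iic]
  simp

/-- Integration by parts for `X = X(0) + ∫ a + m` against a continuously differentiable weight. -/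
theorem mul_sub_mul_eq_of_dynamics (hT : 0 ≤ T) {X a m : Time T → ℝ} {p p' : ℝ → ℝ}
    (hp : ∀ u, HasDerivAt p (p' u) u) (hp' : Continuous p') (hm : Continuous m)
    (ha : Integrable a)
    (h : ∀ s t, s ≤ t → X t - X s = (∫ u in Set.Ioc s t, a u) + (m t - m s)) {s t : Time T}
    (hst : s ≤ t) :
    p t * X t - p s * X s = (∫ u in Set.Ioc s t, (p' u * X u + p u * a u)) +
      ((p t * m t - p s * m s) - ∫ u in Set.Ioc s t, p' u * m u) := by
  have hpc : Continuous p := continuous_iff_continuousAt.2 fun u => (hp u).continuousAt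
  let z : Time T := ⟨0, le_rfl, hT⟩
  have hz : ∀ u : Time T, z ≤ u := fun u => u.2.1
  set a' := extend hT a with ha'
  have hint : IntervalIntegrable a' volume 0 T := intervalIntegrable_extend hT ha
  -- `X = A + m` with `A` absolutely continuous. The product rule is applied to `p A` only; `p m`
  -- enters the boundary terms and is compensated by `∫ p' m`, so `m` need not have bounded
  -- variation.
  set A : ℝ → ℝ := fun u => (X z - m z) + ∫ v in (0 : ℝ)..u, a' v with hA
  have hXm : ∀ u : Time T, X u = A u + m u := by
    intro u
    have := h z u (hz u)
    have h2 : ∫ v in Set.Ioc z u, a v = ∫ v in (0 : ℝ)..u, a' v := by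
      rw [← setIntegral_time_Ioc a' (hz u)]; simp [a']
    simp only [hA]; rw [h2] at this; linarith
  have hsub : Set.uIcc (s : ℝ) t ⊆ Set.uIcc 0 T := by
    rw [Set.uIcc_of_le (show (s : ℝ) ≤ t from hst), Set.uIcc_of_le hT]
    exact Set.Icc_subset_Icc s.2.1 t.2.2
  have hsub' : Set.uIoc (s : ℝ) t ⊆ Set.uIoc 0 T := by
    rw [Set.uIoc_of_le (show (s : ℝ) ≤ t from hst), Set.uIoc_of_le hT]
    exact Set.Ioc_subset_Ioc s.2.1 t.2.2
  have hint_st : IntervalIntegrable a' volume s t := hint.mono_set hsub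
  have hAac : AbsolutelyContinuousOnInterval A s t := by
    have h0 := (hint.absolutelyContinuousOnInterval_intervalIntegral (c := 0)
      Set.left_mem_uIcc).mono hsub
    have h1 : AbsolutelyContinuousOnInterval (fun _ : ℝ => X z - m z) s t :=
      (LipschitzWith.const (X z - m z)).lipschitzOnWith.absolutelyContinuousOnInterval
    exact h1.fun_add h0
  have hpac : AbsolutelyContinuousOnInterval p s t := by
    have h0 := ((hp'.intervalIntegrable s t).absolutelyContinuousOnInterval_intervalIntegral
      (c := (s : ℝ)) Set.left_mem_uIcc)
    have h1 : AbsolutelyContinuousOnInterval (fun _ : ℝ => p s) s t :=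
      (LipschitzWith.const (p s)).lipschitzOnWith.absolutelyContinuousOnInterval
    have h2 : p = fun u => p s + ∫ v in (s : ℝ)..u, p' v := by
      funext u
      rw [intervalIntegral.integral_eq_sub_of_hasDerivAt (fun x _ => hp x)
        (hp'.intervalIntegrable _ _)]
      ring
    rw [h2]
    exact h1.fun_add h0
  have hAd : ∀ᵐ u, u ∈ Set.uIcc 0 T → HasDerivAt A (a' u) u := by
    filter_upwards [hint.ae_hasDerivAt_integral] with u hu hu'
    exact (hu hu' 0 Set.left_mem_uIcc).const_add _
  have key := hpac.integral_deriv_mul_eq_sub hAac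
  have hAcont : ContinuousOn A (Set.uIcc (s : ℝ) t) := hAac.continuousOn
  have key2 : ∫ u in (s : ℝ)..t, (p' u * A u + p u * a' u) = p t * A t - p s * A s := by
    rw [← key]
    refine intervalIntegral.integral_congr_ae ?_
    filter_upwards [hAd] with u hu hu'
    rw [(hp u).deriv, (hu (hsub (Set.uIoc_subset_uIcc hu'))).deriv]
  have e1 : ∫ u in Set.Ioc s t, (p' u * X u + p u * a u) =
      ∫ u in (s : ℝ)..t, ((p' u * A u + p u * a' u) + p' u * extend hT m u) := by
    rw [← setIntegral_time_Ioc _ hst]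
    refine setIntegral_congr_fun measurableSet_Ioc fun u _ => ?_
    simp only [hXm u, a', extend_coe]
    ring
  have e2 : ∫ u in Set.Ioc s t, p' u * m u = ∫ u in (s : ℝ)..t, p' u * extend hT m u := by
    rw [← setIntegral_time_Ioc _ hst]
    simp
  have i1 : IntervalIntegrable (fun u => p' u * A u + p u * a' u) volume s t := by
    refine IntervalIntegrable.add ?_ ?_
    · exact (hp'.continuousOn.mul hAcont).intervalIntegrable
    · exact hint_st.continuousOn_mul hpc.continuousOn
  have i2 : IntervalIntegrable (fun u => p' u * extend hT m u) volume s t :=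
    (hp'.mul (continuous_extend hT hm)).intervalIntegrable _ _
  rw [e1, e2, intervalIntegral.integral_add i1 i2, key2, hXm t, hXm s]
  ring

/-- Product rule for `X = X(0) + ∫ a` against a continuously differentiable weight. -/
theorem mul_sub_mul_eq_of_rate (hT : 0 ≤ T) {X a : Time T → ℝ} {p p' : ℝ → ℝ}
    (hp : ∀ u, HasDerivAt p (p' u) u) (hp' : Continuous p') (ha : Integrable a)
    (h : ∀ t, X t = ∫ u in Set.Iic t, a u) {s t : Time T} (hst : s ≤ t) :
    p t * X t - p s * X s = ∫ u in Set.Ioc s t, (p' u * X u + p u * a u) := by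
  have := mul_sub_mul_eq_of_dynamics hT (m := fun _ => (0 : ℝ)) hp hp' continuous_const ha
    (X := X) (fun s t hst => by rw [h, h, setIntegral_Iic_sub ha hst]; ring) hst
  simpa using this

end TimeIntegrals

/-! ### Processes -/

section Processes

variable {Ω : Type*} [mΩ : MeasurableSpace Ω] {T : ℝ} {P : Measure Ω}
  {𝓕 : Filtration (Time T) mΩ}

/-- The smallest grid point of mesh `1 / (n + 1)` strictly after `t`, capped by `T`. -/
noncomputable def gridAfter (hT : 0 ≤ T) (n : ℕ) (t : Time T) : Time T :=
  Set.projIcc 0 T hT ((⌊(t : ℝ) * (n + 1)⌋₊ + 1) / (n + 1))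

/-- The largest grid point of mesh `1 / (n + 1)` before `t`. -/
noncomputable def gridBefore (hT : 0 ≤ T) (n : ℕ) (t : Time T) : Time T :=
  Set.projIcc 0 T hT (⌊(t : ℝ) * (n + 1)⌋₊ / (n + 1))

lemma le_gridAfter (hT : 0 ≤ T) (n : ℕ) (t : Time T) : t ≤ gridAfter hT n t := by
  have h : (t : ℝ) ≤ (⌊(t : ℝ) * (n + 1)⌋₊ + 1) / (n + 1) := by
    rw [le_div_iff₀ (by positivity)]
    exact (Nat.lt_floor_add_one _).le
  calc t = Set.projIcc 0 T hT (t : ℝ) := (Set.projIcc_val hT t).symm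
    _ ≤ _ := Set.monotone_projIcc hT h

lemma gridBefore_le (hT : 0 ≤ T) (n : ℕ) (t : Time T) : gridBefore hT n t ≤ t := by
  have h : (⌊(t : ℝ) * (n + 1)⌋₊ : ℝ) / (n + 1) ≤ t := by
    rw [div_le_iff₀ (by positivity)]
    exact Nat.floor_le (mul_nonneg t.2.1 (by positivity))
  calc _ ≤ Set.projIcc 0 T hT (t : ℝ) := Set.monotone_projIcc hT h
    _ = t := Set.projIcc_val hT t

lemma tendsto_gridBefore (hT : 0 ≤ T) (t : Time T) :
    Tendsto (fun n => gridBefore hT n t) atTop (𝓝 t) := by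
  have h1 : Tendsto (fun n : ℕ => (⌊(t : ℝ) * (n + 1)⌋₊ : ℝ) / (n + 1)) atTop (𝓝 t) :=
    (tendsto_nat_floor_mul_div_atTop t.2.1).comp
      (tendsto_natCast_atTop_atTop.atTop_add tendsto_const_nhds)
  have h2 := (continuous_projIcc (h := hT)).tendsto (t : ℝ) |>.comp h1
  rwa [Set.projIcc_val] at h2

lemma tendsto_gridAfter (hT : 0 ≤ T) (t : Time T) :
    Tendsto (fun n => gridAfter hT n t) atTop (𝓝 t) := by
  have h1 : Tendsto (fun n : ℕ => (⌊(t : ℝ) * (n + 1)⌋₊ : ℝ) / (n + 1)) atTop (𝓝 t) :=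
    (tendsto_nat_floor_mul_div_atTop t.2.1).comp
      (tendsto_natCast_atTop_atTop.atTop_add tendsto_const_nhds)
  have h3 : Tendsto (fun n : ℕ => ((⌊(t : ℝ) * (n + 1)⌋₊ : ℝ) + 1) / (n + 1)) atTop (𝓝 t) := by
    have := h1.add tendsto_one_div_add_atTop_nhds_zero_nat
    rw [add_zero] at this
    exact this.congr fun n => by rw [add_div]
  have h2 := (continuous_projIcc (h := hT)).tendsto (t : ℝ) |>.comp h3
  rwa [Set.projIcc_val] at h2

/-- Progressive measurability of a real process: the stopped process at each deterministic time is
jointly measurable with respect to the past. -/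
def IsProg (𝓕 : Filtration (Time T) mΩ) (X : Time T → Ω → ℝ) : Prop :=
  ∀ t, Measurable[Prod.instMeasurableSpace (m₂ := 𝓕 t)] fun p : Time T × Ω => X (min p.1 t) p.2

/-- Time is approximated from the right by grid points. Capping them at `t` keeps the approximations
measurable with respect to the past of `t`, and their countably many values make them jointly
measurable. -/
lemma isProg_of_rightContinuous (hT : 0 ≤ T) {X : Time T → Ω → ℝ} (hX : Adapted 𝓕 X)
    (hc : ∀ ω t, ContinuousWithinAt (fun t => X t ω) (Set.Ici t) t) : IsProg 𝓕 X := by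
  intro t
  let G : ℕ → ℕ → Time T := fun n k => Set.projIcc 0 T hT ((k + 1) / (n + 1))
  have hlim : ∀ p : Time T × Ω, Tendsto
      (fun n => X (min (gridAfter hT n (min p.1 t)) t) p.2) atTop (𝓝 (X (min p.1 t) p.2)) := by
    intro p
    have h0 : Tendsto (fun n => min (gridAfter hT n (min p.1 t)) t) atTop (𝓝 (min p.1 t)) := by
      have := (tendsto_gridAfter hT (min p.1 t)).min (tendsto_const_nhds (x := t))
      rwa [min_eq_left (min_le_right p.1 t)] at this
    have h1 : Tendsto (fun n => min (gridAfter hT n (min p.1 t)) t) atTop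
        (𝓝[Set.Ici (min p.1 t)] (min p.1 t)) :=
      tendsto_nhdsWithin_iff.2 ⟨h0, Eventually.of_forall fun n =>
        le_min (le_gridAfter hT n _) (min_le_right _ _)⟩
    exact (hc p.2 (min p.1 t)).tendsto.comp h1
  refine @measurable_of_tendsto_metrizable _ _ (Prod.instMeasurableSpace (m₂ := 𝓕 t)) _ _ _ _ _ _
    (fun n => ?_) (tendsto_pi_nhds.2 hlim)
  -- the approximation takes countably many time values
  change @Measurable _ _ (Prod.instMeasurableSpace (m₂ := 𝓕 t)) _
    ((fun q : ℕ × Ω => X (min (G n q.1) t) q.2) ∘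
      fun p : Time T × Ω => (⌊((min p.1 t : Time T) : ℝ) * (n + 1)⌋₊, p.2))
  refine @Measurable.comp (Time T × Ω) (ℕ × Ω) ℝ (Prod.instMeasurableSpace (m₂ := 𝓕 t))
    (Prod.instMeasurableSpace (m₂ := 𝓕 t)) _ _ _ ?_ ?_
  · refine @measurable_from_prod_countable_right ℕ Ω ℝ _ (𝓕 t) _ _ _ _ fun k => ?_
    exact (hX (min (G n k) t)).mono (𝓕.mono (min_le_right _ _)) le_rfl
  · have h1 : Measurable fun s : Time T => ⌊((min s t : Time T) : ℝ) * (n + 1)⌋₊ :=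
      Nat.measurable_floor.comp
        ((measurable_subtype_coe.comp (measurable_id.min measurable_const)).mul_const _)
    exact (h1.comp (@measurable_fst (Time T) Ω _ (𝓕 t))).prodMk (@measurable_snd (Time T) Ω _ (𝓕 t))

/-- It suffices to pull back the generators of the optional σ-algebra, and for an adapted càdlàg
process this is progressive measurability. Optional processes are therefore progressive. -/
lemma measurable_min_optionalSigma (hT : 0 ≤ T) (t : Time T) :
    @Measurable _ _ (Prod.instMeasurableSpace (m₂ := 𝓕 t)) (optionalSigma 𝓕)
      fun p : Time T × Ω => (min p.1 t, p.2) := by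
  rw [measurable_iff_comap_le, optionalSigma, MeasurableSpace.comap_iSup]
  refine iSup_le fun Y => ?_
  rw [MeasurableSpace.comap_comp, ← measurable_iff_comap_le, ← BorelSpace.measurable_eq (α := ℝ)]
  exact isProg_of_rightContinuous hT Y.2.1 (fun ω u => (Y.2.2 ω u).1) t

lemma isProg_of_optional (hT : 0 ≤ T) {X : Time T → Ω → ℝ}
    (hX : Measurable[optionalSigma 𝓕] fun p : Time T × Ω => X p.1 p.2) : IsProg 𝓕 X := fun t =>
  @Measurable.comp _ _ _ (Prod.instMeasurableSpace (m₂ := 𝓕 t)) (optionalSigma 𝓕) _ _ _ hX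
    (measurable_min_optionalSigma hT t)

lemma measurable_optional_of_continuous {X : Time T → Ω → ℝ} (hX : Adapted 𝓕 X)
    (hc : ∀ ω, Continuous fun t => X t ω) :
    Measurable[optionalSigma 𝓕] fun p : Time T × Ω => X p.1 p.2 := by
  have hcad : ∀ ω, IsCadlag fun t => X t ω := fun ω t =>
    ⟨(hc ω).continuousWithinAt, X t ω, ((hc ω).tendsto t).mono_left nhdsWithin_le_nhds⟩
  have h : (MeasurableSpace.comap (fun p : Time T × Ω => X p.1 p.2) (borel ℝ)) ≤
      optionalSigma 𝓕 :=
    le_iSup (fun Y : {Y : Time T → Ω → ℝ // Adapted 𝓕 Y ∧ ∀ ω, IsCadlag fun t => Y t ω} =>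
      MeasurableSpace.comap (fun p : Time T × Ω => Y.1 p.1 p.2) (borel ℝ)) ⟨X, hX, hcad⟩
  rw [measurable_iff_comap_le]
  rwa [← BorelSpace.measurable_eq (α := ℝ)] at h

lemma isProg_of_continuous (hT : 0 ≤ T) {X : Time T → Ω → ℝ} (hX : Adapted 𝓕 X)
    (hc : ∀ ω, Continuous fun t => X t ω) : IsProg 𝓕 X :=
  isProg_of_rightContinuous hT hX fun ω _ => (hc ω).continuousWithinAt

namespace IsProg

variable {X Y : Time T → Ω → ℝ}

lemma measurable_uncurry (hT : 0 ≤ T) (hX : IsProg 𝓕 X) :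
    Measurable fun p : Time T × Ω => X p.1 p.2 := by
  let t : Time T := ⟨T, hT, le_rfl⟩
  have h := hX t
  have h2 : (fun p : Time T × Ω => X (min p.1 t) p.2) = fun p => X p.1 p.2 := by
    funext p
    rw [min_eq_left (show p.1 ≤ t from p.1.2.2)]
  rw [h2] at h
  exact h.mono (sup_le_sup le_rfl (MeasurableSpace.comap_mono (𝓕.le t))) le_rfl

lemma adapted (hX : IsProg 𝓕 X) : Adapted 𝓕 X := by
  intro t
  have h : Measurable[𝓕 t] fun ω => X (min t t) ω :=
    @Measurable.comp _ _ _ (𝓕 t) (Prod.instMeasurableSpace (m₂ := 𝓕 t)) _ _ _ (hX t)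
      (@measurable_prodMk_left _ _ _ (𝓕 t) t)
  simpa using h

lemma det_mul {c : ℝ → ℝ} (hc : Continuous c) (hX : IsProg 𝓕 X) :
    IsProg 𝓕 fun t ω => c t * X t ω := by
  intro t
  refine @Measurable.mul _ _ _ _ (Prod.instMeasurableSpace (m₂ := 𝓕 t)) _ _ _ ?_ (hX t)
  have h : Measurable fun s : Time T => c ((min s t : Time T) : ℝ) :=
    (hc.measurable.comp measurable_subtype_coe).comp (measurable_id.min measurable_const)
  exact h.comp (@measurable_fst (Time T) Ω _ (𝓕 t))

/-- The running time integral of a progressive process is adapted. -/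
lemma adapted_integral (hX : IsProg 𝓕 X) : Adapted 𝓕 fun t ω => ∫ u in Set.Iic t, X u ω := by
  intro t
  have h1 : (fun ω => ∫ u in Set.Iic t, X u ω) = fun ω => ∫ u in Set.Iic t, X (min u t) ω := by
    funext ω
    refine setIntegral_congr_fun measurableSet_Iic fun u hu => ?_
    simp only [min_eq_left (show u ≤ t from hu)]
  have h2 : StronglyMeasurable[Prod.instMeasurableSpace (m₂ := 𝓕 t)]
      (fun p : Time T × Ω => X (min p.1 t) p.2) := (hX t).stronglyMeasurable
  change Measurable[𝓕 t] fun ω => ∫ u in Set.Iic t, X u ω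
  rw [h1]
  exact (@StronglyMeasurable.integral_prod_left _ _ _ _ (𝓕 t) (volume.restrict (Set.Iic t)) _ _ _
    (fun u ω => X (min u t) ω) h2).measurable

end IsProg

/-- An a.s. continuous process whose values agree a.s. with adapted random variables can be modified
on a null event to be continuous and adapted. -/
theorem exists_continuous_adapted_modification (hT : 0 ≤ T)
    (hnull : ∀ A, MeasurableSet A → P A = 0 → ∀ t, MeasurableSet[𝓕 t] A)
    {X : Time T → Ω → ℝ} (hc : ∀ᵐ ω ∂P, Continuous fun t => X t ω)
    (hX : ∀ t, ∃ g : Ω → ℝ, Measurable[𝓕 t] g ∧ X t =ᵐ[P] g) :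
    ∃ X' : Time T → Ω → ℝ, Adapted 𝓕 X' ∧ (∀ ω, Continuous fun t => X' t ω) ∧
      ∀ᵐ ω ∂P, ∀ t, X' t ω = X t ω := by
  choose g hg hXg using hX
  let G : ℕ → ℕ → Time T := fun n k => Set.projIcc 0 T hT (k / (n + 1))
  have hgood : ∀ᵐ ω ∂P, (Continuous fun t => X t ω) ∧ ∀ n k, X (G n k) ω = g (G n k) ω :=
    hc.and (ae_all_iff.2 fun n => ae_all_iff.2 fun k => hXg _)
  -- The bad event is enlarged to a measurable null event, which belongs to every `𝓕 t`; setting the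
  -- process to zero there preserves adaptedness.
  obtain ⟨A, hAsub, hA, hPA⟩ := exists_measurable_superset_of_null (ae_iff.1 hgood)
  have hgoodA : ∀ ω, ω ∉ A → (Continuous fun t => X t ω) ∧ ∀ n k, X (G n k) ω = g (G n k) ω := by
    intro ω hω
    by_contra h
    exact hω (hAsub h)
  refine ⟨fun t => Aᶜ.indicator (X t), fun t => ?_, fun ω => ?_, ?_⟩
  -- Grid points before `t` are used so that the approximating variables are known at time `t`. Only
  -- countably many of the almost sure identities are needed.
  · have hlim : ∀ ω, Tendsto (fun n => Aᶜ.indicator (g (gridBefore hT n t)) ω) atTop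
        (𝓝 (Aᶜ.indicator (X t) ω)) := by
      intro ω
      by_cases hω : ω ∈ A
      · simp [hω]
      · have h1 := ((hgoodA ω hω).1.tendsto t).comp (tendsto_gridBefore hT t)
        simp only [Set.indicator, Set.mem_compl_iff, hω, not_false_eq_true, if_true]
        refine h1.congr fun n => (hgoodA ω hω).2 n _
    refine @measurable_of_tendsto_metrizable _ _ (𝓕 t) _ _ _ _ _ _ (fun n => ?_)
      (tendsto_pi_nhds.2 hlim)
    exact ((hg _).mono (𝓕.mono (gridBefore_le hT n t)) le_rfl).indicator (hnull A hA hPA t).compl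
  · by_cases hω : ω ∈ A
    · simpa [hω] using continuous_const
    · simpa [hω] using (hgoodA ω hω).1
  · have : ∀ᵐ ω ∂P, ω ∉ A := by rwa [ae_iff, show {ω | ¬ω ∉ A} = A by ext; simp]
    filter_upwards [this] with ω hω t
    simp [hω]

/-- Two a.s. continuous processes which agree a.s. at each time are indistinguishable. -/
theorem ae_forall_eq_of_continuous {E : Type*} [TopologicalSpace E] [T2Space E]
    {X Y : Time T → Ω → E} (hX : ∀ᵐ ω ∂P, Continuous fun t => X t ω)
    (hY : ∀ᵐ ω ∂P, Continuous fun t => Y t ω) (h : ∀ t, X t =ᵐ[P] Y t) :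
    ∀ᵐ ω ∂P, ∀ t, X t ω = Y t ω := by
  obtain ⟨D, hD, hDd⟩ := TopologicalSpace.exists_countable_dense (Time T)
  have : ∀ᵐ ω ∂P, ∀ t ∈ D, X t ω = Y t ω := (ae_ball_iff hD).2 fun t _ => h t
  filter_upwards [hX, hY, this] with ω h1 h2 h3 t
  exact congrFun (Continuous.ext_on hDd h1 h2 h3) t

end Processes

/-! ### Continuous versions of closed martingales -/

section ContinuousVersions

open scoped NNReal

variable {Ω : Type*} [mΩ : MeasurableSpace Ω] {T : ℝ} {P : Measure Ω}
  {𝓕 : Filtration (Time T) mΩ}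

/-- The martingale closed by `ξ` has a version with a.s. continuous paths. -/
def HasContVersion (𝓕 : Filtration (Time T) mΩ) (P : Measure Ω) (ξ : Ω → ℝ) : Prop :=
  ∃ M : Time T → Ω → ℝ, (∀ᵐ ω ∂P, Continuous fun t => M t ω) ∧ ∀ t, M t =ᵐ[P] P[ξ | 𝓕 t]

lemma HasContVersion.congr {ξ ξ' : Ω → ℝ} (h : HasContVersion 𝓕 P ξ) (hξ : ξ =ᵐ[P] ξ') :
    HasContVersion 𝓕 P ξ' := by
  obtain ⟨M, hc, hM⟩ := h
  exact ⟨M, hc, fun t => (hM t).trans (condExp_congr_ae hξ)⟩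

lemma HasContVersion.add {ξ ξ' : Ω → ℝ} (h : HasContVersion 𝓕 P ξ) (h' : HasContVersion 𝓕 P ξ')
    (hξ : Integrable ξ P) (hξ' : Integrable ξ' P) : HasContVersion 𝓕 P (ξ + ξ') := by
  obtain ⟨M, hc, hM⟩ := h
  obtain ⟨M', hc', hM'⟩ := h'
  refine ⟨fun t => M t + M' t, ?_, fun t => ?_⟩
  · filter_upwards [hc, hc'] with ω h1 h2 using h1.add h2
  · exact ((hM t).add (hM' t)).trans (condExp_add hξ hξ' _).symm

lemma HasContVersion.const_smul {ξ : Ω → ℝ} (h : HasContVersion 𝓕 P ξ) (c : ℝ) :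
    HasContVersion 𝓕 P (c • ξ) := by
  obtain ⟨M, hc, hM⟩ := h
  refine ⟨fun t => c • M t, ?_, fun t => ?_⟩
  · filter_upwards [hc] with ω h1 using h1.const_smul c
  · exact ((hM t).const_smul c).trans (condExp_smul c ξ _).symm

lemma HasContVersion.const [IsFiniteMeasure P] (c : ℝ) : HasContVersion 𝓕 P fun _ => c :=
  ⟨fun _ _ => c, ae_of_all _ fun _ => continuous_const, fun t => by
    rw [condExp_const (𝓕.le t)]⟩

/-- The `k`-th dyadic time of level `n`. -/
noncomputable def dyadicTime (hT : 0 ≤ T) (n k : ℕ) : Time T :=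
  Set.projIcc 0 T hT ((k : ℝ) / 2 ^ n * T)

lemma monotone_dyadicTime (hT : 0 ≤ T) (n : ℕ) : Monotone (dyadicTime hT n) := by
  intro k l hkl
  refine Set.monotone_projIcc hT ?_
  have : (k : ℝ) ≤ l := by exact_mod_cast hkl
  gcongr

/-- The dyadic grids are nested, which makes the exceedance events in the maximal inequality
increase with the level. -/
lemma dyadicTime_succ (hT : 0 ≤ T) (n k : ℕ) :
    dyadicTime hT (n + 1) (2 * k) = dyadicTime hT n k := by
  unfold dyadicTime
  congr 1
  push_cast
  rw [pow_succ]
  field_simp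

lemma exists_tendsto_dyadicTime (hT : 0 < T) (t : Time T) :
    ∃ k : ℕ → ℕ, (∀ n, k n ≤ 2 ^ n) ∧
      Tendsto (fun n => dyadicTime hT.le n (k n)) atTop (𝓝 t) := by
  have h0 : 0 ≤ (t : ℝ) / T := div_nonneg t.2.1 hT.le
  have h1 : (t : ℝ) / T ≤ 1 := (div_le_one hT).2 t.2.2
  refine ⟨fun n => ⌊(t : ℝ) / T * (2 : ℝ) ^ n⌋₊, fun n => ?_, ?_⟩
  · refine Nat.floor_le_of_le ?_
    push_cast
    exact mul_le_of_le_one_left (by positivity) h1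
  · have h2 : Tendsto (fun n : ℕ => (⌊(t : ℝ) / T * (2 : ℝ) ^ n⌋₊ : ℝ) / (2 : ℝ) ^ n) atTop
        (𝓝 ((t : ℝ) / T)) :=
      (tendsto_nat_floor_mul_div_atTop h0).comp (tendsto_pow_atTop_atTop_of_one_lt one_lt_two)
    have h3 := h2.mul_const T
    rw [div_mul_cancel₀ _ hT.ne'] at h3
    have h4 := (continuous_projIcc (h := hT.le)).tendsto (t : ℝ) |>.comp h3
    rwa [Set.projIcc_val] at h4

/-- Doob's maximal inequality for a continuous version of a closed martingale. -/
theorem mul_measure_exists_lt_abs_le [IsFiniteMeasure P] (hT : 0 < T) {ξ : Ω → ℝ}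
    {M : Time T → Ω → ℝ} (hc : ∀ᵐ ω ∂P, Continuous fun t => M t ω)
    (hM : ∀ t, M t =ᵐ[P] P[ξ | 𝓕 t]) (ε : ℝ≥0) :
    ε * P {ω | ∃ t, (ε : ℝ) < |M t ω|} ≤ ENNReal.ofReal (∫ ω, |ξ ω| ∂P) := by
  set S : ℕ → Set Ω := fun n => {ω | ∃ k ≤ 2 ^ n, (ε : ℝ) < |M (dyadicTime hT.le n k) ω|} with hS
  have hSmono : Monotone S := by
    refine monotone_nat_of_le_succ fun n ω hω => ?_
    obtain ⟨k, hk, h⟩ := hω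
    refine ⟨2 * k, by rw [pow_succ]; omega, ?_⟩
    rwa [dyadicTime_succ]
  -- A strict exceedance is an open condition, so on a continuous path it already occurs at a dyadic
  -- time.
  have hsub : {ω | ∃ t, (ε : ℝ) < |M t ω|} ≤ᵐ[P] ⋃ n, S n := by
    filter_upwards [hc] with ω hω hex
    obtain ⟨t, ht⟩ := hex
    obtain ⟨k, hk, hlim⟩ := exists_tendsto_dyadicTime hT t
    have h1 := ((hω.abs).tendsto t).comp hlim
    obtain ⟨n, hn⟩ := (h1.eventually (lt_mem_nhds ht)).exists
    exact Set.mem_iUnion.2 ⟨n, k n, hk n, hn⟩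
  have hSn : ∀ n, ε * P (S n) ≤ ENNReal.ofReal (∫ ω, |ξ ω| ∂P) := by
    intro n
    let 𝒢 : Filtration ℕ mΩ :=
      { seq := fun k => 𝓕 (dyadicTime hT.le n k)
        mono' := fun k l hkl => 𝓕.mono (monotone_dyadicTime hT.le n hkl)
        le' := fun k => 𝓕.le _ }
    have hmart : Martingale (fun k => P[ξ | 𝒢 k]) 𝒢 P := martingale_condExp ξ 𝒢 P
    -- The absolute value is the supremum of the martingale and its negative, hence a nonnegative
    -- submartingale.
    have hsubm := hmart.submartingale.sup hmart.neg.submartingale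
    have hmax := maximal_ineq hsubm (fun k ω => abs_nonneg (P[ξ | 𝒢 k] ω)) (ε := ε) (2 ^ n)
    refine (mul_le_mul_right ?_ _).trans (hmax.trans (ENNReal.ofReal_le_ofReal ?_))
    · refine measure_mono_ae ?_
      have hall : ∀ᵐ ω ∂P, ∀ k, M (dyadicTime hT.le n k) ω = P[ξ | 𝒢 k] ω :=
        ae_all_iff.2 fun k => hM _
      filter_upwards [hall] with ω hω hex
      obtain ⟨k, hk, h⟩ := hex
      rw [hω k] at h
      exact h.le.trans (Finset.le_sup' (f := fun k => |P[ξ | 𝒢 k] ω|)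
        (Finset.mem_range.2 (Nat.lt_succ_of_le hk)))
    · refine (setIntegral_le_integral (hsubm.integrable _)
        (ae_of_all _ fun ω => abs_nonneg _)).trans ?_
      exact integral_abs_condExp_le ξ
  calc ε * P {ω | ∃ t, (ε : ℝ) < |M t ω|} ≤ ε * P (⋃ n, S n) :=
        mul_le_mul_right (measure_mono_ae hsub) _
    _ = ⨆ n, ε * P (S n) := by
        rw [hSmono.measure_iUnion, ENNReal.mul_iSup]
    _ ≤ _ := iSup_le hSn

/-- Closed martingales with a continuous version are stable under `L¹` limits. -/
theorem hasContVersion_of_approx [IsFiniteMeasure P] (hT : 0 < T) {ξ : Ω → ℝ}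
    (hξ : Integrable ξ P)
    (h : ∀ ε > 0, ∃ ξ' : Ω → ℝ, Integrable ξ' P ∧ HasContVersion 𝓕 P ξ' ∧
      ∫ ω, |ξ ω - ξ' ω| ∂P ≤ ε) : HasContVersion 𝓕 P ξ := by
  have hpos : ∀ n : ℕ, (0 : ℝ) < (1 / 4) ^ n := fun n => by positivity
  -- With `L¹` errors of order `4⁻ⁿ` and threshold `2⁻ⁿ`, the maximal inequality bounds the
  -- exceedance probabilities by `2 · 2⁻ⁿ`. Both these and the thresholds are summable, so
  -- Borel–Cantelli gives uniform convergence of almost every path.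
  choose ξ' hint hver hdist using fun n : ℕ => h ((1 / 4) ^ n) (hpos n)
  choose M hc hM using hver
  have hdiff : ∀ n t, (fun ω => M (n + 1) t ω - M n t ω) =ᵐ[P] P[ξ' (n + 1) - ξ' n | 𝓕 t] :=
    fun n t => ((hM (n + 1) t).sub (hM n t)).trans (condExp_sub (hint _) (hint _) _).symm
  have hL1 : ∀ n, ∫ ω, |(ξ' (n + 1) - ξ' n) ω| ∂P ≤ 2 * (1 / 4) ^ n := by
    intro n
    have h1 : ∫ ω, |(ξ' (n + 1) - ξ' n) ω| ∂P ≤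
        ∫ ω, (|ξ ω - ξ' (n + 1) ω| + |ξ ω - ξ' n ω|) ∂P := by
      refine integral_mono ((hint _).sub (hint _)).abs
        ((hξ.sub (hint _)).abs.add (hξ.sub (hint _)).abs) fun ω => ?_
      have := abs_sub_abs_le_abs_sub (ξ ω) (ξ' n ω)
      simp only [Pi.sub_apply]
      calc |ξ' (n + 1) ω - ξ' n ω| = |(ξ ω - ξ' n ω) - (ξ ω - ξ' (n + 1) ω)| := by congr 1; ring
        _ ≤ |ξ ω - ξ' n ω| + |ξ ω - ξ' (n + 1) ω| := abs_sub _ _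
        _ = _ := add_comm _ _
    rw [integral_add (f := fun ω => |ξ ω - ξ' (n + 1) ω|) (g := fun ω => |ξ ω - ξ' n ω|)
      (hξ.sub (hint _)).abs (hξ.sub (hint _)).abs] at h1
    have h2 := hdist (n + 1)
    have h3 := hdist n
    have h4 : ((1 : ℝ) / 4) ^ (n + 1) ≤ (1 / 4) ^ n :=
      pow_le_pow_of_le_one (by norm_num) (by norm_num) n.le_succ
    linarith
  have hprob : ∀ n : ℕ, P {ω | ∃ t, (((1 / 2 : ℝ≥0) ^ n : ℝ≥0) : ℝ) < |M (n + 1) t ω - M n t ω|} ≤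
      ENNReal.ofReal (2 * (1 / 2) ^ n) := by
    intro n
    have hcd : ∀ᵐ ω ∂P, Continuous fun t => M (n + 1) t ω - M n t ω := by
      filter_upwards [hc (n + 1), hc n] with ω h1 h2 using h1.sub h2
    have h1 := (mul_measure_exists_lt_abs_le hT hcd (hdiff n) ((1 / 2) ^ n)).trans
      (ENNReal.ofReal_le_ofReal (hL1 n))
    have h2 : ((((1 / 2 : ℝ≥0) ^ n : ℝ≥0)) : ℝ≥0∞) = ENNReal.ofReal ((1 / 2) ^ n) := by
      rw [ENNReal.ofReal, Real.toNNReal_pow (by norm_num)]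
      congr 2
      ext; simp
    have h3 : (2 : ℝ) * (1 / 4) ^ n = (1 / 2) ^ n * (2 * (1 / 2) ^ n) := by
      rw [show (1 / 4 : ℝ) = 1 / 2 * (1 / 2) by norm_num, mul_pow]; ring
    rw [h2, h3, ENNReal.ofReal_mul (by positivity)] at h1
    exact (ENNReal.mul_le_mul_iff_right (by simp) ENNReal.ofReal_ne_top).1 h1
  have hBC : ∀ᵐ ω ∂P, ∀ᶠ n in atTop,
      ω ∉ {ω | ∃ t, (((1 / 2 : ℝ≥0) ^ n : ℝ≥0) : ℝ) < |M (n + 1) t ω - M n t ω|} := by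
    refine ae_eventually_notMem (ne_top_of_le_ne_top ?_ (ENNReal.tsum_le_tsum hprob))
    have hs : Summable fun n : ℕ => (2 : ℝ) * (1 / 2) ^ n :=
      (summable_geometric_of_lt_one (by norm_num) (by norm_num)).mul_left 2
    rw [← ENNReal.ofReal_tsum_of_nonneg (fun n => by positivity) hs]
    exact ENNReal.ofReal_ne_top
  have hlim : ∀ᵐ ω ∂P, ∃ f : Time T → ℝ, Continuous f ∧
      ∀ t, Tendsto (fun n => M n t ω) atTop (𝓝 (f t)) := by
    filter_upwards [hBC, ae_all_iff.2 hc] with ω hω hcω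
    obtain ⟨N, hN⟩ := eventually_atTop.1 hω
    have hb : ∀ n t, dist (M (n + N) t ω) (M (n + 1 + N) t ω) ≤ (1 / 2) ^ N *
        (1 / 2) ^ n := by
      intro n t
      have h1 := hN (n + N) (Nat.le_add_left _ _)
      simp only [not_exists, not_lt] at h1
      have h2 := h1 t
      rw [dist_comm, Real.dist_eq, show n + 1 + N = n + N + 1 by ring]
      refine h2.trans_eq ?_
      push_cast
      rw [pow_add]; ring
    have hcau : ∀ t, CauchySeq fun n => M (n + N) t ω := fun t =>
      cauchySeq_of_le_geometric _ _ (by norm_num) fun n => hb n t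
    choose f hf using fun t => cauchySeq_tendsto_of_complete (hcau t)
    refine ⟨f, ?_, fun t => (tendsto_add_atTop_iff_nat N).1 (hf t)⟩
    have hunif : TendstoUniformly (fun n t => M (n + N) t ω) f atTop := by
      rw [Metric.tendstoUniformly_iff]
      intro ε hε
      have hz : Tendsto (fun n : ℕ => (1 / 2 : ℝ) ^ N * (1 / 2) ^ n /
          (1 - 1 / 2)) atTop (𝓝 0) := by
        have := (tendsto_pow_atTop_nhds_zero_of_lt_one (r := (1 / 2 : ℝ)) (by norm_num)
          (by norm_num)).const_mul ((1 / 2 : ℝ) ^ N)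
        have := this.div_const (1 - 1 / 2)
        simpa using this
      filter_upwards [hz.eventually (gt_mem_nhds hε)] with n hn t
      rw [dist_comm]
      exact (dist_le_of_le_geometric_of_tendsto _ _ (by norm_num) (fun n => hb n t)
        (hf t) n).trans_lt hn
    exact hunif.continuous (Frequently.of_forall fun n => hcω (n + N))
  refine ⟨fun t ω => limUnder atTop fun n => M n t ω, ?_, fun t => ?_⟩
  · filter_upwards [hlim] with ω ⟨f, hf, hlim⟩
    exact hf.congr fun t => ((hlim t).limUnder_eq).symm
  -- The pathwise limit and the conditional expectation of `ξ` are both limits in measure of the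
  -- same sequence, hence almost surely equal.
  · have h1 : TendstoInMeasure P (fun n => M n t) atTop (fun ω => limUnder atTop fun n => M n t ω) := by
      refine tendstoInMeasure_of_tendsto_ae (fun n => ?_) ?_
      · exact (stronglyMeasurable_condExp.mono (𝓕.le t)).aestronglyMeasurable.congr (hM n t).symm
      · filter_upwards [hlim] with ω ⟨f, _, hlim⟩
        rw [(hlim t).limUnder_eq]
        exact hlim t
    have h2 : TendstoInMeasure P (fun n => M n t) atTop (P[ξ | 𝓕 t]) := by
      refine tendstoInMeasure_of_tendsto_eLpNorm one_ne_zero (fun n => ?_) ?_ ?_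
      · exact (stronglyMeasurable_condExp.mono (𝓕.le t)).aestronglyMeasurable.congr (hM n t).symm
      · exact (stronglyMeasurable_condExp.mono (𝓕.le t)).aestronglyMeasurable
      · have h3 : ∀ n, eLpNorm (M n t - P[ξ | 𝓕 t]) 1 P ≤ ENNReal.ofReal ((1 / 4) ^ n) := by
          intro n
          have h4 : M n t - P[ξ | 𝓕 t] =ᵐ[P] P[ξ' n - ξ | 𝓕 t] :=
            ((hM n t).sub (ae_eq_refl _)).trans (condExp_sub (hint n) hξ _).symm
          rw [eLpNorm_congr_ae h4]
          refine (eLpNorm_condExp_le_eLpNorm _ le_rfl).trans ?_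
          rw [eLpNorm_one_eq_lintegral_enorm, ← ofReal_integral_norm_eq_lintegral_enorm
            ((hint n).sub hξ)]
          refine ENNReal.ofReal_le_ofReal (le_trans (le_of_eq ?_) (hdist n))
          refine integral_congr_ae (ae_of_all _ fun ω => ?_)
          simp [Real.norm_eq_abs, abs_sub_comm]
        refine tendsto_of_tendsto_of_tendsto_of_le_of_le tendsto_const_nhds ?_
          (fun _ => zero_le) h3
        rw [← ENNReal.ofReal_zero]
        exact ENNReal.tendsto_ofReal
          (tendsto_pow_atTop_nhds_zero_of_lt_one (by norm_num) (by norm_num))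
    exact tendstoInMeasure_ae_unique h1 h2

end ContinuousVersions

/-! ### Continuity of martingales in the Brownian filtration -/

section BrownianContinuity

open scoped NNReal

/-- Independence of increments is used along monotone sequences indexed by `ℕ`; a finite set of
times is listed in order and the list is then continued by its last element. -/
lemma exists_monotone_enumeration {α : Type*} [LinearOrder α] (A : Finset α) (hA : A.Nonempty) :
    ∃ τ : ℕ → α, Monotone τ ∧ ∀ a ∈ A, ∃ k, τ k = a := by
  have hpos : 0 < A.card := hA.card_pos
  refine ⟨fun k => A.orderEmbOfFin rfl ⟨min k (A.card - 1), by omega⟩, fun k l hkl => ?_,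
    fun a ha => ?_⟩
  · refine (A.orderEmbOfFin rfl).monotone ?_
    simp only [Fin.mk_le_mk]
    omega
  · have : a ∈ Set.range (A.orderEmbOfFin rfl) := by simpa using ha
    obtain ⟨i, hi⟩ := this
    refine ⟨i, ?_⟩
    rw [← hi]
    exact congrArg _ (Fin.ext (min_eq_left (by omega)))

variable {Ω : Type*} [mΩ : MeasurableSpace Ω] {T : ℝ} {P : Measure Ω} {d : ℕ}
  {W : Time T → Ω → Fin d → ℝ}

/-- The past of a Brownian motion is independent of its later increments. -/
theorem IsBrownianMotion.indepFun_past_increments [IsProbabilityMeasure P] (hT : 0 ≤ T)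
    (hW : IsBrownianMotion W P) (t : Time T) (J : Finset (Time T)) :
    IndepFun (fun ω (u : Set.Iic t) => W u ω)
      (fun ω (j : J) => W j ω - W (min (j : Time T) t) ω) P := by
  let z : Time T := ⟨0, le_rfl, hT⟩
  have hz : ∀ u : Time T, z ≤ u := fun u => u.2.1
  have hYm : Measurable (fun ω (j : J) => W j ω - W (min (j : Time T) t) ω) :=
    measurable_pi_lambda _ fun j => (hW.measurable _).sub (hW.measurable _)
  -- `W` starts at zero only almost surely, so the past is first expressed through increments.
  suffices h : IndepFun (fun ω (u : Set.Iic t) => W u ω - W z ω)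
      (fun ω (j : J) => W j ω - W (min (j : Time T) t) ω) P by
    refine IndepFun.process_congr_left (X := fun (u : Set.Iic t) ω => W u ω - W z ω) h fun u => ?_
    filter_upwards [hW.start z rfl] with ω hω
    simp [hω]
  refine IndepFun.process_indepFun (X := fun (u : Set.Iic t) ω => W u ω - W z ω)
    (fun u => (hW.measurable _).sub (hW.measurable _)) hYm fun I => ?_
  -- One ordered list contains `0`, `t`, the past times and the times in `J`. Past values are sums
  -- of increments with index below `k₀`, later increments are sums with index at least `k₀`, and
  -- these two blocks are independent.
  obtain ⟨τ, hτ, hτA⟩ := exists_monotone_enumeration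
    (insert z (insert t (I.image ((↑) : Set.Iic t → Time T) ∪ J))) (by simp)
  obtain ⟨kz, hkz⟩ := hτA z (by simp)
  have hτ0 : τ 0 = z := le_antisymm (hkz ▸ hτ (Nat.zero_le _)) (hz _)
  obtain ⟨k₀, hk₀⟩ := hτA t (by simp)
  set D : ℕ → Ω → Fin d → ℝ := fun i ω => W (τ (i + 1)) ω - W (τ i) ω with hD
  have hDm : ∀ i, Measurable (D i) := fun i => (hW.measurable _).sub (hW.measurable _)
  have hind : iIndepFun D P := hW.indep_increments.nat hτ
  have hsplit := indep_iSup_of_disjoint (m := fun i => MeasurableSpace.comap (D i) inferInstance)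
    (fun i => (hDm i).comap_le) hind (S := Set.Iio k₀) (T := Set.Ici k₀)
    (Set.disjoint_left.2 fun i (hi : i < k₀) (hi' : k₀ ≤ i) => not_lt.2 hi' hi)
  have hDS : ∀ (S : Set ℕ) (i : ℕ), i ∈ S →
      Measurable[⨆ i ∈ S, MeasurableSpace.comap (D i) inferInstance] (D i) := fun S i hi =>
    measurable_iff_comap_le.2
      (le_iSup₂ (f := fun i (_ : i ∈ S) => MeasurableSpace.comap (D i) inferInstance) i hi)
  rw [IndepFun_iff_Indep]
  refine indep_of_indep_of_le_left (indep_of_indep_of_le_right hsplit ?_) ?_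
  · rw [← measurable_iff_comap_le]
    refine @measurable_pi_lambda _ _ _ (_) _ _ fun j => ?_
    obtain ⟨k, hk⟩ := hτA j (by simp)
    rcases le_total (j : Time T) t with hjt | htj
    · simp only [min_eq_left hjt, sub_self]
      exact measurable_const
    -- The list may repeat values, so an index of `j` can lie below `k₀`; then `j = t` and `k₀`
    -- itself serves.
    · have hk' : ∃ k, k₀ ≤ k ∧ τ k = j := by
        rcases le_total k₀ k with h | h
        · exact ⟨k, h, hk⟩
        · refine ⟨k₀, le_rfl, le_antisymm (hk₀ ▸ htj) (hk ▸ hτ h)⟩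
      obtain ⟨l, hl, hlj⟩ := hk'
      have : (fun ω => W j ω - W (min (j : Time T) t) ω) =
          fun ω => ∑ i ∈ Finset.Ico k₀ l, D i ω := by
        funext ω
        rw [min_eq_right htj, ← hlj, ← hk₀, Finset.sum_Ico_eq_sub _ hl]
        simp only [hD]
        rw [Finset.sum_range_sub (fun i => W (τ i) ω), Finset.sum_range_sub (fun i => W (τ i) ω)]
        abel
      rw [this]
      exact Finset.measurable_fun_sum _ fun i hi => hDS _ i (Finset.mem_Ico.1 hi).1
  · rw [← measurable_iff_comap_le]
    refine @measurable_pi_lambda _ _ _ (_) _ _ fun u => ?_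
    obtain ⟨k, hk⟩ := hτA (u : Set.Iic t) (by
      simp only [Finset.mem_insert, Finset.mem_union, Finset.mem_image]
      exact Or.inr (Or.inr (Or.inl ⟨u, u.2, rfl⟩)))
    have hut : ((u : Set.Iic t) : Time T) ≤ t := (u : Set.Iic t).2
    have hk' : ∃ k, k ≤ k₀ ∧ τ k = (u : Set.Iic t) := by
      rcases le_total k k₀ with h | h
      · exact ⟨k, h, hk⟩
      · refine ⟨k₀, le_rfl, le_antisymm (hk ▸ hτ h) (hk₀ ▸ hut)⟩
    obtain ⟨l, hl, hlj⟩ := hk'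
    have : (fun ω => W (u : Set.Iic t) ω - W z ω) =
        fun ω => ∑ i ∈ Finset.range l, D i ω := by
      funext ω
      simp only [hD]
      rw [Finset.sum_range_sub (fun i => W (τ i) ω), hτ0, hlj]
    rw [this]
    exact Finset.measurable_fun_sum _ fun i hi => hDS _ i ((Finset.mem_range.1 hi).trans_le hl)

/-- Freezing: the independent variable can be integrated out on events of the past. -/
theorem setIntegral_comp_add_of_indep {Ω : Type*} {m mΩ : MeasurableSpace Ω} {P : Measure Ω}
    [IsProbabilityMeasure P] (hm : m ≤ mΩ) {E : Type*} [MeasurableSpace E] [Add E] [MeasurableAdd₂ E] {X Y : Ω → E}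
    (hX : Measurable[m] X) (hY : Measurable Y)
    (hind : Indep m (MeasurableSpace.comap Y inferInstance) P) {f : E → ℝ} (hf : Measurable f)
    {C : ℝ} (hC : ∀ x, |f x| ≤ C) {A : Set Ω} (hA : MeasurableSet[m] A) :
    ∫ ω in A, f (X ω + Y ω) ∂P = ∫ ω in A, ∫ ω', f (X ω + Y ω') ∂P ∂P := by
  -- Carrying the indicator of `A` along with `X` turns the set integral into the expectation of a
  -- function of the independent pair `(Z, Y)`, to which Fubini applies.
  set Z : Ω → ℝ × E := fun ω => (A.indicator 1 ω, X ω) with hZ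
  have h1A : Measurable[m] (A.indicator (1 : Ω → ℝ)) :=
    (@measurable_const _ _ _ m (1 : ℝ)).indicator hA
  have hZm : Measurable[m] Z := h1A.prodMk hX
  have hZm' : Measurable Z := hZm.mono hm le_rfl
  have hZY : IndepFun Z Y P := by
    rw [IndepFun_iff_Indep]
    exact indep_of_indep_of_le_left hind hZm.comap_le
  set Φ : (ℝ × E) × E → ℝ := fun z => z.1.1 * f (z.1.2 + z.2) with hΦ
  have hΦm : Measurable Φ :=
    (measurable_fst.comp measurable_fst).mul
      (hf.comp ((measurable_snd.comp measurable_fst).add measurable_snd))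
  have hZYm : Measurable fun ω => (Z ω, Y ω) := hZm'.prodMk hY
  have hΦint : Integrable Φ (P.map fun ω => (Z ω, Y ω)) := by
    rw [integrable_map_measure hΦm.aestronglyMeasurable hZYm.aemeasurable]
    refine Integrable.of_bound (hΦm.comp hZYm).aestronglyMeasurable C (ae_of_all _ fun ω => ?_)
    simp only [hΦ, hZ, Function.comp, Real.norm_eq_abs, abs_mul]
    have h0 : 0 ≤ C := (abs_nonneg _).trans (hC (X ω + Y ω))
    by_cases hω : ω ∈ A
    · simpa [hω] using hC _
    · simpa [hω] using h0
  have hind_eq : ∀ (g : Ω → ℝ) , ∫ ω in A, g ω ∂P = ∫ ω, A.indicator 1 ω * g ω ∂P := by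
    intro g
    rw [← integral_indicator (hm _ hA)]
    refine integral_congr_ae (ae_of_all _ fun ω => ?_)
    by_cases hω : ω ∈ A <;> simp [hω]
  calc ∫ ω in A, f (X ω + Y ω) ∂P = ∫ ω, Φ (Z ω, Y ω) ∂P := hind_eq _
    _ = ∫ z, Φ z ∂(P.map fun ω => (Z ω, Y ω)) :=
        (integral_map hZYm.aemeasurable hΦm.aestronglyMeasurable).symm
    _ = ∫ z, ∫ y, Φ (z, y) ∂(P.map Y) ∂(P.map Z) := by
        rw [hZY.map_prod_eq_prod_map_map hZm'.aemeasurable hY.aemeasurable] at hΦint ⊢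
        have := Measure.isProbabilityMeasure_map (μ := P) hY.aemeasurable
        have := Measure.isProbabilityMeasure_map (μ := P) hZm'.aemeasurable
        exact integral_prod _ hΦint
    _ = ∫ ω, ∫ y, Φ (Z ω, y) ∂(P.map Y) ∂P := by
        have := Measure.isProbabilityMeasure_map (μ := P) hY.aemeasurable
        rw [integral_map hZm'.aemeasurable]
        exact hΦm.stronglyMeasurable.integral_prod_right.aestronglyMeasurable
    _ = ∫ ω, A.indicator 1 ω * ∫ ω', f (X ω + Y ω') ∂P ∂P := by
        refine integral_congr_ae (ae_of_all _ fun ω => ?_)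
        simp only
        rw [integral_map hY.aemeasurable (f := fun y => Φ (Z ω, y))
          (hΦm.comp measurable_prodMk_left).aestronglyMeasurable]
        simp only [hΦ, hZ, integral_const_mul]
    _ = _ := (hind_eq _).symm

/-- The generators added by the augmentation are almost surely empty. Hence every augmented event
agrees almost surely with an event of the natural filtration, where independence is available. -/
lemma brownianFiltration_le_eventuallyMeasurable (hW : IsBrownianMotion W P) (t : Time T) :
    brownianFiltration hW t ≤ eventuallyMeasurableSpace
      (Filtration.natural W (fun t => (hW.measurable t).stronglyMeasurable) t) (ae P) := by
  refine sup_le le_eventuallyMeasurableSpace (MeasurableSpace.generateFrom_le fun A hA => ?_)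
  exact ⟨∅, @MeasurableSet.empty _ (_), ae_eq_empty.2 hA.2⟩

lemma natural_le_brownianFiltration (hW : IsBrownianMotion W P) (t : Time T) :
    Filtration.natural W (fun t => (hW.measurable t).stronglyMeasurable) t ≤
      brownianFiltration hW t := le_sup_left

lemma measurableSet_brownianFiltration_of_null (hW : IsBrownianMotion W P) (A : Set Ω)
    (hA : MeasurableSet A) (hPA : P A = 0) (t : Time T) :
    MeasurableSet[brownianFiltration hW t] A :=
  (le_sup_right : _ ≤ brownianFiltration hW t) _ (MeasurableSpace.measurableSet_generateFrom ⟨hA, hPA⟩)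

/-- Bounded continuous functions of finitely many values of Brownian motion close continuous
martingales. -/
theorem hasContVersion_cylinder [IsProbabilityMeasure P] (hT : 0 ≤ T) (hW : IsBrownianMotion W P)
    (J : Finset (Time T)) {f : (J → Fin d → ℝ) → ℝ} (hf : Continuous f) {C : ℝ}
    (hC : ∀ x, |f x| ≤ C) :
    HasContVersion (brownianFiltration hW) P fun ω => f fun j => W j ω := by
  set X : Time T → Ω → J → Fin d → ℝ := fun t ω j => W (min (j : Time T) t) ω with hX
  set Y : Time T → Ω → J → Fin d → ℝ := fun t ω j => W j ω - W (min (j : Time T) t) ω with hY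
  have hYm : ∀ t, Measurable (Y t) := fun t =>
    measurable_pi_lambda _ fun j => (hW.measurable _).sub (hW.measurable _)
  have hXY : ∀ t ω, X t ω + Y t ω = fun j : J => W j ω := by
    intro t ω; funext j; simp [hX, hY]
  have hXc : ∀ ω, Continuous (fun t => W t ω) → Continuous fun t => X t ω := fun ω h =>
    continuous_pi fun j => h.comp (continuous_const.min continuous_id)
  have hYc : ∀ ω, Continuous (fun t => W t ω) → Continuous fun t => Y t ω := fun ω h =>
    continuous_pi fun j => continuous_const.sub (h.comp (continuous_const.min continuous_id))
  have hint : Integrable (fun ω => f fun j : J => W j ω) P :=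
    Integrable.of_bound (hf.measurable.comp
      (measurable_pi_lambda _ fun j => hW.measurable _)).aestronglyMeasurable C
      (ae_of_all _ fun ω => hC _)
  -- Each value of `W` is split at time `t` into a known part `X` and an independent increment `Y`.
  -- Averaging over `Y` gives the conditional expectation, and dominated convergence gives
  -- continuity in `t`.
  refine ⟨fun t ω => ∫ ω', f (X t ω + Y t ω') ∂P, ?_, fun t => ?_⟩
  · filter_upwards [hW.continuous_paths] with ω hω
    refine continuous_of_dominated (bound := fun _ => C) (fun t => ?_)
      (fun t => ae_of_all _ fun ω' => hC _) (integrable_const _) ?_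
    · exact (hf.measurable.comp (measurable_const.add (hYm t))).aestronglyMeasurable
    · filter_upwards [hW.continuous_paths] with ω' hω'
      exact hf.comp ((hXc ω hω).add (hYc ω' hω'))
  · set 𝓖 := Filtration.natural W (fun t => (hW.measurable t).stronglyMeasurable) with hnat
    have hle : 𝓖 t ≤ mΩ := Filtration.le _ t
    have hXm : Measurable[𝓖 t] (X t) := by
      refine @measurable_pi_lambda _ _ _ (_) _ _ fun j => ?_
      exact measurable_iff_comap_le.2 (le_iSup₂
        (f := fun u (_ : u ≤ t) => MeasurableSpace.comap (W u) inferInstance)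
        (min (j : Time T) t) (min_le_right _ _))
    have hind : Indep (𝓖 t) (MeasurableSpace.comap (Y t) inferInstance) P := by
      have := hW.indepFun_past_increments hT t J
      rw [IndepFun_iff_Indep] at this
      rwa [hnat, Filtration.natural_eq_comap]
    have hgc : Continuous fun x => ∫ ω', f (x + Y t ω') ∂P := by
      refine continuous_of_dominated (bound := fun _ => C) (fun x => ?_)
        (fun x => ae_of_all _ fun ω' => hC _) (integrable_const _)
        (ae_of_all _ fun ω' => hf.comp (continuous_id.add continuous_const))
      exact (hf.measurable.comp (measurable_const.add (hYm t))).aestronglyMeasurable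
    have hMm : Measurable[𝓖 t] fun ω => ∫ ω', f (X t ω + Y t ω') ∂P := hgc.measurable.comp hXm
    have hMbd : ∀ ω, ‖∫ ω', f (X t ω + Y t ω') ∂P‖ ≤ C := fun ω =>
      (norm_integral_le_of_norm_le_const (ae_of_all _ fun ω' => hC _)).trans_eq (by simp)
    refine ae_eq_condExp_of_forall_setIntegral_eq ((brownianFiltration hW).le t) hint
      (fun s _ _ => (Integrable.of_bound (hMm.mono hle le_rfl).aestronglyMeasurable C
        (ae_of_all _ hMbd)).integrableOn) (fun s hs _ => ?_)
      (hMm.mono (natural_le_brownianFiltration hW t) le_rfl).stronglyMeasurable.aestronglyMeasurable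
    obtain ⟨s', hs', hss'⟩ := brownianFiltration_le_eventuallyMeasurable hW t s hs
    rw [setIntegral_congr_set hss', setIntegral_congr_set hss',
      ← setIntegral_comp_add_of_indep hle hXm (hYm t) hind hf.measurable hC hs']
    simp_rw [hXY]

/-- A π-λ argument with closed cylinders as the π-system: the indicator of a closed set is a limit
of bounded continuous thickened indicators. Complements and countable disjoint unions are handled by
linearity and `L¹` limits. -/
lemma hasContVersion_indicator_natural [IsProbabilityMeasure P] (hT : 0 < T)
    (hW : IsBrownianMotion W P) (t : Time T) {A : Set Ω}
    (hA : MeasurableSet[Filtration.natural W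
      (fun t => (hW.measurable t).stronglyMeasurable) t] A) :
    HasContVersion (brownianFiltration hW) P (A.indicator fun _ => (1 : ℝ)) := by
  set π : Time T → Set (Set Ω) := fun u => {A | ∃ C, IsClosed C ∧ W u ⁻¹' C = A} with hπ
  set 𝓖 := Filtration.natural W (fun t => (hW.measurable t).stronglyMeasurable) with hnat
  have hle : 𝓖 t ≤ mΩ := Filtration.le _ t
  have hgen : 𝓖 t = MeasurableSpace.generateFrom (piiUnionInter π (Set.Iic t)) := by
    have hcomap : ∀ u, MeasurableSpace.comap (W u) inferInstance =
        MeasurableSpace.generateFrom (π u) := by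
      intro u
      rw [BorelSpace.measurable_eq (α := Fin d → ℝ), borel_eq_generateFrom_isClosed,
        MeasurableSpace.comap_generateFrom]
      rfl
    refine le_antisymm (iSup₂_le fun u hu => ?_) (MeasurableSpace.generateFrom_le ?_)
    · rw [hcomap]
      exact le_generateFrom_piiUnionInter _ hu
    · rintro _ ⟨J, hJ, F, hF, rfl⟩
      refine Finset.measurableSet_biInter _ fun u hu => ?_
      have h1 : MeasurableSpace.comap (W u) inferInstance ≤ 𝓖 t := le_iSup₂
        (f := fun u (_ : u ≤ t) => MeasurableSpace.comap (W u) inferInstance) u (hJ hu)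
      refine h1 _ ?_
      rw [hcomap]
      exact MeasurableSpace.measurableSet_generateFrom (hF u hu)
  have hpi : IsPiSystem (piiUnionInter π (Set.Iic t)) := by
    refine isPiSystem_piiUnionInter _ (fun u => ?_) _
    rintro _ ⟨C, hC, rfl⟩ _ ⟨D, hD, rfl⟩ _
    exact ⟨C ∩ D, hC.inter hD, rfl⟩
  have hintA : ∀ B, MeasurableSet[𝓖 t] B → Integrable (B.indicator fun _ => (1 : ℝ)) P :=
    fun B hB => (integrable_const _).indicator (hle _ hB)
  refine MeasurableSpace.induction_on_inter (m := 𝓖 t)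
    (C := fun B _ => HasContVersion (brownianFiltration hW) P (B.indicator fun _ => (1 : ℝ)))
    hgen hpi ?_ ?_ ?_ ?_ A hA
  · simpa using HasContVersion.const (𝓕 := brownianFiltration hW) (P := P) 0
  · rintro _ ⟨J, hJ, F, hF, rfl⟩
    choose! C hC hCF using hF
    set K : Set (J → Fin d → ℝ) := Set.univ.pi fun j => C j with hK
    have hKc : IsClosed K := isClosed_set_pi fun j _ => hC j j.2
    have hKF : (⋂ u ∈ J, F u) = (fun ω (j : J) => W j ω) ⁻¹' K := by
      ext ω
      simp only [Set.mem_iInter, Set.mem_preimage, hK, Set.mem_univ_pi]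
      refine ⟨fun h j => ?_, fun h u hu => ?_⟩
      · have := h j j.2
        rw [← hCF j j.2] at this
        exact this
      · rw [← hCF u hu]
        exact h ⟨u, hu⟩
    rw [hKF]
    have hWm : Measurable fun ω (j : J) => W j ω := measurable_pi_lambda _ fun j => hW.measurable _
    have hδ : ∀ n : ℕ, (0 : ℝ) < 1 / ((n : ℝ) + 1) := fun n => by positivity
    set g : ℕ → Ω → ℝ := fun n ω => (thickenedIndicator (hδ n) K fun j : J => W j ω : ℝ≥0) with hg
    have hgm : ∀ n, Measurable (g n) := fun n =>
      (NNReal.continuous_coe.comp (thickenedIndicator (hδ n) K).continuous).measurable.comp hWm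
    have hgb : ∀ n ω, |g n ω| ≤ 1 := fun n ω => by
      rw [abs_of_nonneg (NNReal.coe_nonneg _)]
      exact_mod_cast thickenedIndicator_le_one (hδ n) K _
    have hgi : ∀ n, Integrable (g n) P := fun n =>
      Integrable.of_bound (hgm n).aestronglyMeasurable 1 (ae_of_all _ (hgb n))
    have hmeas : MeasurableSet ((fun ω (j : J) => W j ω) ⁻¹' K) := hWm hKc.measurableSet
    have hti : Integrable (((fun ω (j : J) => W j ω) ⁻¹' K).indicator fun _ => (1 : ℝ)) P :=
      (integrable_const _).indicator hmeas
    refine hasContVersion_of_approx hT hti fun ε hε => ?_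
    have hlim : Tendsto (fun n => ∫ ω, |((fun ω (j : J) => W j ω) ⁻¹' K).indicator
        (fun _ => (1 : ℝ)) ω - g n ω| ∂P) atTop (𝓝 (∫ _, (0 : ℝ) ∂P)) := by
      refine tendsto_integral_of_dominated_convergence (fun _ => 2)
        (fun n => (hti.sub (hgi n)).abs.aestronglyMeasurable) (integrable_const _)
        (fun n => ae_of_all _ fun ω => ?_) (ae_of_all _ fun ω => ?_)
      · have h1 : |((fun ω (j : J) => W j ω) ⁻¹' K).indicator (fun _ => (1 : ℝ)) ω| ≤ 1 := by
          by_cases h : ω ∈ (fun ω (j : J) => W j ω) ⁻¹' K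
          · rw [Set.indicator_of_mem h]; simp
          · rw [Set.indicator_of_notMem h]; simp
        rw [Real.norm_eq_abs, abs_abs]
        exact (abs_sub _ _).trans (by linarith [hgb n ω])
      · have h1 := tendsto_pi_nhds.1 (thickenedIndicator_tendsto_indicator_closure hδ
          tendsto_one_div_add_atTop_nhds_zero_nat K) fun j : J => W j ω
        rw [hKc.closure_eq] at h1
        have h2 : Tendsto (fun n => g n ω) atTop
            (𝓝 (((fun ω (j : J) => W j ω) ⁻¹' K).indicator (fun _ => (1 : ℝ)) ω)) := by
          have h3 := (NNReal.continuous_coe.tendsto _).comp h1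
          have h5 : ((fun ω (j : J) => W j ω) ⁻¹' K).indicator (fun _ => (1 : ℝ)) ω =
              ((K.indicator (fun _ => (1 : ℝ≥0)) fun j : J => W j ω : ℝ≥0) : ℝ) := by
            by_cases h : (fun j : J => W j ω) ∈ K
            · rw [Set.indicator_of_mem (by exact h), Set.indicator_of_mem h]; simp
            · rw [Set.indicator_of_notMem (by exact h), Set.indicator_of_notMem h]; simp
          rw [h5]
          exact h3
        have h4 := ((tendsto_const_nhds (x := ((fun ω (j : J) => W j ω) ⁻¹' K).indicator
          (fun _ => (1 : ℝ)) ω)).sub h2).abs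
        simpa using h4
    rw [integral_zero] at hlim
    obtain ⟨n, hn⟩ := (hlim.eventually (gt_mem_nhds hε)).exists
    refine ⟨g n, hgi n, ?_, hn.le⟩
    exact hasContVersion_cylinder hT.le hW J (C := 1)
      (f := fun x => ((thickenedIndicator (hδ n) K x : ℝ≥0) : ℝ))
      (NNReal.continuous_coe.comp (thickenedIndicator (hδ n) K).continuous) (fun x => by
        rw [abs_of_nonneg (NNReal.coe_nonneg _)]
        exact_mod_cast thickenedIndicator_le_one (hδ n) K _)
  · intro B hB ih
    have h1 := (HasContVersion.const (𝓕 := brownianFiltration hW) (P := P) (1 : ℝ)).add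
      (ih.const_smul (-1)) (integrable_const _) ((hintA B hB).smul (-1 : ℝ))
    refine h1.congr (ae_of_all _ fun ω => ?_)
    by_cases h : ω ∈ B <;> simp [h]
  · intro B hdisj hB ih
    have hfin : ∀ n : ℕ, HasContVersion (brownianFiltration hW) P
        ((⋃ i ∈ Finset.range n, B i).indicator fun _ => (1 : ℝ)) := by
      intro n
      induction n with
      | zero => simpa using HasContVersion.const (𝓕 := brownianFiltration hW) (P := P) 0
      | succ n ihn =>
        have hm : MeasurableSet[𝓖 t] (⋃ i ∈ Finset.range n, B i) :=
          Finset.measurableSet_biUnion _ fun i _ => hB i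
        have h1 := ihn.add (ih n) (hintA _ hm) (hintA _ (hB n))
        refine h1.congr (ae_of_all _ fun ω => ?_)
        rw [Finset.range_add_one, Finset.set_biUnion_insert, Set.union_comm,
          Set.indicator_union_of_disjoint]
        · rfl
        rw [Set.disjoint_iUnion₂_left]
        intro i hi
        exact hdisj (Finset.mem_range.1 hi).ne
    have hm : ∀ n : ℕ, MeasurableSet[𝓖 t] (⋃ i ∈ Finset.range n, B i) := fun n =>
      Finset.measurableSet_biUnion _ fun i _ => hB i
    refine hasContVersion_of_approx hT (hintA _ (MeasurableSet.iUnion hB)) fun ε hε => ?_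
    have hlim : Tendsto (fun n : ℕ => ∫ ω, |(⋃ i, B i).indicator (fun _ => (1 : ℝ)) ω -
        (⋃ i ∈ Finset.range n, B i).indicator (fun _ => (1 : ℝ)) ω| ∂P) atTop
        (𝓝 (∫ _, (0 : ℝ) ∂P)) := by
      have hb : ∀ (A : Set Ω) (ω : Ω), |A.indicator (fun _ => (1 : ℝ)) ω| ≤ 1 := by
        intro A ω
        by_cases h : ω ∈ A <;> simp [h]
      refine tendsto_integral_of_dominated_convergence (fun _ => 2)
        (fun n => ((hintA _ (MeasurableSet.iUnion hB)).sub
          (hintA _ (hm n))).abs.aestronglyMeasurable) (integrable_const _)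
        (fun n => ae_of_all _ fun ω => ?_) (ae_of_all _ fun ω => ?_)
      · rw [Real.norm_eq_abs, abs_abs]
        have h1 := hb (⋃ i, B i) ω
        have h2 := hb (⋃ i ∈ Finset.range n, B i) ω
        exact (abs_sub _ _).trans (by linarith)
      · refine tendsto_const_nhds.congr' ?_
        by_cases h : ω ∈ ⋃ i, B i
        · obtain ⟨i, hi⟩ := Set.mem_iUnion.1 h
          filter_upwards [eventually_gt_atTop i] with n hn
          have h2 : ω ∈ ⋃ i ∈ Finset.range n, B i :=
            Set.mem_biUnion (by simpa using hn) hi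
          rw [Set.indicator_of_mem h, Set.indicator_of_mem h2]; simp
        · refine Eventually.of_forall fun n => ?_
          have h2 : ω ∉ ⋃ i ∈ Finset.range n, B i := fun hh => by
            obtain ⟨i, _, hi⟩ := Set.mem_iUnion₂.1 hh
            exact h (Set.mem_iUnion.2 ⟨i, hi⟩)
          simp only [Set.indicator_of_notMem h, Set.indicator_of_notMem h2, sub_self, abs_zero]
    rw [integral_zero] at hlim
    obtain ⟨n, hn⟩ := (hlim.eventually (gt_mem_nhds hε)).exists
    exact ⟨_, hintA _ (hm n), hfin n, hn.le⟩

/-- In the Brownian filtration every closed martingale has a continuous version. -/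
theorem hasContVersion_brownianFiltration [IsProbabilityMeasure P] (hT : 0 < T)
    (hW : IsBrownianMotion W P) (ξ : Ω → ℝ) :
    HasContVersion (brownianFiltration hW) P ξ := by
  let e : Time T := ⟨T, hT.le, le_rfl⟩
  -- Replacing `ξ` by its projection on the terminal σ-algebra changes none of the conditional
  -- expectations. The projection is always integrable, being zero by convention for a nonintegrable
  -- `ξ`.
  set 𝓕 := brownianFiltration hW with h𝓕
  have hle := 𝓕.le e
  set η : Ω → ℝ := condExp (𝓕 e) P ξ with hη
  have hηm : StronglyMeasurable[𝓕 e] η := stronglyMeasurable_condExp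
  have hηi : Integrable η P := integrable_condExp
  suffices h : HasContVersion 𝓕 P η by
    obtain ⟨M, hc, hM⟩ := h
    exact ⟨M, hc, fun t => (hM t).trans
      (condExp_condExp_of_le (𝓕.mono (show t ≤ e from t.2.2)) hle)⟩
  have hind : ∀ A, MeasurableSet[𝓕 e] A → HasContVersion 𝓕 P (A.indicator fun _ => (1 : ℝ)) := by
    intro A hA
    obtain ⟨A', hA', hAA'⟩ := brownianFiltration_le_eventuallyMeasurable hW e A hA
    exact (hasContVersion_indicator_natural hT hW e hA').congr (indicator_ae_eq_of_ae_eq_set hAA').symm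
  have hsimple : ∀ g : @SimpleFunc Ω (𝓕 e) ℝ, Integrable g P ∧ HasContVersion 𝓕 P g := by
    intro g
    refine @SimpleFunc.induction _ _ (𝓕 e) _ (fun g => Integrable g P ∧ HasContVersion 𝓕 P g)
      (fun c A hA => ?_) (fun f g _ hf hg => ?_) g
    · classical
      have he : (fun ω => c * A.indicator (fun _ => (1 : ℝ)) ω) =
          (@SimpleFunc.piecewise _ _ (𝓕 e) A hA (@SimpleFunc.const _ _ (𝓕 e) c)
            (@SimpleFunc.const _ _ (𝓕 e) 0) : Ω → ℝ) := by
        funext ω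
        rw [@SimpleFunc.coe_piecewise _ _ (𝓕 e)]
        by_cases h : ω ∈ A <;> simp [h]
      rw [← he]
      exact ⟨((integrable_const (1 : ℝ)).indicator (hle _ hA)).const_mul c,
        (hind A hA).const_smul c⟩
    · exact ⟨hf.1.add hg.1, hf.2.add hg.2 hf.1 hg.1⟩
  refine hasContVersion_of_approx hT hηi fun ε hε => ?_
  -- The approximation is made for the trimmed measure, so that the simple functions are measurable
  -- for the terminal σ-algebra, where indicators are already treated.
  obtain ⟨g, hg, -⟩ := @MemLp.exists_simpleFunc_eLpNorm_sub_lt Ω (𝓕 e) 1 ℝ _ η (P.trim hle)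
    (memLp_one_iff_integrable.2 (hηi.trim hle hηm)) ENNReal.one_ne_top
    (ε := ENNReal.ofReal ε) (by simpa using hε)
  refine ⟨g, (hsimple g).1, (hsimple g).2, ?_⟩
  rw [eLpNorm_trim hle (hηm.sub (@SimpleFunc.stronglyMeasurable _ _ (𝓕 e) _ g)),
    eLpNorm_one_eq_lintegral_enorm,
    ← ofReal_integral_norm_eq_lintegral_enorm (hηi.sub (hsimple g).1)] at hg
  exact ((ENNReal.ofReal_lt_ofReal_iff hε).1 hg).le

end BrownianContinuity

/-! ### Deterministic weights against bounded martingales -/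

section DeterministicWeights

variable {Ω : Type*} [mΩ : MeasurableSpace Ω] {T : ℝ} {P : Measure Ω}
  {𝓕 : Filtration (Time T) mΩ}

lemma exists_abs_le_time {c : ℝ → ℝ} (hc : Continuous c) :
    ∃ C, 0 ≤ C ∧ ∀ t : Time T, |c t| ≤ C := by
  obtain ⟨C, hC⟩ := (isCompact_Icc (a := (0 : ℝ)) (b := T)).exists_bound_of_continuousOn
    hc.continuousOn
  exact ⟨max C 0, le_max_right _ _, fun t => (hC t t.2).trans (le_max_left _ _)⟩

lemma setIntegral_deriv_time {c c' : ℝ → ℝ} (hc : ∀ u, HasDerivAt c (c' u) u)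
    (hc' : Continuous c') {s t : Time T} (hst : s ≤ t) :
    ∫ u in Set.Ioc s t, c' u = c t - c s := by
  rw [setIntegral_time_Ioc c' hst]
  exact intervalIntegral.integral_eq_sub_of_hasDerivAt (fun x _ => hc x)
    (hc'.intervalIntegrable _ _)

lemma integrable_path {f : Time T → ℝ} (hf : Measurable f) {C : ℝ}
    (hb : ∀ᵐ t : Time T, |f t| ≤ C) : Integrable f :=
  Integrable.of_bound hf.aestronglyMeasurable C hb

lemma abs_setIntegral_le {f : Time T → ℝ} {C : ℝ} (hb : ∀ᵐ t : Time T, |f t| ≤ C)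
    (hC : 0 ≤ C) (A : Set (Time T)) :
    |∫ u in A, f u| ≤ C * volume.real (Set.univ : Set (Time T)) := by
  refine (norm_setIntegral_le_of_norm_le_const_ae' (f := f) (measure_lt_top _ A) (C := C) ?_).trans ?_
  · filter_upwards [hb] with t ht _ using ht
  · exact mul_le_mul_of_nonneg_left (measureReal_mono (μ := volume) (Set.subset_univ A)) hC

/-- The bound is given path by path; joint measurability permits exchanging the two
almost-everywhere quantifiers. -/
lemma integrable_prod_of_bounded [IsFiniteMeasure P] {X : Time T → Ω → ℝ}
    (hX : Measurable fun p : Time T × Ω => X p.1 p.2) {C : ℝ}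
    (hb : ∀ᵐ ω ∂P, ∀ᵐ t : Time T, |X t ω| ≤ C) :
    Integrable (fun p : Time T × Ω => X p.1 p.2) (volume.prod P) := by
  refine Integrable.of_bound hX.aestronglyMeasurable C ?_
  have hm : MeasurableSet {p : Time T × Ω | |X p.1 p.2| ≤ C} :=
    measurableSet_le hX.abs measurable_const
  have h1 : ∀ᵐ t : Time T, ∀ᵐ ω ∂P, |X t ω| ≤ C := by
    refine (Measure.ae_ae_comm ?_).1 hb
    exact (measurable_swap hm)
  exact (Measure.ae_prod_mem_iff_ae_ae_mem hm).2 h1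

/-- The integral of a continuously differentiable deterministic weight against a bounded
martingale, written without stochastic integrals, is a martingale. -/
theorem martingale_weighted [IsProbabilityMeasure P] (hT : 0 ≤ T) {m : Time T → Ω → ℝ}
    (hm : Martingale m 𝓕 P) (hprog : IsProg 𝓕 m) {C : ℝ}
    (hb : ∀ᵐ ω ∂P, ∀ᵐ t : Time T, |m t ω| ≤ C) {c c' : ℝ → ℝ}
    (hc : ∀ u, HasDerivAt c (c' u) u) (hc' : Continuous c') :
    Martingale (fun (t : Time T) ω => c t * m t ω - ∫ u in Set.Iic t, c' u * m u ω) 𝓕 P := by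
  have hmm : Measurable fun p : Time T × Ω => m p.1 p.2 := hprog.measurable_uncurry hT
  have hprog' : IsProg 𝓕 fun t ω => c' t * m t ω := hprog.det_mul hc'
  have hadI := hprog'.adapted_integral
  obtain ⟨D, hD, hDb⟩ := exists_abs_le_time (T := T) hc'
  have hb' : ∀ᵐ ω ∂P, ∀ᵐ t : Time T, |c' t * m t ω| ≤ D * C := by
    filter_upwards [hb] with ω hω
    filter_upwards [hω] with t ht
    rw [abs_mul]
    exact mul_le_mul (hDb t) ht (abs_nonneg _) hD
  have hpi : Integrable (fun p : Time T × Ω => c' p.1 * m p.1 p.2) (volume.prod P) :=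
    integrable_prod_of_bounded (X := fun t ω => c' t * m t ω) (hprog'.measurable_uncurry hT) hb'
  have hpm : Integrable (fun p : Time T × Ω => m p.1 p.2) (volume.prod P) :=
    integrable_prod_of_bounded hmm hb
  have hpi_r : ∀ (B : Set (Time T)) (A : Set Ω),
      Integrable (fun p : Time T × Ω => c' p.1 * m p.1 p.2)
        ((volume.restrict B).prod (P.restrict A)) := fun B A => by
    rw [Measure.prod_restrict]; exact hpi.restrict
  have hIint : ∀ t : Time T, Integrable (fun ω => ∫ u in Set.Iic t, c' u * m u ω) P := by
    intro t
    have := (hpi_r (Set.Iic t) Set.univ).integral_prod_right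
    rwa [Measure.restrict_univ] at this
  have hnint : ∀ t : Time T, Integrable
      (fun ω => c (t : Time T) * m t ω - ∫ u in Set.Iic t, c' u * m u ω) P :=
    fun t => ((hm.integrable t).const_mul _).sub (hIint t)
  have had : StronglyAdapted 𝓕
      (fun (t : Time T) ω => c t * m t ω - ∫ u in Set.Iic t, c' u * m u ω) := fun t =>
    ((hm.stronglyAdapted t).const_mul _).sub (hadI t).stronglyMeasurable
  refine ⟨had, fun s t hst => ?_⟩
  refine (ae_eq_condExp_of_forall_setIntegral_eq (𝓕.le s) (hnint t)
    (fun A _ _ => (hnint s).integrableOn) (fun A hA _ => ?_)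
    (had s).aestronglyMeasurable).symm
  -- After Fubini only the means of `m u` over the event `A ∈ 𝓕 s` matter. They are constant for `u
  -- ≥ s`, so the time integral over `(s, t]` is `c t - c s` times that constant and cancels the
  -- change of `c m`.
  have hswap : ∀ t : Time T, ∫ ω in A, (∫ u in Set.Iic t, c' u * m u ω) ∂P =
      ∫ u in Set.Iic t, c' u * ∫ ω in A, m u ω ∂P := by
    intro t
    rw [← integral_integral_swap (f := fun u ω => c' (u : Time T) * m u ω)
      (hpi_r (Set.Iic t) A)]
    simp_rw [integral_const_mul]
  have hval : ∀ t : Time T, ∫ ω in A, (c (t : Time T) * m t ω - ∫ u in Set.Iic t, c' u * m u ω) ∂P =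
      c t * (∫ ω in A, m t ω ∂P) - ∫ u in Set.Iic t, c' u * ∫ ω in A, m u ω ∂P := by
    intro t
    rw [integral_sub ((hm.integrable t).const_mul _).integrableOn (hIint t).integrableOn,
      integral_const_mul, hswap]
  have hconst : ∀ u : Time T, s ≤ u → ∫ ω in A, m u ω ∂P = ∫ ω in A, m s ω ∂P := fun u hu =>
    (hm.setIntegral_eq hu hA).symm
  have hφ : Integrable fun u : Time T => c' u * ∫ ω in A, m u ω ∂P := by
    have := (hpi_r Set.univ A).integral_prod_left
    rw [Measure.restrict_univ] at this
    simpa only [integral_const_mul] using this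
  have hIoc : ∫ u in Set.Ioc s t, c' u * ∫ ω in A, m u ω ∂P =
      (c t - c s) * ∫ ω in A, m s ω ∂P := by
    rw [← setIntegral_deriv_time hc hc' hst, ← integral_mul_const]
    refine setIntegral_congr_fun measurableSet_Ioc fun u hu => ?_
    simp only [hconst u hu.1.le]
  rw [hval, hval, setIntegral_Iic_sub hφ hst, hIoc, hconst t hst]
  ring

end DeterministicWeights

/-! ### The scalar forward-backward system -/

section ScalarSystem

variable {T : ℝ}

/-- Coefficients which decouple the scalar system: a solution `F` of the Riccati equation and the
weight `p` of its linearisation. -/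
structure IsFeedback (T b r : ℝ) (F p : ℝ → ℝ) : Prop where
  hasDerivAt_feedback : ∀ u, HasDerivAt F (F u ^ 2 + r * F u - b) u
  hasDerivAt_weight : ∀ u, HasDerivAt p (-(r + F u) * p u) u
  weight_pos : ∀ u, 0 < p u
  feedback_end : F T = 0

namespace IsFeedback

variable {b r : ℝ} {F p : ℝ → ℝ}

lemma continuous_feedback (h : IsFeedback T b r F p) : Continuous F :=
  continuous_iff_continuousAt.2 fun u => (h.hasDerivAt_feedback u).continuousAt

lemma continuous_weight (h : IsFeedback T b r F p) : Continuous p :=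
  continuous_iff_continuousAt.2 fun u => (h.hasDerivAt_weight u).continuousAt

lemma continuous_deriv_feedback (h : IsFeedback T b r F p) :
    Continuous fun u => F u ^ 2 + r * F u - b :=
  ((h.continuous_feedback.pow 2).add (continuous_const.mul h.continuous_feedback)).sub
    continuous_const

lemma continuous_deriv_weight (h : IsFeedback T b r F p) :
    Continuous fun u => -(r + F u) * p u :=
  (continuous_const.add h.continuous_feedback).neg.mul h.continuous_weight

lemma hasDerivAt_inv_weight (h : IsFeedback T b r F p) (u : ℝ) :
    HasDerivAt (fun u => (p u)⁻¹) ((r + F u) * (p u)⁻¹) u := by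
  have hp := (h.weight_pos u).ne'
  refine ((h.hasDerivAt_weight u).fun_inv hp).congr_deriv ?_
  field_simp

lemma continuous_inv_weight (h : IsFeedback T b r F p) : Continuous fun u => (p u)⁻¹ :=
  h.continuous_weight.inv₀ fun u => (h.weight_pos u).ne'

lemma continuous_deriv_inv_weight (h : IsFeedback T b r F p) :
    Continuous fun u => (r + F u) * (p u)⁻¹ :=
  (continuous_const.add h.continuous_feedback).mul h.continuous_inv_weight

lemma hasDerivAt_exp_primitive (h : IsFeedback T b r F p) (u : ℝ) :
    HasDerivAt (fun u => Real.exp (∫ v in (0 : ℝ)..u, F v))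
      (F u * Real.exp (∫ v in (0 : ℝ)..u, F v)) u := by
  have h1 := (intervalIntegral.integral_hasDerivAt_right
    (h.continuous_feedback.intervalIntegrable 0 u)
    (h.continuous_feedback.stronglyMeasurableAtFilter _ _)
    h.continuous_feedback.continuousAt).exp
  rwa [mul_comm] at h1

lemma hasDerivAt_exp_neg_primitive (h : IsFeedback T b r F p) (u : ℝ) :
    HasDerivAt (fun u => Real.exp (-∫ v in (0 : ℝ)..u, F v))
      (-F u * Real.exp (-∫ v in (0 : ℝ)..u, F v)) u := by
  have h1 := (intervalIntegral.integral_hasDerivAt_right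
    (h.continuous_feedback.intervalIntegrable 0 u)
    (h.continuous_feedback.stronglyMeasurableAtFilter _ _)
    h.continuous_feedback.continuousAt).neg.exp
  rwa [mul_comm] at h1

lemma continuous_exp_primitive (h : IsFeedback T b r F p) :
    Continuous fun u => Real.exp (∫ v in (0 : ℝ)..u, F v) :=
  continuous_iff_continuousAt.2 fun u => (h.hasDerivAt_exp_primitive u).continuousAt

lemma continuous_exp_neg_primitive (h : IsFeedback T b r F p) :
    Continuous fun u => Real.exp (-∫ v in (0 : ℝ)..u, F v) :=
  continuous_iff_continuousAt.2 fun u => (h.hasDerivAt_exp_neg_primitive u).continuousAt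

/-- The kernel separates into a function of `t` and a function of `s`; the factor depending on `t`
leaves the integral, and adaptedness and continuity of the formula become visible. -/
lemma exp_neg_integral_eq (h : IsFeedback T b r F p) (s t : ℝ) :
    Real.exp (-∫ u in s..t, F u) =
      Real.exp (-∫ v in (0 : ℝ)..t, F v) * Real.exp (∫ v in (0 : ℝ)..s, F v) := by
  rw [← Real.exp_add]
  congr 1
  rw [← intervalIntegral.integral_add_adjacent_intervals
    (h.continuous_feedback.intervalIntegrable 0 s) (h.continuous_feedback.intervalIntegrable s t)]
  ring

/-- Variation of constants. -/
lemma eq_integral_of_rate (h : IsFeedback T b r F p) (hT : 0 ≤ T) {x y η : Time T → ℝ}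
    (hy : Integrable y) (hη : Integrable η) (hx : ∀ t, x t = ∫ u in Set.Iic t, y u)
    (hyη : ∀ t : Time T, y t = η t - F t * x t) (t : Time T) :
    x t = ∫ s in Set.Iic t, Real.exp (-∫ u in (s : ℝ)..t, F u) * η s := by
  let z : Time T := ⟨0, le_rfl, hT⟩
  have hzt : z ≤ t := t.2.1
  -- Integrating factor: the derivative of `exp (∫ F) x` is `exp (∫ F) η`, the terms in `F x`
  -- cancelling.
  have h1 := mul_sub_mul_eq_of_rate hT h.hasDerivAt_exp_primitive
    (h.continuous_feedback.mul h.continuous_exp_primitive) hy hx hzt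
  have hxz : x z = 0 := by rw [hx, setIntegral_Iic_zero z rfl]
  have hEη : Integrable fun u : Time T => Real.exp (∫ v in (0 : ℝ)..u, F v) * η u := by
    obtain ⟨C, _, hCb⟩ := exists_abs_le_time (T := T) h.continuous_exp_primitive
    exact hη.bdd_mul (c := C)
      (h.continuous_exp_primitive.comp continuous_subtype_val).aestronglyMeasurable
      (ae_of_all _ hCb)
  have h2 : ∫ u in Set.Ioc z t, (F u * Real.exp (∫ v in (0 : ℝ)..u, F v) * x u +
      Real.exp (∫ v in (0 : ℝ)..u, F v) * y u) =
      ∫ u in Set.Iic t, Real.exp (∫ v in (0 : ℝ)..u, F v) * η u := by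
    rw [setIntegral_Iic_sub hEη hzt, setIntegral_Iic_zero z rfl, zero_add]
    refine setIntegral_congr_fun measurableSet_Ioc fun u _ => ?_
    simp only [hyη u]; ring
  rw [h2, hxz, mul_zero, sub_zero] at h1
  have he : ∀ s : Time T, Real.exp (-∫ u in (s : ℝ)..t, F u) * η s =
      Real.exp (-∫ v in (0 : ℝ)..t, F v) * (Real.exp (∫ v in (0 : ℝ)..s, F v) * η s) := fun s => by
    rw [h.exp_neg_integral_eq, mul_assoc]
  simp only [he]
  rw [integral_const_mul, ← h1, ← mul_assoc, ← Real.exp_add]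
  simp

/-- The explicit integral solves the closed-loop equation. -/
lemma integral_rate_of_eq (h : IsFeedback T b r F p) (hT : 0 ≤ T) {x η : Time T → ℝ}
    (hη : Integrable η)
    (hx : ∀ t : Time T, x t = ∫ s in Set.Iic t, Real.exp (-∫ u in (s : ℝ)..t, F u) * η s)
    (t : Time T) : x t = ∫ u in Set.Iic t, (η u - F u * x u) := by
  let z : Time T := ⟨0, le_rfl, hT⟩
  have hzt : z ≤ t := t.2.1
  have hEη : Integrable fun u : Time T => Real.exp (∫ v in (0 : ℝ)..u, F v) * η u := by
    obtain ⟨C, _, hCb⟩ := exists_abs_le_time (T := T) h.continuous_exp_primitive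
    exact hη.bdd_mul (c := C)
      (h.continuous_exp_primitive.comp continuous_subtype_val).aestronglyMeasurable
      (ae_of_all _ hCb)
  set A : Time T → ℝ := fun t => ∫ u in Set.Iic t, Real.exp (∫ v in (0 : ℝ)..u, F v) * η u with hA
  have hxA : ∀ t : Time T, x t = Real.exp (-∫ v in (0 : ℝ)..t, F v) * A t := by
    intro t
    rw [hx t]
    have he : ∀ s : Time T, Real.exp (-∫ u in (s : ℝ)..t, F u) * η s =
        Real.exp (-∫ v in (0 : ℝ)..t, F v) * (Real.exp (∫ v in (0 : ℝ)..s, F v) * η s) :=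
      fun s => by rw [h.exp_neg_integral_eq, mul_assoc]
    simp only [he]
    rw [integral_const_mul]
  have h1 := mul_sub_mul_eq_of_rate hT (X := A) h.hasDerivAt_exp_neg_primitive
    (h.continuous_feedback.neg.mul h.continuous_exp_neg_primitive) hEη (fun _ => rfl) hzt
  have hAz : A z = 0 := setIntegral_Iic_zero z rfl
  have hAc : Continuous A := continuous_setIntegral_Iic hT hEη
  have hxc : Continuous x := by
    have : x = fun t : Time T => Real.exp (-∫ v in (0 : ℝ)..t, F v) * A t := funext hxA
    rw [this]
    exact (h.continuous_exp_neg_primitive.comp continuous_subtype_val).mul hAc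
  have hint : Integrable fun u : Time T => η u - F u * x u :=
    hη.sub (integrable_of_continuous
      ((h.continuous_feedback.comp continuous_subtype_val).mul hxc))
  rw [hAz, mul_zero, sub_zero, ← hxA] at h1
  rw [h1, setIntegral_Iic_sub hint hzt, setIntegral_Iic_zero z rfl, zero_add]
  refine setIntegral_congr_fun measurableSet_Ioc fun u _ => ?_
  have he : Real.exp (-∫ v in (0 : ℝ)..u, F v) * Real.exp (∫ v in (0 : ℝ)..u, F v) = 1 := by
    rw [← Real.exp_add]; simp
  simp only [hxA u]
  linear_combination η u * he

/-- The weighted feedback residual of a solution is an integral against the target plus martingale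
increments. -/
lemma weight_mul_residual (h : IsFeedback T b r F p) (hT : 0 ≤ T) {x y m θ : Time T → ℝ}
    (hy : Continuous y) (hm : Continuous m) (hθ : Integrable θ)
    (hx : ∀ t, x t = ∫ u in Set.Iic t, y u)
    (hdyn : ∀ s t, s ≤ t →
      y t - y s = (∫ u in Set.Ioc s t, (b * (x u - θ u) + r * y u)) + (m t - m s))
    {s t : Time T} (hst : s ≤ t) :
    p t * (y t + F t * x t) - p s * (y s + F s * x s) =
      -(∫ u in Set.Ioc s t, p u * b * θ u) +
        ((p t * m t - p s * m s) - ∫ u in Set.Ioc s t, -(r + F u) * p u * m u) := by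
  have hyi : Integrable y := integrable_of_continuous hy
  have hxc : Continuous x := by
    rw [funext hx]
    exact continuous_setIntegral_Iic hT hyi
  have hFc : Continuous fun u : Time T => F u := h.continuous_feedback.comp continuous_subtype_val
  have hi1 : Integrable fun u : Time T => b * (x u - θ u) + r * y u :=
    (((integrable_of_continuous hxc).sub hθ).const_mul b).add (hyi.const_mul r)
  have hi2 : Integrable fun u : Time T => (F u ^ 2 + r * F u - b) * x u + F u * y u :=
    integrable_of_continuous
      (((h.continuous_deriv_feedback.comp continuous_subtype_val).mul hxc).add (hFc.mul hy))
  have hz : ∀ s t : Time T, s ≤ t → (y t + F t * x t) - (y s + F s * x s) =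
      (∫ u in Set.Ioc s t, ((b * (x u - θ u) + r * y u) +
        ((F u ^ 2 + r * F u - b) * x u + F u * y u))) + (m t - m s) := by
    intro s t hst
    rw [integral_add hi1.integrableOn hi2.integrableOn,
      ← mul_sub_mul_eq_of_rate hT h.hasDerivAt_feedback h.continuous_deriv_feedback hyi hx hst]
    have := hdyn s t hst
    linarith
  -- By the Riccati equation the drift of the residual is `(r + F) (y + F x) - b θ`, and the weight
  -- removes its first term.
  have h1 := mul_sub_mul_eq_of_dynamics hT (X := fun t => y t + F t * x t) h.hasDerivAt_weight
    h.continuous_deriv_weight hm (hi1.add hi2) hz hst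
  rw [h1, ← integral_neg]
  congr 1
  refine setIntegral_congr_fun measurableSet_Ioc fun u _ => ?_
  simp only [Pi.add_apply]
  ring

/-- Pathwise verification: the closed-loop system driven by a martingale path `N` has the dynamics
of the forward-backward system. -/
lemma dynamics_of_closed_loop (h : IsFeedback T b r F p) (hT : 0 ≤ T) {x η N θ : Time T → ℝ}
    (hN : Continuous N) (hη : Continuous η) (hθ : Integrable θ)
    (hηN : ∀ t : Time T, η t = (p t)⁻¹ * (N t - ∫ u in Set.Iic t, p u * b * θ u))
    (hx : ∀ t : Time T, x t = ∫ u in Set.Iic t, (η u - F u * x u)) (hxc : Continuous x)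
    {s t : Time T} (hst : s ≤ t) :
    (η t - F t * x t) - (η s - F s * x s) =
      (∫ u in Set.Ioc s t, (b * (x u - θ u) + r * (η u - F u * x u))) +
        (((p t)⁻¹ * N t - ∫ u in Set.Iic t, (r + F u) * (p u)⁻¹ * N u) -
          ((p s)⁻¹ * N s - ∫ u in Set.Iic s, (r + F u) * (p u)⁻¹ * N u)) := by
  have hFc : Continuous fun u : Time T => F u := h.continuous_feedback.comp continuous_subtype_val
  have hpθ : Integrable fun u : Time T => p u * b * θ u := by
    have hc : Continuous fun u => p u * b := h.continuous_weight.mul continuous_const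
    obtain ⟨C, _, hCb⟩ := exists_abs_le_time (T := T) hc
    exact hθ.bdd_mul (c := C) (hc.comp continuous_subtype_val).aestronglyMeasurable
      (ae_of_all _ hCb)
  have hX : ∀ s t : Time T, s ≤ t → (N t - ∫ u in Set.Iic t, p u * b * θ u) -
      (N s - ∫ u in Set.Iic s, p u * b * θ u) =
      (∫ u in Set.Ioc s t, -(p u * b * θ u)) + (N t - N s) := by
    intro s t hst
    rw [setIntegral_Iic_sub hpθ hst, integral_neg]
    ring
  -- Multiplying `N - ∫ p b θ` by `p⁻¹` gives the dynamics of `η`, with drift `(r + F) η - b θ`.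
  -- Subtracting those of `F x` and using the Riccati equation leaves the required drift.
  have h1 := mul_sub_mul_eq_of_dynamics hT (X := fun t => N t - ∫ u in Set.Iic t, p u * b * θ u)
    h.hasDerivAt_inv_weight h.continuous_deriv_inv_weight hN hpθ.neg hX hst
  have hy : Continuous fun u : Time T => η u - F u * x u := hη.sub (hFc.mul hxc)
  have h2 := mul_sub_mul_eq_of_rate hT h.hasDerivAt_feedback h.continuous_deriv_feedback
    (integrable_of_continuous hy) hx hst
  have hcN : Integrable fun u : Time T => (r + F u) * (p u)⁻¹ * N u :=
    integrable_of_continuous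
      ((h.continuous_deriv_inv_weight.comp continuous_subtype_val).mul hN)
  have h3 : (∫ u in Set.Ioc s t, (b * (x u - θ u) + r * (η u - F u * x u))) =
      (∫ u in Set.Ioc s t, ((r + F u) * (p u)⁻¹ * (N u - ∫ v in Set.Iic u, p v * b * θ v) +
        (p u)⁻¹ * (-(p u * b * θ u)))) -
      ∫ u in Set.Ioc s t, ((F u ^ 2 + r * F u - b) * x u + F u * (η u - F u * x u)) := by
    have e1 : ∀ u : Time T, (r + F u) * (p u)⁻¹ * (N u - ∫ v in Set.Iic u, p v * b * θ v) +
        (p u)⁻¹ * (-(p u * b * θ u)) = (r + F u) * η u - b * θ u := by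
      intro u
      have := (h.weight_pos u).ne'
      rw [hηN u]
      generalize (∫ v in Set.Iic u, p v * b * θ v) = J
      field_simp
      ring
    simp_rw [e1]
    rw [← integral_sub]
    · refine setIntegral_congr_fun measurableSet_Ioc fun u _ => ?_
      ring
    · exact ((integrable_of_continuous ((continuous_const.add hFc).mul hη)).sub
        (hθ.const_mul b)).integrableOn
    · exact (integrable_of_continuous
        (((h.continuous_deriv_feedback.comp continuous_subtype_val).mul hxc).add
          (hFc.mul hy))).integrableOn
  rw [h3, ← h2, setIntegral_Iic_sub hcN hst]
  simp only [← hηN] at h1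
  have h4 : (∫ u in Set.Ioc s t, ((r + F u) * (p u)⁻¹ * (N u - ∫ v in Set.Iic u, p v * b * θ v) +
      (p u)⁻¹ * (-(p u * b * θ u)))) = η t - η s - (((p t)⁻¹ * N t - (p s)⁻¹ * N s) -
      ∫ u in Set.Ioc s t, (r + F u) * (p u)⁻¹ * N u) := by
    rw [h1]
    simp only [Pi.neg_apply]
    ring
  rw [h4]
  ring

end IsFeedback

end ScalarSystem

/-! ### Uniqueness and existence for the scalar system with random target -/

section ScalarProcesses

variable {Ω : Type*} [mΩ : MeasurableSpace Ω] {T : ℝ} {P : Measure Ω}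
  {𝓕 : Filtration (Time T) mΩ}

/-- A continuous adapted process with uniformly bounded paths. -/
structure IsRegular (𝓕 : Filtration (Time T) mΩ) (P : Measure Ω) (X : Time T → Ω → ℝ) : Prop where
  adapted : Adapted 𝓕 X
  continuous_paths : ∀ ω, Continuous fun t => X t ω
  bounded : ∃ C, ∀ᵐ ω ∂P, ∀ t, |X t ω| ≤ C

namespace IsRegular

variable {X Y : Time T → Ω → ℝ}

lemma isProg (hT : 0 ≤ T) (hX : IsRegular 𝓕 P X) : IsProg 𝓕 X :=
  isProg_of_continuous hT hX.adapted hX.continuous_paths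

lemma add (hX : IsRegular 𝓕 P X) (hY : IsRegular 𝓕 P Y) :
    IsRegular 𝓕 P fun t ω => X t ω + Y t ω := by
  obtain ⟨C, hC⟩ := hX.bounded
  obtain ⟨D, hD⟩ := hY.bounded
  refine ⟨fun t => (hX.adapted t).add (hY.adapted t),
    fun ω => (hX.continuous_paths ω).add (hY.continuous_paths ω), C + D, ?_⟩
  filter_upwards [hC, hD] with ω h1 h2 t
  exact (abs_add_le _ _).trans (add_le_add (h1 t) (h2 t))

lemma det_mul (hX : IsRegular 𝓕 P X) {c : ℝ → ℝ} (hc : Continuous c) :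
    IsRegular 𝓕 P fun t ω => c t * X t ω := by
  obtain ⟨C, hC⟩ := hX.bounded
  obtain ⟨D, hD, hDb⟩ := exists_abs_le_time (T := T) hc
  refine ⟨fun t => (hX.adapted t).const_mul _,
    fun ω => (hc.comp continuous_subtype_val).mul (hX.continuous_paths ω), D * C, ?_⟩
  filter_upwards [hC] with ω h1 t
  rw [abs_mul]
  exact mul_le_mul (hDb t) (h1 t) (abs_nonneg _) hD

lemma sub (hX : IsRegular 𝓕 P X) (hY : IsRegular 𝓕 P Y) :
    IsRegular 𝓕 P fun t ω => X t ω - Y t ω := by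
  have := hX.add (hY.det_mul (c := fun _ => -1) continuous_const)
  simpa [sub_eq_add_neg] using this

lemma integral (hT : 0 ≤ T) (hX : IsRegular 𝓕 P X) :
    IsRegular 𝓕 P fun t ω => ∫ u in Set.Iic t, X u ω := by
  obtain ⟨C, hC⟩ := hX.bounded
  refine ⟨(hX.isProg hT).adapted_integral, fun ω => continuous_setIntegral_Iic hT
    (integrable_of_continuous (hX.continuous_paths ω)),
    max C 0 * volume.real (Set.univ : Set (Time T)), ?_⟩
  filter_upwards [hC] with ω h1 t
  exact abs_setIntegral_le (ae_of_all _ fun t => (h1 t).trans (le_max_left _ _))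
    (le_max_right _ _) _

end IsRegular

/-- A bound which holds a.s. at each time holds along a.s. continuous paths. -/
lemma ae_forall_abs_le_of_continuous {X : Time T → Ω → ℝ} {C : ℝ}
    (hX : ∀ᵐ ω ∂P, Continuous fun t => X t ω) (h : ∀ t, ∀ᵐ ω ∂P, |X t ω| ≤ C) :
    ∀ᵐ ω ∂P, ∀ t, |X t ω| ≤ C := by
  -- The inequality is encoded as an equality of two continuous processes, to which
  -- indistinguishability applies.
  have := ae_forall_eq_of_continuous (P := P) (X := fun t ω => max |X t ω| C) (Y := fun _ _ => C)
    (by filter_upwards [hX] with ω hω using hω.abs.max continuous_const)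
    (ae_of_all _ fun _ => continuous_const)
    (fun t => by filter_upwards [h t] with ω hω using max_eq_right hω)
  filter_upwards [this] with ω hω t
  exact max_eq_right_iff.1 (hω t)

lemma ae_integrable_path {X : Time T → Ω → ℝ}
    (hX : Measurable fun p : Time T × Ω => X p.1 p.2) {C : ℝ}
    (hb : ∀ᵐ ω ∂P, ∀ᵐ t : Time T, |X t ω| ≤ C) : ∀ᵐ ω ∂P, Integrable fun t => X t ω := by
  filter_upwards [hb] with ω hω
  exact integrable_path (hX.comp measurable_prodMk_right) hω

lemma ae_det_mul_le {X : Time T → Ω → ℝ} {C : ℝ} {c : ℝ → ℝ} (hc : Continuous c)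
    (hb : ∀ᵐ ω ∂P, ∀ᵐ t : Time T, |X t ω| ≤ C) :
    ∃ D, 0 ≤ D ∧ ∀ᵐ ω ∂P, ∀ᵐ t : Time T, |c t * X t ω| ≤ D := by
  obtain ⟨D, hD, hDb⟩ := exists_abs_le_time (T := T) hc
  refine ⟨D * max C 0, mul_nonneg hD (le_max_right _ _), ?_⟩
  filter_upwards [hb] with ω hω
  filter_upwards [hω] with t ht
  rw [abs_mul]
  exact mul_le_mul (hDb t) (ht.trans (le_max_left _ _)) (abs_nonneg _) hD

lemma IsProg.integrable_setIntegral [IsFiniteMeasure P] (hT : 0 ≤ T) {X : Time T → Ω → ℝ}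
    (hX : IsProg 𝓕 X) {C : ℝ} (hb : ∀ᵐ ω ∂P, ∀ᵐ t : Time T, |X t ω| ≤ C) (A : Set (Time T)) :
    Integrable (fun ω => ∫ s in A, X s ω) P := by
  have h : Integrable (fun q : Time T × Ω => X q.1 q.2)
      ((volume.restrict A).prod (P.restrict Set.univ)) := by
    rw [Measure.prod_restrict]
    exact (integrable_prod_of_bounded (hX.measurable_uncurry hT) hb).restrict
  have := h.integral_prod_right
  rwa [Measure.restrict_univ] at this

namespace IsFeedback

variable {b r : ℝ} {F p : ℝ → ℝ}

/-- Every solution of the scalar forward-backward system is given by the feedback form. -/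
theorem ae_eq_feedback [IsProbabilityMeasure P] (h : IsFeedback T b r F p) (hT : 0 ≤ T)
    {x y m θ η : Time T → Ω → ℝ} (hθ : IsProg 𝓕 θ) {Cθ : ℝ}
    (hθb : ∀ᵐ ω ∂P, ∀ᵐ t : Time T, |θ t ω| ≤ Cθ) (hm : Martingale m 𝓕 P) (hmp : IsProg 𝓕 m) {Cm : ℝ}
    (hmb : ∀ᵐ ω ∂P, ∀ᵐ t : Time T, |m t ω| ≤ Cm) (hmc : ∀ᵐ ω ∂P, Continuous fun t => m t ω)
    (hyp : IsProg 𝓕 y) (hyc : ∀ᵐ ω ∂P, Continuous fun t => y t ω)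
    (hx : ∀ᵐ ω ∂P, ∀ t, x t ω = ∫ u in Set.Iic t, y u ω)
    (hdyn : ∀ᵐ ω ∂P, ∀ s t, s ≤ t → y t ω - y s ω =
      (∫ u in Set.Ioc s t, (b * (x u ω - θ u ω) + r * y u ω)) + (m t ω - m s ω))
    (e : Time T) (he : (e : ℝ) = T) (hend : ∀ᵐ ω ∂P, y e ω = 0)
    (hηc : ∀ᵐ ω ∂P, Continuous fun t => η t ω)
    (hη : ∀ t : Time T, η t =ᵐ[P] fun ω =>
      (p t)⁻¹ * (P[fun ω' => ∫ s in Set.Ici t, p s * b * θ s ω' | 𝓕 t]) ω) :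
    ∀ᵐ ω ∂P, ∀ t : Time T, y t ω = η t ω - F t * x t ω ∧
      x t ω = ∫ s in Set.Iic t, Real.exp (-∫ u in (s : ℝ)..t, F u) * η s ω := by
  have hle : ∀ t : Time T, t ≤ e := fun t => by
    change (t : ℝ) ≤ e; rw [he]; exact t.2.2
  have hpb : Continuous fun u => p u * b := h.continuous_weight.mul continuous_const
  have hpθ : IsProg 𝓕 fun t ω => p t * b * θ t ω := hθ.det_mul hpb
  obtain ⟨D, hD, hpθb⟩ := ae_det_mul_le hpb hθb
  have hθi := ae_integrable_path (hθ.measurable_uncurry hT) hθb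
  have hnmart := martingale_weighted hT hm hmp hmb h.hasDerivAt_weight h.continuous_deriv_weight
  -- Up to a constant `n` is `∫ p dm`; the conditional expectation of its increment after `t`
  -- vanishes.
  set n : Time T → Ω → ℝ :=
    fun t ω => p t * m t ω - ∫ u in Set.Iic t, -(r + F u) * p u * m u ω with hn
  have hIint : ∀ t : Time T, Integrable (fun ω => ∫ s in Set.Ici t, p s * b * θ s ω) P :=
    fun t => hpθ.integrable_setIntegral hT hpθb _
  have key : ∀ t : Time T, (fun ω => y t ω + F t * x t ω) =ᵐ[P] η t := by
    intro t
    have hR : (fun ω => p t * (y t ω + F t * x t ω)) =ᵐ[P]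
        (fun ω => (∫ s in Set.Ici t, p s * b * θ s ω)) - (n e - n t) := by
      filter_upwards [hθi, hmc, hyc, hx, hdyn, hend] with ω h1 h2 h3 h4 h5 h6
      have h7 := h.weight_mul_residual hT h3 h2 h1 h4 h5 (hle t)
      have h8 : Integrable fun u : Time T => -(r + F u) * p u * m u ω :=
        integrable_of_continuous ((h.continuous_deriv_weight.comp continuous_subtype_val).mul h2)
      simp only [Pi.sub_apply, hn]
      rw [setIntegral_Ici_eq t e he, setIntegral_Iic_sub h8 (hle t)]
      rw [h6, he, h.feedback_end] at h7
      rw [he]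
      linarith
    have hRint : Integrable (fun ω => p t * (y t ω + F t * x t ω)) P :=
      ((hIint t).sub ((hnmart.integrable e).sub (hnmart.integrable t))).congr hR.symm
    -- Nothing is assumed about measurability of `x`; it is replaced by the running integral of the
    -- progressive process `y`.
    have hmeas : (fun ω => p t * (y t ω + F t * x t ω)) =ᵐ[P]
        fun ω => p t * (y t ω + F t * ∫ u in Set.Iic t, y u ω) := by
      filter_upwards [hx] with ω hω
      rw [hω]
    have hgm : StronglyMeasurable[𝓕 t] fun ω => p t * (y t ω + F t * ∫ u in Set.Iic t, y u ω) :=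
      (((hyp.adapted t).add ((hyp.adapted_integral t).const_mul _)).const_mul _).stronglyMeasurable
    have h1 : P[fun ω => p t * (y t ω + F t * x t ω) | 𝓕 t] =ᵐ[P]
        fun ω => p t * (y t ω + F t * x t ω) := by
      refine (condExp_congr_ae hmeas).trans ?_
      rw [condExp_of_stronglyMeasurable (𝓕.le t) hgm (hRint.congr hmeas)]
      exact hmeas.symm
    have h2 : P[fun ω => p t * (y t ω + F t * x t ω) | 𝓕 t] =ᵐ[P]
        P[fun ω => (∫ s in Set.Ici t, p s * b * θ s ω) | 𝓕 t] := by
      refine (condExp_congr_ae hR).trans ?_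
      refine (condExp_sub (hIint t) ((hnmart.integrable e).sub (hnmart.integrable t)) _).trans ?_
      have h3 : P[n e - n t | 𝓕 t] =ᵐ[P] 0 := by
        refine (condExp_sub (hnmart.integrable e) (hnmart.integrable t) _).trans ?_
        filter_upwards [hnmart.condExp_ae_eq (hle t), hnmart.condExp_ae_eq (le_refl t)]
          with ω h4 h5
        simp [h4, h5]
      filter_upwards [h3] with ω h4
      simp [h4]
    filter_upwards [h1, h2, hη t] with ω h1 h2 h3
    rw [h3, ← h2, h1, inv_mul_cancel_left₀ (h.weight_pos t).ne']
  have hxc : ∀ᵐ ω ∂P, Continuous fun t => x t ω := by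
    filter_upwards [hx, hyc] with ω h1 h2
    rw [funext h1]
    exact continuous_setIntegral_Iic hT (integrable_of_continuous h2)
  have hall := ae_forall_eq_of_continuous (P := P) (X := fun t ω => y t ω + F t * x t ω) (Y := η)
    (by
      filter_upwards [hyc, hxc] with ω h1 h2
      exact h1.add ((h.continuous_feedback.comp continuous_subtype_val).mul h2)) hηc key
  filter_upwards [hall, hx, hyc, hηc] with ω h1 h2 h3 h4 t
  have h5 : ∀ t : Time T, y t ω = η t ω - F t * x t ω := fun t => by rw [← h1 t]; ring
  exact ⟨h5 t, h.eq_integral_of_rate hT (integrable_of_continuous h3)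
    (integrable_of_continuous h4) h2 h5 t⟩

/-- Existence for the scalar forward-backward system. -/
theorem exists_solution [IsProbabilityMeasure P]
    (hnull : ∀ A, MeasurableSet A → P A = 0 → ∀ t, MeasurableSet[𝓕 t] A)
    (hcont : ∀ ξ, HasContVersion 𝓕 P ξ) (h : IsFeedback T b r F p) (hT : 0 ≤ T)
    {θ : Time T → Ω → ℝ} (hθ : IsProg 𝓕 θ) {Cθ : ℝ}
    (hθb : ∀ᵐ ω ∂P, ∀ᵐ t : Time T, |θ t ω| ≤ Cθ) (e : Time T) (he : (e : ℝ) = T) :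
    ∃ η x y m : Time T → Ω → ℝ, IsRegular 𝓕 P η ∧ IsRegular 𝓕 P x ∧ IsRegular 𝓕 P y ∧
      IsRegular 𝓕 P m ∧ Martingale m 𝓕 P ∧
      (∀ᵐ ω ∂P, ∀ t, x t ω = ∫ u in Set.Iic t, y u ω) ∧
      (∀ᵐ ω ∂P, ∀ s t, s ≤ t → y t ω - y s ω =
        (∫ u in Set.Ioc s t, (b * (x u ω - θ u ω) + r * y u ω)) + (m t ω - m s ω)) ∧
      (∀ᵐ ω ∂P, y e ω = 0) ∧
      ∀ t : Time T, η t =ᵐ[P] fun ω =>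
        (p t)⁻¹ * (P[fun ω' => ∫ s in Set.Ici t, p s * b * θ s ω' | 𝓕 t]) ω := by
  have hle : ∀ t : Time T, t ≤ e := fun t => by
    change (t : ℝ) ≤ e; rw [he]; exact t.2.2
  have hpb : Continuous fun u => p u * b := h.continuous_weight.mul continuous_const
  have hpθ : IsProg 𝓕 fun t ω => p t * b * θ t ω := hθ.det_mul hpb
  obtain ⟨D, hD, hpθb⟩ := ae_det_mul_le hpb hθb
  have hθi := ae_integrable_path (hθ.measurable_uncurry hT) hθb
  have hpθi := ae_integrable_path (hpθ.measurable_uncurry hT) hpθb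
  set J : Time T → Ω → ℝ := fun t ω => ∫ u in Set.Iic t, p u * b * θ u ω with hJ
  have hJad : Adapted 𝓕 J := hpθ.adapted_integral
  set D' := D * volume.real (Set.univ : Set (Time T)) with hD'
  have hJb : ∀ᵐ ω ∂P, ∀ t, |J t ω| ≤ D' := by
    filter_upwards [hpθb] with ω hω t using abs_setIntegral_le hω hD _
  have hJc : ∀ᵐ ω ∂P, Continuous fun t => J t ω := by
    filter_upwards [hpθi] with ω hω using continuous_setIntegral_Iic hT hω
  have hJint : ∀ t, Integrable (J t) P := fun t =>
    Integrable.of_bound ((hJad t).mono (𝓕.le t) le_rfl).aestronglyMeasurable D'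
      (hJb.mono fun ω hω => hω t)
  obtain ⟨N₀, hN₀c, hN₀⟩ := hcont (J e)
  obtain ⟨N, hNad, hNc, hNN₀⟩ := exists_continuous_adapted_modification hT hnull hN₀c
    fun t => ⟨P[J e | 𝓕 t], stronglyMeasurable_condExp.measurable, hN₀ t⟩
  have hNe : ∀ t, N t =ᵐ[P] P[J e | 𝓕 t] := fun t => by
    filter_upwards [hNN₀, hN₀ t] with ω h1 h2
    rw [h1, h2]
  have hNb : ∀ᵐ ω ∂P, ∀ t, |N t ω| ≤ D' := by
    refine ae_forall_abs_le_of_continuous (ae_of_all _ hNc) fun t => ?_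
    have h1 := ae_bdd_abs_condExp_of_ae_bdd_abs (m := 𝓕 t) (μ := P) (f := J e)
      (R := D') (hJb.mono fun ω hω => hω e)
    filter_upwards [h1, hNe t] with ω h1 h2
    rw [h2]
    exact h1
  have hNreg : IsRegular 𝓕 P N := ⟨hNad, hNc, D', hNb⟩
  have hNmart : Martingale N 𝓕 P := (martingale_condExp (J e) 𝓕 P).congr
    (fun t => (hNad t).stronglyMeasurable) fun t => (hNe t).symm
  have hic : Continuous fun t : Time T => (p t)⁻¹ :=
    h.continuous_inv_weight.comp continuous_subtype_val
  obtain ⟨η, hηad, hηc, hηe⟩ := exists_continuous_adapted_modification (P := P) (𝓕 := 𝓕) hT hnull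
    (X := fun t ω => (p t)⁻¹ * (N t ω - J t ω))
    (by filter_upwards [hJc] with ω hω using hic.mul ((hNc ω).sub hω))
    fun t => ⟨_, ((hNad t).sub (hJad t)).const_mul _, ae_eq_refl _⟩
  obtain ⟨Ci, hCi, hCib⟩ := exists_abs_le_time (T := T) h.continuous_inv_weight
  have hηreg : IsRegular 𝓕 P η := by
    refine ⟨hηad, hηc, Ci * (D' + D'), ?_⟩
    filter_upwards [hηe, hNb, hJb] with ω h1 h2 h3 t
    rw [h1, abs_mul]
    exact mul_le_mul (hCib t) ((abs_sub _ _).trans (add_le_add (h2 t) (h3 t))) (abs_nonneg _) hCi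
  -- The separated form of the explicit formula exhibits `x` as a regular process.
  set x : Time T → Ω → ℝ := fun t ω => Real.exp (-∫ v in (0 : ℝ)..t, F v) *
    ∫ s in Set.Iic t, Real.exp (∫ v in (0 : ℝ)..s, F v) * η s ω with hxdef
  have hxreg : IsRegular 𝓕 P x :=
    ((hηreg.det_mul h.continuous_exp_primitive).integral hT).det_mul h.continuous_exp_neg_primitive
  have hxη : ∀ ω (t : Time T), x t ω =
      ∫ s in Set.Iic t, Real.exp (-∫ u in (s : ℝ)..t, F u) * η s ω := by
    intro ω t
    have he : ∀ s : Time T, Real.exp (-∫ u in (s : ℝ)..t, F u) * η s ω =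
        Real.exp (-∫ v in (0 : ℝ)..t, F v) * (Real.exp (∫ v in (0 : ℝ)..s, F v) * η s ω) :=
      fun s => by rw [h.exp_neg_integral_eq, mul_assoc]
    simp only [he]
    rw [integral_const_mul]
  have hyreg := hηreg.sub (hxreg.det_mul h.continuous_feedback)
  -- The martingale part is `∫ p⁻¹ dN` up to a constant, written by parts.
  have hmreg := (hNreg.det_mul h.continuous_inv_weight).sub
    ((hNreg.det_mul h.continuous_deriv_inv_weight).integral hT)
  have hmmart := martingale_weighted hT hNmart (hNreg.isProg hT)
    (hNb.mono fun ω hω => ae_of_all _ hω) h.hasDerivAt_inv_weight h.continuous_deriv_inv_weight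
  have hxy : ∀ ω (t : Time T), x t ω = ∫ u in Set.Iic t, (η u ω - F u * x u ω) := fun ω t =>
    h.integral_rate_of_eq hT (integrable_of_continuous (hηc ω)) (hxη ω) t
  refine ⟨η, x, _, _, hηreg, hxreg, hyreg, hmreg, hmmart, ae_of_all _ hxy, ?_, ?_, fun t => ?_⟩
  · filter_upwards [hθi, hηe] with ω h1 h2 s t hst
    exact h.dynamics_of_closed_loop hT (hNc ω) (hηc ω) h1 h2 (hxy ω) (hxreg.continuous_paths ω) hst
  -- At the terminal time `N` equals `J`, so `η(T) = 0`; together with `F(T) = 0` this gives the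
  -- terminal condition.
  · have h1 : N e =ᵐ[P] J e := by
      refine (hNe e).trans ?_
      rw [condExp_of_stronglyMeasurable (𝓕.le e) (hJad e).stronglyMeasurable (hJint e)]
    filter_upwards [hηe, h1] with ω h2 h3
    rw [h2, h3, he, h.feedback_end]
    simp
  · have h1 : (fun ω => ∫ s in Set.Ici t, p s * b * θ s ω) =ᵐ[P] J e - J t := by
      filter_upwards [hpθi] with ω hω
      simp only [Pi.sub_apply, hJ]
      rw [setIntegral_Ici_eq t e he, setIntegral_Iic_sub hω (hle t)]
      ring
    have h2 : P[fun ω => ∫ s in Set.Ici t, p s * b * θ s ω | 𝓕 t] =ᵐ[P] P[J e | 𝓕 t] - J t := by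
      refine (condExp_congr_ae h1).trans ((condExp_sub (hJint e) (hJint t) _).trans ?_)
      rw [condExp_of_stronglyMeasurable (𝓕.le t) (hJad t).stronglyMeasurable (hJint t)]
    filter_upwards [hηe, h2, hNe t] with ω h3 h4 h5
    rw [h3, h4, h5]
    rfl

end IsFeedback

end ScalarProcesses

/-! ### The scalar coefficients -/

section ScalarCoefficients

variable (b r T : ℝ)

/-- The positive root `√(b + r² / 4)`. -/
noncomputable def scalarRoot : ℝ := √(b + r ^ 2 / 4)

/-- The scalar version of `matG`. -/
noncomputable def scalarG (t : ℝ) : ℝ := Real.cosh ((T - t) * scalarRoot b r)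

/-- The derivative of `scalarG`. -/
noncomputable def scalarG' (t : ℝ) : ℝ :=
  -scalarRoot b r * Real.sinh ((T - t) * scalarRoot b r)

/-- The scalar version of `matK`. -/
noncomputable def scalarK (t : ℝ) : ℝ :=
  (b + r ^ 2 / 4) * scalarG b r T t - r / 2 * scalarG' b r T t

/-- The scalar version of `matF`. -/
noncomputable def scalarF (t : ℝ) : ℝ := -((scalarK b r T t)⁻¹ * b * scalarG' b r T t)

/-- The integrating factor `e^{-(r/2) t} K(t)`. -/
noncomputable def scalarWeight (t : ℝ) : ℝ := Real.exp (-(r / 2) * t) * scalarK b r T t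

variable {b r T}

lemma scalarRoot_pos (hb : 0 < b) : 0 < scalarRoot b r := Real.sqrt_pos.2 (by positivity)

lemma scalarRoot_sq (hb : 0 < b) : scalarRoot b r ^ 2 = b + r ^ 2 / 4 :=
  Real.sq_sqrt (by positivity)

lemma half_rate_lt_scalarRoot (hb : 0 < b) : r / 2 < scalarRoot b r := by
  refine Real.lt_sqrt_of_sq_lt ?_
  nlinarith

lemma hasDerivAt_scalarG (t : ℝ) : HasDerivAt (scalarG b r T) (scalarG' b r T t) t := by
  have h := (((hasDerivAt_id t).const_sub T).mul_const (scalarRoot b r)).cosh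
  refine h.congr_deriv ?_
  simp only [scalarG', id]
  ring

lemma hasDerivAt_scalarG' (hb : 0 < b) (t : ℝ) :
    HasDerivAt (scalarG' b r T) ((b + r ^ 2 / 4) * scalarG b r T t) t := by
  have h := ((((hasDerivAt_id t).const_sub T).mul_const (scalarRoot b r)).sinh).const_mul
    (-scalarRoot b r)
  refine h.congr_deriv ?_
  simp only [scalarG, id, ← scalarRoot_sq hb]
  ring

/-- With `w` the root and `s = (T - t) w`, `K = w (w cosh s + (r / 2) sinh s)`. Positivity follows
from `sinh s > -cosh s` and `0 ≤ r / 2 < w`, for every real `t`, so the differential identities hold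
on the whole line. -/
lemma scalarK_pos (hb : 0 < b) (hr : 0 ≤ r) (t : ℝ) : 0 < scalarK b r T t := by
  set w := scalarRoot b r with hw
  set s := (T - t) * w with hs
  have hw0 : 0 < w := scalarRoot_pos hb
  have hrw : r / 2 < w := half_rate_lt_scalarRoot hb
  have hK : scalarK b r T t = w * (w * Real.cosh s + r / 2 * Real.sinh s) := by
    simp only [scalarK, scalarG, scalarG', ← scalarRoot_sq hb, ← hw, ← hs]
    ring
  have hc : 0 < Real.cosh s := Real.cosh_pos s
  have h1 : -Real.cosh s < Real.sinh s := by
    have := Real.exp_pos s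
    rw [← Real.cosh_add_sinh] at this
    linarith
  rw [hK]
  refine mul_pos hw0 ?_
  nlinarith

lemma hasDerivAt_scalarK (hb : 0 < b) (t : ℝ) :
    HasDerivAt (scalarK b r T)
      ((b + r ^ 2 / 4) * scalarG' b r T t - r / 2 * ((b + r ^ 2 / 4) * scalarG b r T t)) t :=
  ((hasDerivAt_scalarG t).const_mul _).sub ((hasDerivAt_scalarG' hb t).const_mul _)

/-- From `G'' = Δ G` and `Δ = b + r² / 4` one gets `K' = b G' - (r / 2) K`. This yields both the
Riccati equation for `-b G' / K` and the linear equation for `e^{-r t / 2} K`. -/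
theorem isFeedback_scalar (hb : 0 < b) (hr : 0 ≤ r) :
    IsFeedback T b r (scalarF b r T) (scalarWeight b r T) where
  hasDerivAt_feedback u := by
    have hk := (scalarK_pos (T := T) hb hr u).ne'
    have h := (((((hasDerivAt_scalarK (T := T) (r := r) hb u).inv hk).mul_const b).mul
      (hasDerivAt_scalarG' (T := T) (r := r) hb u))).neg
    refine h.congr_deriv ?_
    have hKdef : scalarK b r T u =
      (b + r ^ 2 / 4) * scalarG b r T u - r / 2 * scalarG' b r T u := rfl
    simp only [scalarF, Pi.inv_apply]
    field_simp
    rw [hKdef]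
    ring
  hasDerivAt_weight u := by
    have hk := (scalarK_pos (T := T) hb hr u).ne'
    have h := (((hasDerivAt_id u).const_mul (-(r / 2))).exp).mul
      (hasDerivAt_scalarK (T := T) (r := r) hb u)
    refine h.congr_deriv ?_
    have hKdef : scalarK b r T u =
      (b + r ^ 2 / 4) * scalarG b r T u - r / 2 * scalarG' b r T u := rfl
    simp only [scalarF, scalarWeight, id]
    field_simp
    rw [hKdef]
    ring
  weight_pos u := mul_pos (Real.exp_pos _) (scalarK_pos hb hr u)
  feedback_end := by simp [scalarF, scalarG']

/-- Together with `inv_scalarK_mul_exp` this identifies the discounted kernel `K(t)⁻¹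
e^{-(r/2)(s-t)} K(s)` with `p(t)⁻¹ p(s)`. -/
lemma exp_mul_scalarK (s t : ℝ) : Real.exp (-(r / 2) * (s - t)) * scalarK b r T s =
    Real.exp (r / 2 * t) * scalarWeight b r T s := by
  rw [scalarWeight, ← mul_assoc, ← Real.exp_add]
  ring_nf

lemma inv_scalarK_mul_exp (t : ℝ) :
    (scalarK b r T t)⁻¹ * Real.exp (r / 2 * t) = (scalarWeight b r T t)⁻¹ := by
  rw [scalarWeight, mul_inv, ← Real.exp_neg, mul_comm]
  ring_nf

end ScalarCoefficients

/-! ### Simultaneously diagonalised matrix coefficients -/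

section ConjDiag

/-- The matrix `V diag(a) U`, where `U` is meant to be the inverse of `V`. -/
def conjDiag {R : Type*} [CommRing R] {d : ℕ} (V U : Matrix (Fin d) (Fin d) R) (a : Fin d → R) :
    Matrix (Fin d) (Fin d) R :=
  V * Matrix.diagonal a * U

section Ring

variable {R : Type*} [CommRing R] {d : ℕ} {V U : Matrix (Fin d) (Fin d) R}

lemma conjDiag_apply (a : Fin d → R) (i j : Fin d) :
    conjDiag V U a i j = ∑ k, V i k * a k * U k j := by
  simp [conjDiag, Matrix.mul_apply, Matrix.diagonal_apply]

lemma conjDiag_mul (h : U * V = 1) (a b : Fin d → R) :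
    conjDiag V U a * conjDiag V U b = conjDiag V U fun i => a i * b i := by
  calc conjDiag V U a * conjDiag V U b
      = V * Matrix.diagonal a * (U * V) * Matrix.diagonal b * U := by
        simp only [conjDiag, Matrix.mul_assoc]
    _ = _ := by rw [h, Matrix.mul_one, Matrix.mul_assoc V, Matrix.diagonal_mul_diagonal]; rfl

lemma conjDiag_one (h : V * U = 1) : conjDiag V U (fun _ => 1) = 1 := by
  simp [conjDiag, h]

lemma conjDiag_add (a b : Fin d → R) :
    conjDiag V U a + conjDiag V U b = conjDiag V U fun i => a i + b i := by
  ext i j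
  simp only [Matrix.add_apply, conjDiag_apply, ← Finset.sum_add_distrib]
  exact Finset.sum_congr rfl fun k _ => by ring

lemma conjDiag_smul (c : R) (a : Fin d → R) :
    c • conjDiag V U a = conjDiag V U fun i => c * a i := by
  ext i j
  simp only [Matrix.smul_apply, smul_eq_mul, conjDiag_apply, Finset.mul_sum]
  exact Finset.sum_congr rfl fun k _ => by ring

lemma conjDiag_neg (a : Fin d → R) : -conjDiag V U a = conjDiag V U fun i => -a i := by
  simpa using conjDiag_smul (V := V) (U := U) (-1) a

lemma conjDiag_sub (a b : Fin d → R) :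
    conjDiag V U a - conjDiag V U b = conjDiag V U fun i => a i - b i := by
  rw [sub_eq_add_neg, conjDiag_neg, conjDiag_add]
  simp only [sub_eq_add_neg]

lemma conjDiag_smul_one (h : V * U = 1) (c : R) :
    c • (1 : Matrix (Fin d) (Fin d) R) = conjDiag V U fun _ => c := by
  rw [← conjDiag_one h, conjDiag_smul]
  simp

end Ring

section Field

variable {R : Type*} [Field R] {d : ℕ} {V U : Matrix (Fin d) (Fin d) R}

lemma conjDiag_mul_inv (h : V * U = 1) {a : Fin d → R} (ha : ∀ i, a i ≠ 0) :
    conjDiag V U a * conjDiag V U (fun i => (a i)⁻¹) = 1 := by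
  rw [conjDiag_mul (mul_eq_one_comm.1 h), ← conjDiag_one h]
  congr 1
  funext i
  exact mul_inv_cancel₀ (ha i)

lemma isUnit_conjDiag (h : V * U = 1) {a : Fin d → R} (ha : ∀ i, a i ≠ 0) :
    IsUnit (conjDiag V U a) :=
  IsUnit.of_mul_eq_one _ (conjDiag_mul_inv h ha)

lemma inv_conjDiag (h : V * U = 1) {a : Fin d → R} (ha : ∀ i, a i ≠ 0) :
    (conjDiag V U a)⁻¹ = conjDiag V U fun i => (a i)⁻¹ :=
  Matrix.inv_eq_right_inv (conjDiag_mul_inv h ha)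

lemma exists_eq_of_mem_spectrum_conjDiag (h : V * U = 1) {a : Fin d → R} {z : R}
    (hz : z ∈ spectrum R (conjDiag V U a)) : ∃ i, z = a i := by
  by_contra! hne
  refine hz (spectrum.mem_resolventSet_iff.2 ?_)
  rw [Algebra.algebraMap_eq_smul_one, conjDiag_smul_one h, conjDiag_sub]
  exact isUnit_conjDiag h fun i => sub_ne_zero.2 (hne i)

end Field

section Real

variable {d : ℕ} {V U : Matrix (Fin d) (Fin d) ℝ}

lemma exp_conjDiag (h : V * U = 1) (a : Fin d → ℝ) :
    NormedSpace.exp (conjDiag V U a) = conjDiag V U fun i => Real.exp (a i) := by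
  have hU : U = V⁻¹ := (Matrix.inv_eq_right_inv h).symm
  have hV : IsUnit V := IsUnit.of_mul_eq_one _ h
  simp only [conjDiag, hU]
  rw [Matrix.exp_conj _ _ hV, Matrix.exp_diagonal]
  congr 3
  funext i
  simp [Real.exp_eq_exp_ℝ, Pi.coe_exp]

lemma matrixDeriv_conjDiag {a a' : Fin d → ℝ → ℝ} {t : ℝ}
    (ha : ∀ i, HasDerivAt (a i) (a' i t) t) :
    matrixDeriv (fun u => conjDiag V U fun i => a i u) t = conjDiag V U fun i => a' i t := by
  ext i j
  simp only [matrixDeriv, Matrix.of_apply, conjDiag_apply]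
  refine HasDerivAt.deriv ?_
  have := HasDerivAt.sum (u := Finset.univ) fun k _ =>
    ((ha k).const_mul (V i k)).mul_const (U k j)
  refine this.congr_of_eventuallyEq (Eventually.of_forall fun u => ?_)
  simp [Finset.sum_apply]

lemma matrixIntegral_conjDiag {a : Fin d → ℝ → ℝ} (ha : ∀ i, Continuous (a i)) (s t : ℝ) :
    matrixIntegral (fun u => conjDiag V U fun i => a i u) s t =
      conjDiag V U fun i => ∫ u in s..t, a i u := by
  ext i j
  simp only [matrixIntegral, Matrix.of_apply, conjDiag_apply]
  rw [intervalIntegral.integral_finsetSum fun k _ =>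
    (((ha k).const_mul (V i k)).mul_const (U k j)).intervalIntegrable _ _]
  refine Finset.sum_congr rfl fun k _ => ?_
  rw [intervalIntegral.integral_mul_const, intervalIntegral.integral_const_mul]

end Real

end ConjDiag

/-! ### The principal square root and the hyperbolic cosine -/

section MatrixFunctions

variable {d : ℕ} {V U : Matrix (Fin d) (Fin d) ℝ}

/-- The diagonalisation persists after complexification, so every complex eigenvalue is one of the
positive numbers `a i`. -/
theorem isPrincipalSqrt_conjDiag (h : V * U = 1) {a : Fin d → ℝ} (ha : ∀ i, 0 < a i) :
    IsPrincipalSqrt (conjDiag V U fun i => a i ^ 2) (conjDiag V U a) := by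
  refine ⟨by rw [conjDiag_mul (mul_eq_one_comm.1 h)]; simp only [sq], fun z hz => ?_⟩
  have hmap : (conjDiag V U a).map (algebraMap ℝ ℂ) =
      conjDiag (V.map (algebraMap ℝ ℂ)) (U.map (algebraMap ℝ ℂ)) fun i => algebraMap ℝ ℂ (a i) := by
    ext i j
    simp only [Matrix.map_apply, conjDiag_apply, map_sum, map_mul]
  have h' : V.map (algebraMap ℝ ℂ) * U.map (algebraMap ℝ ℂ) = 1 := by
    rw [← Matrix.map_mul, h, Matrix.map_one _ (map_zero _) (map_one _)]
  rw [hmap] at hz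
  obtain ⟨i, rfl⟩ := exists_eq_of_mem_spectrum_conjDiag h' hz
  simpa using ha i

lemma isPrincipalSqrt_principalSqrt {A S : Matrix (Fin d) (Fin d) ℝ} (h : IsPrincipalSqrt A S) :
    IsPrincipalSqrt A (principalSqrt A) := by
  have hex : ∃ S, IsPrincipalSqrt A S := ⟨S, h⟩
  rw [principalSqrt, dif_pos hex]
  exact hex.choose_spec

section Cosh

attribute [local instance] Matrix.linftyOpNormedRing Matrix.linftyOpNormedAlgebra

lemma hasSum_exp_add_exp_neg (A : Matrix (Fin d) (Fin d) ℝ) :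
    HasSum (fun n : ℕ => ((n.factorial : ℝ)⁻¹) • (A ^ n + (-A) ^ n))
      (NormedSpace.exp A + NormedSpace.exp (-A)) := by
  simp only [smul_add]
  exact (NormedSpace.exp_series_hasSum_exp' (𝕂 := ℝ) A).add
    (NormedSpace.exp_series_hasSum_exp' (𝕂 := ℝ) (-A))

end Cosh

/-- The hyperbolic cosine of a matrix depends only on the square of the matrix. -/
lemma matrixCosh_congr {A A' : Matrix (Fin d) (Fin d) ℝ} (h : A * A = A' * A') :
    matrixCosh A = matrixCosh A' := by
  rw [matrixCosh, matrixCosh]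
  congr 1
  refine (hasSum_exp_add_exp_neg A).unique ?_
  convert hasSum_exp_add_exp_neg A' using 1
  funext n
  congr 1
  -- Odd powers cancel in the sum, and even powers are powers of the square.
  rcases Nat.even_or_odd n with hn | hn
  · rw [hn.neg_pow, hn.neg_pow]
    obtain ⟨k, rfl⟩ := hn
    simp only [← two_mul, pow_mul, sq, h]
  · rw [hn.neg_pow, hn.neg_pow, add_neg_cancel, add_neg_cancel]

lemma matrixCosh_conjDiag (h : V * U = 1) (a : Fin d → ℝ) :
    matrixCosh (conjDiag V U a) = conjDiag V U fun i => Real.cosh (a i) := by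
  rw [matrixCosh, conjDiag_neg, exp_conjDiag h, exp_conjDiag h, conjDiag_add, conjDiag_smul]
  congr 1
  funext i
  rw [Real.cosh_eq]
  ring

end MatrixFunctions

/-! ### The coefficients of the equation in a basis of eigenvectors -/

section Coefficients

variable {d : ℕ} {V U : Matrix (Fin d) (Fin d) ℝ} {b : Fin d → ℝ} {r T : ℝ}

lemma matDelta_conjDiag (h : V * U = 1) (hb : ∀ i, 0 < b i) :
    matDelta (conjDiag V U b) r = conjDiag V U fun i => scalarRoot (b i) r ^ 2 := by
  rw [matDelta, conjDiag_smul_one h, conjDiag_add]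
  simp only [scalarRoot_sq (hb _)]

lemma isPrincipalSqrt_matDelta (h : V * U = 1) (hb : ∀ i, 0 < b i) :
    IsPrincipalSqrt (matDelta (conjDiag V U b) r)
      (principalSqrt (matDelta (conjDiag V U b) r)) := by
  refine isPrincipalSqrt_principalSqrt (S := conjDiag V U fun i => scalarRoot (b i) r) ?_
  rw [matDelta_conjDiag h hb]
  exact isPrincipalSqrt_conjDiag h fun i => scalarRoot_pos (hb i)

/-- Uniqueness of the principal square root is not needed: the chosen root and the diagonal one have
the same square `Δ`, and the hyperbolic cosine sees only the square. -/
lemma matG_conjDiag (h : V * U = 1) (hb : ∀ i, 0 < b i) (t : ℝ) :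
    matG (conjDiag V U b) r T t = conjDiag V U fun i => scalarG (b i) r T t := by
  have h1 := (isPrincipalSqrt_matDelta (r := r) h hb).1
  have h2 : matG (conjDiag V U b) r T t =
      matrixCosh ((T - t) • conjDiag V U fun i => scalarRoot (b i) r) := by
    refine matrixCosh_congr ?_
    rw [smul_mul_smul_comm, smul_mul_smul_comm, h1, matDelta_conjDiag h hb,
      conjDiag_mul (mul_eq_one_comm.1 h)]
    simp only [sq]
  rw [h2, conjDiag_smul, matrixCosh_conjDiag h]
  rfl

lemma matrixDeriv_matG_conjDiag (h : V * U = 1) (hb : ∀ i, 0 < b i) (t : ℝ) :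
    matrixDeriv (matG (conjDiag V U b) r T) t = conjDiag V U fun i => scalarG' (b i) r T t := by
  rw [funext fun u => matG_conjDiag (T := T) (r := r) h hb u]
  exact matrixDeriv_conjDiag fun i => hasDerivAt_scalarG t

lemma matK_conjDiag (h : V * U = 1) (hb : ∀ i, 0 < b i) (t : ℝ) :
    matK (conjDiag V U b) r T t = conjDiag V U fun i => scalarK (b i) r T t := by
  rw [matK, matrixDeriv_matG_conjDiag h hb, matG_conjDiag h hb, matDelta_conjDiag h hb,
    conjDiag_mul (mul_eq_one_comm.1 h), conjDiag_smul, conjDiag_sub]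
  simp only [scalarK, scalarRoot_sq (hb _)]

lemma matF_conjDiag (h : V * U = 1) (hb : ∀ i, 0 < b i) (hr : 0 ≤ r) (t : ℝ) :
    matF (conjDiag V U b) r T t = conjDiag V U fun i => scalarF (b i) r T t := by
  have h' := mul_eq_one_comm.1 h
  rw [matF, matrixDeriv_matG_conjDiag h hb, matK_conjDiag h hb,
    inv_conjDiag h fun i => (scalarK_pos (hb i) hr t).ne', conjDiag_mul h', conjDiag_mul h',
    conjDiag_neg]
  rfl

lemma exp_neg_matrixIntegral_matF (h : V * U = 1) (hb : ∀ i, 0 < b i) (hr : 0 ≤ r) (s t : ℝ) :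
    NormedSpace.exp (-matrixIntegral (matF (conjDiag V U b) r T) s t) =
      conjDiag V U fun i => Real.exp (-∫ u in s..t, scalarF (b i) r T u) := by
  rw [funext fun u => matF_conjDiag (T := T) h hb hr u, matrixIntegral_conjDiag
    fun i => (isFeedback_scalar (T := T) (hb i) hr).continuous_feedback, conjDiag_neg,
    exp_conjDiag h]

/-- `Λ⁻¹ Σ` is diagonalisable with positive eigenvalues. -/
theorem exists_matB_eq_conjDiag {S L : Matrix (Fin d) (Fin d) ℝ} (hS : S.PosDef)
    (hLd : L.IsDiag) (hL : L.PosDef) {δ : ℝ} (hδ : 0 < δ) :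
    ∃ (V U : Matrix (Fin d) (Fin d) ℝ) (b : Fin d → ℝ), V * U = 1 ∧ (∀ i, 0 < b i) ∧
      matB S L δ = conjDiag V U b := by
  obtain ⟨l, rfl⟩ : ∃ l, L = Matrix.diagonal l :=
    ⟨L.diag, ((Matrix.isDiag_iff_diagonal_diag L).1 hLd).symm⟩
  have hl : ∀ i, 0 < l i := fun i => by simpa using hL.diag_pos (i := i)
  set D : Matrix (Fin d) (Fin d) ℝ := Matrix.diagonal fun i => (√(l i))⁻¹ with hD
  set D' : Matrix (Fin d) (Fin d) ℝ := Matrix.diagonal fun i => √(l i) with hD'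
  have hne : ∀ i, √(l i) ≠ 0 := fun i => (Real.sqrt_pos.2 (hl i)).ne'
  have hDD' : D * D' = 1 := by
    rw [hD, hD', Matrix.diagonal_mul_diagonal, ← Matrix.diagonal_one]
    congr 1
    funext i
    exact inv_mul_cancel₀ (hne i)
  have hDD : D * D = (Matrix.diagonal l)⁻¹ := by
    refine (Matrix.inv_eq_left_inv ?_).symm
    rw [hD, Matrix.diagonal_mul_diagonal, Matrix.diagonal_mul_diagonal, ← Matrix.diagonal_one]
    congr 1
    funext i
    have := Real.mul_self_sqrt (hl i).le
    rw [← mul_inv, this]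
    exact inv_mul_cancel₀ (hl i).ne'
  have hDt : D.conjTranspose = D := by simp [hD]
  -- With `D = Λ^(-1/2)`, this congruence is symmetric and has an orthonormal eigenbasis `Q`. Since
  -- `Λ⁻¹ Σ = D (D Σ D) D⁻¹`, the columns of `D Q` are eigenvectors of `Λ⁻¹ Σ`.
  have hA : (D * S * D).PosDef := by
    have := hS.conjTranspose_mul_mul_same (B := D)
      (Matrix.mulVec_injective_of_isUnit (IsUnit.of_mul_eq_one _ hDD'))
    rwa [hDt] at this
  obtain ⟨Q, μ, hQQ, hμ, hspec⟩ : ∃ (Q : Matrix (Fin d) (Fin d) ℝ) (μ : Fin d → ℝ),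
      Q * star Q = 1 ∧ (∀ i, 0 < μ i) ∧ D * S * D = Q * Matrix.diagonal μ * star Q :=
    ⟨hA.1.eigenvectorUnitary, hA.1.eigenvalues, Unitary.coe_mul_star_self _, hA.eigenvalues_pos,
      hA.1.spectral_theorem.trans (Unitary.conjStarAlgAut_apply _ _)⟩
  refine ⟨D * Q, star Q * D', fun i => 1 / (2 * δ) * μ i, ?_, fun i => ?_, ?_⟩
  · rw [Matrix.mul_assoc, ← Matrix.mul_assoc Q, hQQ, Matrix.one_mul, hDD']
  · have := hμ i
    positivity
  · rw [← conjDiag_smul, matB]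
    congr 1
    calc (Matrix.diagonal l)⁻¹ * S = D * (D * S * D) * D' := by
          rw [← hDD]
          simp only [Matrix.mul_assoc, hDD', Matrix.mul_one]
      _ = _ := by
          rw [hspec]
          simp only [conjDiag, Matrix.mul_assoc]

end Coefficients

/-! ### Vector processes: bounds, real coordinates and eigencoordinates -/

section VectorProcesses

variable {Ω : Type*} [mΩ : MeasurableSpace Ω] {T : ℝ} {d : ℕ} {P : Measure Ω}
  {𝓕 : Filtration (Time T) mΩ} {X Y : Time T → Ω → Vec d}

/-! ### The class `ℋ^∞` -/

namespace MemHInfty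

lemma exists_bound (hX : MemHInfty 𝓕 P X) :
    ∃ C, ∀ᵐ ω ∂P, ∀ᵐ t : Time T, ‖X t ω‖ ≤ C := by
  refine ⟨(essSup (fun ω => essSup (fun t => ‖X t ω‖ₑ) volume) P).toReal, ?_⟩
  filter_upwards [ENNReal.ae_le_essSup fun ω => essSup (fun t => ‖X t ω‖ₑ) volume] with ω hω
  filter_upwards [ENNReal.ae_le_essSup fun t => ‖X t ω‖ₑ] with t ht
  have h := ENNReal.toReal_mono hX.2.ne (ht.trans hω)
  rwa [toReal_enorm] at h

lemma of_bound (ho : IsOptional 𝓕 X) {C : ℝ} (h : ∀ᵐ ω ∂P, ∀ᵐ t : Time T, ‖X t ω‖ ≤ C) :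
    MemHInfty 𝓕 P X := by
  refine ⟨ho, lt_of_le_of_lt (b := ENNReal.ofReal C) ?_ ENNReal.ofReal_lt_top⟩
  refine essSup_le_of_ae_le _ ?_
  filter_upwards [h] with ω hω
  refine essSup_le_of_ae_le _ ?_
  filter_upwards [hω] with t ht
  rw [← ofReal_norm]
  exact ENNReal.ofReal_le_ofReal ht

lemma clm (hX : MemHInfty 𝓕 P X) {d' : ℕ} (A : Vec d →L[ℝ] Vec d') :
    MemHInfty 𝓕 P fun t ω => A (X t ω) := by
  obtain ⟨C, hC⟩ := hX.exists_bound
  refine of_bound (C := ‖A‖ * C) (A.continuous.measurable.comp hX.1) ?_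
  filter_upwards [hC] with ω hω
  filter_upwards [hω] with t ht
  exact (A.le_opNorm _).trans (mul_le_mul_of_nonneg_left ht (norm_nonneg _))

lemma act (hX : MemHInfty 𝓕 P X) (A : Matrix (Fin d) (Fin d) ℝ) :
    MemHInfty 𝓕 P fun t ω => act A (X t ω) :=
  hX.clm (Matrix.toEuclideanLin A).toContinuousLinearMap

lemma smul (hX : MemHInfty 𝓕 P X) (c : ℝ) : MemHInfty 𝓕 P fun t ω => c • X t ω :=
  hX.clm (c • ContinuousLinearMap.id ℝ (Vec d))

lemma add (hX : MemHInfty 𝓕 P X) (hY : MemHInfty 𝓕 P Y) :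
    MemHInfty 𝓕 P fun t ω => X t ω + Y t ω := by
  obtain ⟨C, hC⟩ := hX.exists_bound
  obtain ⟨D, hD⟩ := hY.exists_bound
  refine of_bound (C := C + D) (Measurable.add hX.1 hY.1) ?_
  filter_upwards [hC, hD] with ω h1 h2
  filter_upwards [h1, h2] with t h3 h4
  exact (norm_add_le _ _).trans (add_le_add h3 h4)

lemma sub (hX : MemHInfty 𝓕 P X) (hY : MemHInfty 𝓕 P Y) :
    MemHInfty 𝓕 P fun t ω => X t ω - Y t ω := by
  simpa [sub_eq_add_neg] using hX.add (hY.smul (-1))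

lemma zero : MemHInfty 𝓕 P fun _ _ => (0 : Vec d) :=
  of_bound (C := 0) measurable_const (ae_of_all _ fun _ => ae_of_all _ fun _ => by simp)

lemma sum {ι : Type*} (s : Finset ι) {Z : ι → Time T → Ω → Vec d}
    (h : ∀ i, MemHInfty 𝓕 P (Z i)) : MemHInfty 𝓕 P fun t ω => ∑ i ∈ s, Z i t ω := by
  classical
  induction s using Finset.induction_on with
  | empty => simpa using zero
  | insert i s hi ih => simpa only [Finset.sum_insert hi] using (h i).add ih

lemma isProg (hX : MemHInfty 𝓕 P X) (hT : 0 ≤ T) (L : Vec d →L[ℝ] ℝ) :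
    IsProg 𝓕 fun t ω => L (X t ω) :=
  isProg_of_optional hT (L.continuous.measurable.comp hX.1)

lemma exists_abs_bound (hX : MemHInfty 𝓕 P X) (L : Vec d →L[ℝ] ℝ) :
    ∃ C, ∀ᵐ ω ∂P, ∀ᵐ t : Time T, |L (X t ω)| ≤ C := by
  obtain ⟨C, hC⟩ := hX.exists_bound
  refine ⟨‖L‖ * C, ?_⟩
  filter_upwards [hC] with ω hω
  filter_upwards [hω] with t ht
  exact (L.le_opNorm _).trans (mul_le_mul_of_nonneg_left ht (norm_nonneg _))

end MemHInfty

/-! ### Processes built from real coordinates -/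

section Coordinates

variable {x : Fin d → Time T → Ω → ℝ}

lemma isOptional_sum_smul (hx : ∀ i, IsRegular 𝓕 P (x i)) (e : Fin d → Vec d) :
    IsOptional 𝓕 fun t ω => ∑ i, x i t ω • e i :=
  Finset.measurable_fun_sum _ fun i _ =>
    (measurable_optional_of_continuous (hx i).adapted (hx i).continuous_paths).smul_const (e i)

lemma memHInfty_sum_smul (hx : ∀ i, IsRegular 𝓕 P (x i)) (e : Fin d → Vec d) :
    MemHInfty 𝓕 P fun t ω => ∑ i, x i t ω • e i := by
  choose C hC using fun i => (hx i).bounded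
  refine MemHInfty.of_bound (isOptional_sum_smul hx e) (C := ∑ i, C i * ‖e i‖) ?_
  filter_upwards [ae_all_iff.2 hC] with ω hω
  refine ae_of_all _ fun t => (norm_sum_le _ _).trans (Finset.sum_le_sum fun i _ => ?_)
  rw [norm_smul]
  exact mul_le_mul_of_nonneg_right (hω i t) (norm_nonneg _)

lemma continuous_sum_smul (hx : ∀ i, IsRegular 𝓕 P (x i)) (e : Fin d → Vec d) (ω : Ω) :
    Continuous fun t => ∑ i, x i t ω • e i :=
  continuous_finsetSum _ fun i _ => ((hx i).continuous_paths ω).smul continuous_const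

lemma stronglyAdapted_sum_smul (hx : ∀ i, IsRegular 𝓕 P (x i)) (e : Fin d → Vec d) :
    StronglyAdapted 𝓕 fun t ω => ∑ i, x i t ω • e i := fun t =>
  Finset.stronglyMeasurable_fun_sum _ fun i _ =>
    ((hx i).adapted t).stronglyMeasurable.smul_const (e i)

lemma martingale_clm_comp {E F : Type*} [NormedAddCommGroup E] [NormedSpace ℝ E] [CompleteSpace E]
    [NormedAddCommGroup F] [NormedSpace ℝ F] [CompleteSpace F] [IsFiniteMeasure P]
    {M : Time T → Ω → E} (hM : Martingale M 𝓕 P) (A : E →L[ℝ] F) :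
    Martingale (fun t ω => A (M t ω)) 𝓕 P := by
  refine ⟨fun t => A.continuous.comp_stronglyMeasurable (hM.1 t), fun s t hst => ?_⟩
  refine (A.comp_condExp_comm (m := 𝓕 s) (hM.integrable t)).symm.trans ?_
  filter_upwards [hM.condExp_ae_eq hst] with ω hω
  simp [hω]

lemma martingale_sum_smul [IsFiniteMeasure P] (hx : ∀ i, Martingale (x i) 𝓕 P)
    (e : Fin d → Vec d) : Martingale (fun t ω => ∑ i, x i t ω • e i) 𝓕 P := by
  have h : ∀ s : Finset (Fin d), Martingale (fun t ω => ∑ i ∈ s, x i t ω • e i) 𝓕 P := by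
    intro s
    induction s using Finset.induction_on with
    | empty => simpa using! martingale_zero (Vec d) 𝓕 P
    | insert i s hi ih =>
      simp only [Finset.sum_insert hi]
      exact (martingale_clm_comp (hx i) (ContinuousLinearMap.toSpanSingleton ℝ (e i))).add ih
  exact h _

end Coordinates

/-! ### Coordinates in a basis of eigenvectors -/

section Eigenbasis

variable {V U : Matrix (Fin d) (Fin d) ℝ}

/-- The `i`-th coordinate `(U x)_i` in the basis of the columns of `V = U⁻¹`. -/
noncomputable def coord (U : Matrix (Fin d) (Fin d) ℝ) (i : Fin d) : Vec d →L[ℝ] ℝ :=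
  (EuclideanSpace.proj i : Vec d →L[ℝ] ℝ) ∘L (Matrix.toEuclideanLin U).toContinuousLinearMap

/-- The `i`-th column of `V`. -/
def column (V : Matrix (Fin d) (Fin d) ℝ) (i : Fin d) : Vec d := WithLp.toLp 2 fun j => V j i

lemma coord_apply (i : Fin d) (v : Vec d) : coord U i v = ∑ j, U i j * v j := by
  simp [coord, Matrix.toLpLin_apply, Matrix.mulVec, dotProduct]

lemma sum_coord_smul_column (h : V * U = 1) (v : Vec d) :
    ∑ i, coord U i v • column V i = v := by
  ext k
  have h1 : ∀ j, ∑ i, V k i * U i j = if k = j then 1 else 0 := fun j => by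
    rw [← Matrix.mul_apply, h, Matrix.one_apply]
  calc (∑ i, coord U i v • column V i) k = ∑ i, ∑ j, V k i * U i j * v j := by
        simp only [WithLp.ofLp_sum, Finset.sum_apply, coord_apply, column, PiLp.smul_apply,
          smul_eq_mul, Finset.sum_mul]
        exact Finset.sum_congr rfl fun i _ => Finset.sum_congr rfl fun j _ => by ring
    _ = v k := by
        rw [Finset.sum_comm]
        simp only [← Finset.sum_mul, h1]
        simp

lemma coord_column (h : U * V = 1) (i j : Fin d) :
    coord U i (column V j) = if i = j then 1 else 0 := by
  rw [coord_apply, ← Matrix.one_apply, ← h, Matrix.mul_apply]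
  rfl

lemma coord_sum_smul_column (h : U * V = 1) (c : Fin d → ℝ) (i : Fin d) :
    coord U i (∑ j, c j • column V j) = c i := by
  simp [map_sum, coord_column h]

lemma eq_of_coord_eq (h : V * U = 1) {v w : Vec d} (hvw : ∀ i, coord U i v = coord U i w) :
    v = w := by
  rw [← sum_coord_smul_column h v, ← sum_coord_smul_column h w]
  simp only [hvw]

/-- The rows of `U` are left eigenvectors, since `U (V diag(a) U) = diag(a) U`; this decouples the
equation. -/
lemma coord_act_conjDiag (h : U * V = 1) (a : Fin d → ℝ) (v : Vec d) (i : Fin d) :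
    coord U i (act (conjDiag V U a) v) = a i * coord U i v := by
  have h1 : ∀ A : Matrix (Fin d) (Fin d) ℝ, coord U i (act A v) = ((U * A).mulVec v) i := by
    intro A
    simp [coord, Matrix.toLpLin_apply]
  have h2 : U * conjDiag V U a = Matrix.diagonal a * U := by
    rw [conjDiag, ← Matrix.mul_assoc, ← Matrix.mul_assoc, h, Matrix.one_mul]
  rw [h1, h2, coord_apply]
  simp [Matrix.mulVec, dotProduct, Matrix.diagonal_mul, Finset.mul_sum, mul_assoc]

lemma integrable_of_coord (h : V * U = 1) {α : Type*} [MeasurableSpace α] {μ : Measure α}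
    {f : α → Vec d} (hf : ∀ i, Integrable (fun a => coord U i (f a)) μ) : Integrable f μ := by
  have : f = fun a => ∑ i, coord U i (f a) • column V i :=
    funext fun a => (sum_coord_smul_column h (f a)).symm
  rw [this]
  exact integrable_finsetSum _ fun i _ => (hf i).smul_const _

lemma coord_integral (h : V * U = 1) {α : Type*} [MeasurableSpace α] {μ : Measure α}
    {f : α → Vec d} (hf : ∀ i, Integrable (fun a => coord U i (f a)) μ) (i : Fin d) :
    coord U i (∫ a, f a ∂μ) = ∫ a, coord U i (f a) ∂μ :=
  ((coord U i).integral_comp_comm (integrable_of_coord h hf)).symm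

lemma MemHInfty.ae_integrable_coord (hX : MemHInfty 𝓕 P X) (hT : 0 ≤ T) :
    ∀ᵐ ω ∂P, ∀ i, Integrable fun t => coord U i (X t ω) := by
  refine ae_all_iff.2 fun i => ?_
  obtain ⟨C, hC⟩ := hX.exists_abs_bound (coord U i)
  exact ae_integrable_path ((hX.isProg hT (coord U i)).measurable_uncurry hT) hC

/-- The integral of a bounded rate has a bounded optional version. -/
lemma MemHInfty.exists_version_of_hasRate (hX : MemHInfty 𝓕 P X) (hT : 0 ≤ T)
    (hnull : ∀ A, MeasurableSet A → P A = 0 → ∀ t, MeasurableSet[𝓕 t] A) (hY : HasRate P Y X) :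
    ∃ Y', MemHInfty 𝓕 P Y' ∧ ∀ᵐ ω ∂P, ∀ t, Y' t ω = Y t ω := by
  -- Any basis would do here; standard coordinates are obtained from the identity matrix.
  have h1 : (1 : Matrix (Fin d) (Fin d) ℝ) * 1 = 1 := one_mul 1
  have hint := hX.ae_integrable_coord (U := 1) hT
  have : ∀ i : Fin d, ∃ y : Time T → Ω → ℝ, IsRegular 𝓕 P y ∧
      ∀ᵐ ω ∂P, ∀ t, y t ω = ∫ u in Set.Iic t, coord 1 i (X u ω) := by
    intro i
    obtain ⟨C, hC⟩ := hX.exists_abs_bound (coord 1 i)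
    obtain ⟨y, hya, hyc, hye⟩ := exists_continuous_adapted_modification (P := P) (𝓕 := 𝓕) hT hnull
      (X := fun t ω => ∫ u in Set.Iic t, coord 1 i (X u ω))
      (by filter_upwards [hint] with ω hω using continuous_setIntegral_Iic hT (hω i))
      fun t => ⟨_, (hX.isProg hT (coord 1 i)).adapted_integral t, ae_eq_refl _⟩
    refine ⟨y, ⟨hya, hyc, max C 0 * volume.real (Set.univ : Set (Time T)), ?_⟩, hye⟩
    filter_upwards [hye, hC] with ω h2 h3 t
    rw [h2]
    exact abs_setIntegral_le (h3.mono fun t ht => ht.trans (le_max_left _ _)) (le_max_right _ _) _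
  choose y hy hye using this
  refine ⟨_, memHInfty_sum_smul hy (column 1), ?_⟩
  filter_upwards [ae_all_iff.2 hye, hY, hint] with ω h2 h3 h4 t
  refine eq_of_coord_eq h1 fun i => ?_
  rw [coord_sum_smul_column h1, h2, h3, coord_integral h1 fun i => (h4 i).restrict]

end Eigenbasis

end VectorProcesses

/-! ### The vector equation -/

section VectorEquation

variable {Ω : Type*} [mΩ : MeasurableSpace Ω] {T : ℝ} {d : ℕ} {P : Measure Ω}
  {𝓕 : Filtration (Time T) mΩ} {V U : Matrix (Fin d) (Fin d) ℝ}

/-- Integrability of the coordinate paths lets the coordinate maps pass through the Bochner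
integral. -/
lemma hasRate_iff_coord (h : V * U = 1) {X Y : Time T → Ω → Vec d}
    (hint : ∀ᵐ ω ∂P, ∀ i, Integrable fun t => coord U i (Y t ω)) :
    HasRate P X Y ↔ ∀ i, ∀ᵐ ω ∂P, ∀ t : Time T,
      coord U i (X t ω) = ∫ u in Set.Iic t, coord U i (Y u ω) := by
  rw [← ae_all_iff]
  constructor
  · intro hX
    filter_upwards [hX, hint] with ω h1 h2 i t
    rw [h1, coord_integral h fun j => (h2 j).restrict]
  · intro hX
    filter_upwards [hX, hint] with ω h1 h2 t
    refine eq_of_coord_eq h fun i => ?_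
    rw [h1, coord_integral h fun j => (h2 j).restrict]

lemma hasDynamics_iff_coord (h : V * U = 1) {X a M : Time T → Ω → Vec d}
    (hint : ∀ᵐ ω ∂P, ∀ i, Integrable fun t => coord U i (a t ω)) :
    HasDynamics P X a M ↔ ∀ i, ∀ᵐ ω ∂P, ∀ s t : Time T, s ≤ t →
      coord U i (X t ω) - coord U i (X s ω) =
        (∫ u in Set.Ioc s t, coord U i (a u ω)) + (coord U i (M t ω) - coord U i (M s ω)) := by
  rw [← ae_all_iff]
  constructor
  · intro hX
    filter_upwards [hX, hint] with ω h1 h2 i s t hst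
    rw [← map_sub, h1 s t hst, map_add, map_sub, coord_integral h fun j => (h2 j).restrict]
  · intro hX
    filter_upwards [hX, hint] with ω h1 h2 s t hst
    refine eq_of_coord_eq h fun i => ?_
    rw [map_add, map_sub, map_sub, h1 i s t hst, coord_integral h fun j => (h2 j).restrict]

lemma HasDynamics.congr_drift {X a a' M : Time T → Ω → Vec d} (h : HasDynamics P X a M)
    (ha : ∀ᵐ ω ∂P, ∀ t, a t ω = a' t ω) : HasDynamics P X a' M := by
  filter_upwards [h, ha] with ω h1 h2 s t hst
  rw [h1 s t hst, setIntegral_congr_fun measurableSet_Ioc fun u _ => h2 u]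

variable {b : Fin d → ℝ} {r : ℝ} {TP TP' : Time T → Ω → Vec d}

/-- The coordinates of the discounted target. -/
lemma coord_discountedTarget [IsFiniteMeasure P] (hT : 0 ≤ T) (h : V * U = 1)
    (hb : ∀ i, 0 < b i) (hr : 0 ≤ r) (hTP' : MemHInfty 𝓕 P TP')
    (hTP : ∀ᵐ ω ∂P, ∀ t, TP' t ω = TP t ω) (t : Time T) (i : Fin d) :
    (fun ω => coord U i (act (matK (conjDiag V U b) r T t)⁻¹
      ((P[fun ω' => ∫ s in Set.Ici t, act (Real.exp (-(r / 2) * ((s : ℝ) - (t : ℝ))) •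
        (matK (conjDiag V U b) r T s * conjDiag V U b)) (TP s ω') | 𝓕 t]) ω))) =ᵐ[P]
    fun ω => (scalarWeight (b i) r T t)⁻¹ * (P[fun ω' => ∫ s in Set.Ici t,
      scalarWeight (b i) r T s * b i * coord U i (TP' s ω') | 𝓕 t]) ω := by
  have h' := mul_eq_one_comm.1 h
  -- This factor comes from writing the kernel through the weight; it is deterministic and is
  -- absorbed by `K(t)⁻¹` at the end.
  set c := Real.exp (r / 2 * t) with hc
  set Z : Ω → Vec d := fun ω' => ∫ s in Set.Ici t,
    act (Real.exp (-(r / 2) * ((s : ℝ) - (t : ℝ))) •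
      (matK (conjDiag V U b) r T s * conjDiag V U b)) (TP s ω') with hZdef
  set I : Fin d → Ω → ℝ := fun i ω' => ∫ s in Set.Ici t,
    scalarWeight (b i) r T s * b i * coord U i (TP' s ω') with hI
  have hcont : ∀ i, Continuous fun s => scalarWeight (b i) r T s * b i := fun i =>
    (isFeedback_scalar (T := T) (hb i) hr).continuous_weight.mul continuous_const
  have hker : ∀ (s : Time T) (v : Vec d) (i : Fin d),
      coord U i (act (Real.exp (-(r / 2) * ((s : ℝ) - (t : ℝ))) •
        (matK (conjDiag V U b) r T s * conjDiag V U b)) v) =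
      c * (scalarWeight (b i) r T s * b i * coord U i v) := by
    intro s v i
    rw [matK_conjDiag h hb, conjDiag_mul h', conjDiag_smul, coord_act_conjDiag h', ← mul_assoc,
      exp_mul_scalarK]
    ring
  have hb' : ∀ i, ∃ C, ∀ᵐ ω ∂P, ∀ᵐ s : Time T,
      |scalarWeight (b i) r T s * b i * coord U i (TP' s ω)| ≤ C := fun i => by
    obtain ⟨C, hC⟩ := hTP'.exists_abs_bound (coord U i)
    obtain ⟨D, -, hD⟩ := ae_det_mul_le (hcont i) hC
    exact ⟨D, hD⟩
  choose D hD using hb'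
  have hprog : ∀ i, IsProg 𝓕 fun s ω => scalarWeight (b i) r T s * b i * coord U i (TP' s ω) :=
    fun i => (hTP'.isProg hT (coord U i)).det_mul (hcont i)
  have hpath : ∀ᵐ ω ∂P, ∀ i, Integrable fun s : Time T =>
      scalarWeight (b i) r T s * b i * coord U i (TP' s ω) :=
    ae_all_iff.2 fun i => ae_integrable_path ((hprog i).measurable_uncurry hT) (hD i)
  have hIint : ∀ i, Integrable (I i) P := fun i => (hprog i).integrable_setIntegral hT (hD i) _
  have hZ : ∀ i, (fun ω => coord U i (Z ω)) =ᵐ[P] fun ω => c * I i ω := by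
    intro i
    filter_upwards [hpath, hTP] with ω h1 h2
    simp only [hZdef, hI, ← h2]
    rw [coord_integral h]
    · simp only [hker]
      rw [integral_const_mul]
    · intro j
      simp only [hker]
      exact ((h1 j).const_mul c).restrict
  have hZint : Integrable Z P :=
    integrable_of_coord h fun i => ((hIint i).const_mul c).congr (hZ i).symm
  have h1 := (coord U i).comp_condExp_comm (m := 𝓕 t) hZint
  have h2 : P[coord U i ∘ Z | 𝓕 t] =ᵐ[P] P[c • I i | 𝓕 t] := condExp_congr_ae (hZ i)
  have h3 := condExp_smul (μ := P) c (I i) (𝓕 t)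
  filter_upwards [h1, h2, h3] with ω h1 h2 h3
  rw [matK_conjDiag h hb, inv_conjDiag h fun i => (scalarK_pos (hb i) hr t).ne',
    coord_act_conjDiag h']
  rw [Function.comp_apply] at h1
  rw [h1, h2, h3, Pi.smul_apply, smul_eq_mul, ← mul_assoc, inv_scalarK_mul_exp]

/-- The drift of the backward equation in coordinates. -/
lemma coord_drift (h : U * V = 1) (i : Fin d) (x θ y : Vec d) :
    coord U i (act (conjDiag V U b) (x - θ) + r • y) =
      b i * (coord U i x - coord U i θ) + r * coord U i y := by
  rw [map_add, coord_act_conjDiag h, map_sub, map_smul, smul_eq_mul]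

/-- Every solution is given by the feedback form and by the explicit formula. -/
theorem SolvesFBSDE.ae_eq_feedback [IsProbabilityMeasure P]
    (hnull : ∀ A, MeasurableSet A → P A = 0 → ∀ t, MeasurableSet[𝓕 t] A) (hT : 0 ≤ T)
    (h : V * U = 1) (hb : ∀ i, 0 < b i) (hr : 0 ≤ r) (hTP' : MemHInfty 𝓕 P TP')
    (hTP : ∀ᵐ ω ∂P, ∀ t, TP' t ω = TP t ω) {φ φdot M ξ : Time T → Ω → Vec d}
    (hφ : MemWA 𝓕 P φ φdot) (hsol : SolvesFBSDE 𝓕 P (conjDiag V U b) r TP φ φdot M)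
    (hξ : IsDiscountedTarget 𝓕 P (conjDiag V U b) r TP ξ) :
    ∀ᵐ ω ∂P, ∀ t : Time T,
      φdot t ω = ξ t ω - act (matF (conjDiag V U b) r T t) (φ t ω) ∧
      φ t ω = ∫ s in Set.Iic t,
        act (NormedSpace.exp (-matrixIntegral (matF (conjDiag V U b) r T) s t)) (ξ s ω) := by
  have h' := mul_eq_one_comm.1 h
  obtain ⟨-, a, N, hA⟩ := hφ
  -- `φ` is known only almost surely as an integral. An optional version makes the drift a member of
  -- `ℋ^∞`, so its paths are integrable and coordinates can be taken.
  obtain ⟨φ', hφ', hφe⟩ := hA.mem.exists_version_of_hasRate hT hnull hsol.forward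
  have hdrift : MemHInfty 𝓕 P fun t ω => act (conjDiag V U b) (φ' t ω - TP' t ω) + r • φdot t ω :=
    ((hφ'.sub hTP').act _).add (hA.mem.smul r)
  have hdyn := (hasDynamics_iff_coord h (hdrift.ae_integrable_coord hT)).1
    (hsol.backward.congr_drift (by
      filter_upwards [hφe, hTP] with ω h1 h2 t
      rw [h1, h2]))
  have hrate := (hasRate_iff_coord h (hA.mem.ae_integrable_coord hT)).1 hsol.forward
  have hcoord : ∀ i, ∀ᵐ ω ∂P, ∀ t : Time T,
      coord U i (φdot t ω) = coord U i (ξ t ω) - scalarF (b i) r T t * coord U i (φ t ω) ∧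
      coord U i (φ t ω) = ∫ s in Set.Iic t,
        Real.exp (-∫ u in (s : ℝ)..t, scalarF (b i) r T u) * coord U i (ξ s ω) := by
    intro i
    have hcc : Continuous (coord U i) := (coord U i).continuous
    obtain ⟨Cθ, hCθ⟩ := hTP'.exists_abs_bound (coord U i)
    obtain ⟨Cm, hCm⟩ := hsol.martingale.mem.exists_abs_bound (coord U i)
    refine (isFeedback_scalar (T := T) (hb i) hr).ae_eq_feedback hT
      (hTP'.isProg hT (coord U i)) hCθ (martingale_clm_comp hsol.martingale.martingale (coord U i))
      (hsol.martingale.mem.isProg hT (coord U i)) hCm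
      (hsol.martingale.continuous_paths.mono fun ω hω => hcc.comp hω)
      (hA.mem.isProg hT (coord U i)) (hA.continuous_paths.mono fun ω hω => hcc.comp hω)
      (hrate i) ?_ ⟨T, hT, le_rfl⟩ rfl ?_ (hξ.continuous_paths.mono fun ω hω => hcc.comp hω)
      fun t => ?_
    · filter_upwards [hdyn i, hφe] with ω h1 h2 s t hst
      rw [h1 s t hst]
      simp only [coord_drift h', h2]
    · filter_upwards [hsol.terminal ⟨T, hT, le_rfl⟩ rfl] with ω hω
      rw [hω, map_zero]
    · filter_upwards [hξ.version t, coord_discountedTarget hT h hb hr hTP' hTP t i] with ω h1 h2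
      rw [h1, ← h2]
  filter_upwards [ae_all_iff.2 hcoord, hξ.continuous_paths] with ω h1 h2 t
  constructor
  · refine eq_of_coord_eq h fun i => ?_
    rw [map_sub, matF_conjDiag h hb hr, coord_act_conjDiag h', (h1 i t).1]
  · have hker : ∀ (s : Time T) (i : Fin d), coord U i
        (act (NormedSpace.exp (-matrixIntegral (matF (conjDiag V U b) r T) s t)) (ξ s ω)) =
        Real.exp (-∫ u in (s : ℝ)..t, scalarF (b i) r T u) * coord U i (ξ s ω) := fun s i => by
      rw [exp_neg_matrixIntegral_matF h hb hr, coord_act_conjDiag h']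
    refine eq_of_coord_eq h fun i => ?_
    rw [(h1 i t).2, coord_integral h]
    · simp only [hker]
    · intro j
      simp only [hker]
      have hF := (isFeedback_scalar (T := T) (hb j) hr).continuous_feedback
      have hint : Continuous fun s : ℝ => ∫ u in s..(t : ℝ), scalarF (b j) r T u := by
        simp only [intervalIntegral.integral_symm (t : ℝ)]
        exact (intervalIntegral.continuous_primitive
          (fun _ _ => hF.intervalIntegrable _ _) _).neg
      exact (integrable_of_continuous (((Real.continuous_exp.comp hint.neg).comp
        continuous_subtype_val).mul ((coord U j).continuous.comp h2))).restrict

/-- Existence of the discounted target and of a solution. -/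
theorem exists_solvesFBSDE [IsProbabilityMeasure P]
    (hnull : ∀ A, MeasurableSet A → P A = 0 → ∀ t, MeasurableSet[𝓕 t] A)
    (hcont : ∀ ξ, HasContVersion 𝓕 P ξ) (hT : 0 ≤ T)
    (h : V * U = 1) (hb : ∀ i, 0 < b i) (hr : 0 ≤ r) (hTP' : MemHInfty 𝓕 P TP')
    (hTP : ∀ᵐ ω ∂P, ∀ t, TP' t ω = TP t ω) :
    ∃ ξ φ φdot M : Time T → Ω → Vec d,
      IsDiscountedTarget 𝓕 P (conjDiag V U b) r TP ξ ∧ MemWA 𝓕 P φ φdot ∧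
      SolvesFBSDE 𝓕 P (conjDiag V U b) r TP φ φdot M := by
  have h' := mul_eq_one_comm.1 h
  choose Cθ hCθ using fun i => hTP'.exists_abs_bound (coord U i)
  choose η x y m hη hx hy hm hmm hxy hdyn hend hver using fun i =>
    (isFeedback_scalar (T := T) (hb i) hr).exists_solution hnull hcont hT
      (hTP'.isProg hT (coord U i)) (hCθ i) ⟨T, hT, le_rfl⟩ rfl
  have hφ := memHInfty_sum_smul hx (column V)
  have hφdot := memHInfty_sum_smul hy (column V)
  have hdrift : MemHInfty 𝓕 P fun t ω => act (conjDiag V U b)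
      ((∑ i, x i t ω • column V i) - TP' t ω) + r • ∑ i, y i t ω • column V i :=
    ((hφ.sub hTP').act _).add (hφdot.smul r)
  have hM : IsBddContMartingale 𝓕 P fun t ω => ∑ i, m i t ω • column V i :=
    ⟨martingale_sum_smul hmm _, memHInfty_sum_smul hm _,
      ae_of_all _ (continuous_sum_smul hm _)⟩
  have hrate : HasRate P (fun t ω => ∑ i, x i t ω • column V i)
      fun t ω => ∑ i, y i t ω • column V i := by
    refine (hasRate_iff_coord h (hφdot.ae_integrable_coord hT)).2 fun i => ?_
    simpa only [coord_sum_smul_column h'] using hxy i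
  have hdyn' : HasDynamics P (fun t ω => ∑ i, y i t ω • column V i)
      (fun t ω => act (conjDiag V U b)
        ((∑ i, x i t ω • column V i) - TP' t ω) + r • ∑ i, y i t ω • column V i)
      fun t ω => ∑ i, m i t ω • column V i := by
    refine (hasDynamics_iff_coord h (hdrift.ae_integrable_coord hT)).2 fun i => ?_
    simpa only [coord_sum_smul_column h', coord_drift h'] using hdyn i
  have hterm : VanishesAtEnd P fun t ω => ∑ i, y i t ω • column V i := by
    intro t ht
    obtain rfl : t = ⟨T, hT, le_rfl⟩ := Subtype.ext ht
    filter_upwards [ae_all_iff.2 hend] with ω hω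
    simp [hω]
  refine ⟨fun t ω => ∑ i, η i t ω • column V i, _, _, _, ⟨stronglyAdapted_sum_smul hη _,
    ae_of_all _ (continuous_sum_smul hη _), fun t => ?_⟩,
    ⟨hrate, _, _, ⟨hφdot, ae_of_all _ (continuous_sum_smul hy _), hdrift, hM, hdyn', hterm⟩⟩,
    ⟨hrate, hM, hdyn'.congr_drift ?_, hterm⟩⟩
  · filter_upwards [ae_all_iff.2 fun i => hver i t,
      ae_all_iff.2 (coord_discountedTarget hT h hb hr hTP' hTP t)] with ω h1 h2
    refine eq_of_coord_eq h fun i => ?_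
    rw [coord_sum_smul_column h', h1, h2]
  · filter_upwards [hTP] with ω h1 t
    rw [h1]

/-- Pathwise uniqueness. -/
theorem SolvesFBSDE.ae_unique [IsProbabilityMeasure P]
    (hnull : ∀ A, MeasurableSet A → P A = 0 → ∀ t, MeasurableSet[𝓕 t] A) (hT : 0 ≤ T)
    (h : V * U = 1) (hb : ∀ i, 0 < b i) (hr : 0 ≤ r) (hTP' : MemHInfty 𝓕 P TP')
    (hTP : ∀ᵐ ω ∂P, ∀ t, TP' t ω = TP t ω) {φ φdot M φ' φdot' M' ξ : Time T → Ω → Vec d}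
    (hξ : IsDiscountedTarget 𝓕 P (conjDiag V U b) r TP ξ)
    (hφ : MemWA 𝓕 P φ φdot) (hsol : SolvesFBSDE 𝓕 P (conjDiag V U b) r TP φ φdot M)
    (hφ' : MemWA 𝓕 P φ' φdot') (hsol' : SolvesFBSDE 𝓕 P (conjDiag V U b) r TP φ' φdot' M') :
    ∀ᵐ ω ∂P, ∀ s t : Time T,
      φ t ω = φ' t ω ∧ φdot t ω = φdot' t ω ∧ M t ω - M s ω = M' t ω - M' s ω := by
  filter_upwards [hsol.ae_eq_feedback hnull hT h hb hr hTP' hTP hφ hξ,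
    hsol'.ae_eq_feedback hnull hT h hb hr hTP' hTP hφ' hξ, hsol.backward, hsol'.backward]
    with ω h1 h2 h3 h4
  have h5 : ∀ t, φ t ω = φ' t ω := fun t => by rw [(h1 t).2, (h2 t).2]
  have h6 : ∀ t, φdot t ω = φdot' t ω := fun t => by rw [(h1 t).1, (h2 t).1, h5]
  -- Equal paths have equal drifts, so the two dynamics force equal increments of the martingale
  -- parts.
  have h7 : ∀ s t : Time T, s ≤ t → M t ω - M s ω = M' t ω - M' s ω := by
    intro s t hst
    have h8 := h3 s t hst
    have h9 := h4 s t hst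
    simp only [h5, h6] at h8
    exact add_left_cancel (h8.symm.trans h9)
  intro s t
  refine ⟨h5 t, h6 t, ?_⟩
  rcases le_total s t with hst | hst
  · exact h7 s t hst
  · rw [← neg_sub, h7 t s hst, neg_sub]

/-- The target process has a bounded optional version. -/
theorem exists_version_targetProcess {N : ℕ} (hT : 0 ≤ T)
    (hnull : ∀ A, MeasurableSet A → P A = 0 → ∀ t, MeasurableSet[𝓕 t] A)
    (S L : Matrix (Fin d) (Fin d) ℝ) (r δbar : ℝ) (δ : Fin N → ℝ)
    {ζ : Fin N → Time T → Ω → Vec d} (hζ : ∀ m, MemHInfty 𝓕 P (ζ m))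
    {ψ ψdot aψ Mψ : Time T → Ω → Vec d} (hψ : HasRate P ψ ψdot)
    (hψdot : IsClassADecomp 𝓕 P ψdot aψ Mψ) (n : Fin N) :
    ∃ TP', MemHInfty 𝓕 P TP' ∧ ∀ᵐ ω ∂P, ∀ t,
      TP' t ω = targetProcess S L r δbar δ ζ ψ ψdot aψ n t ω := by
  -- Among the ingredients of the target only `ψ` is not given as an optional process.
  obtain ⟨ψ', hψ', hψe⟩ := hψdot.mem.exists_version_of_hasRate hT hnull hψ
  refine ⟨targetProcess S L r δbar δ ζ ψ' ψdot aψ n, ?_, ?_⟩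
  · exact ((((MemHInfty.sum _ hζ).sub hψ').smul _).sub ((hζ n).smul _)).smul _ |>.add
      (((hψdot.drift_mem.sub (hψdot.mem.smul r)).act _).smul _)
  · filter_upwards [hψe] with ω hω t
    simp only [targetProcess, frictionlessBestResponse, hω]

end VectorEquation

end FrictionalMarket

/-! ### The frictional best response -/

theorem proposition4p3 {Ω : Type*} [mΩ : MeasurableSpace Ω] (P : Measure Ω)
    [IsProbabilityMeasure P] (T : ℝ) (hT : 0 < T) (d N : ℕ)
    (W : Time T → Ω → Fin d → ℝ)
    (hW : IsBrownianMotion W P)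
    (r : ℝ) (hr : 0 ≤ r)
    (σ : Matrix (Fin d) (Fin d) ℝ) (hσ : (σ * σ.transpose).PosDef)
    (Λ : Matrix (Fin d) (Fin d) ℝ) (hΛdiag : Λ.IsDiag) (hΛ : Λ.PosDef)
    (δ : Fin N → ℝ) (δbar : ℝ) (hδbar : 0 < δbar) (hδ : ∀ m, δ m = δbar)
    (ζ : Fin N → Time T → Ω → Vec d)
    (hζ : ∀ m, MemHInfty (brownianFiltration hW) P (ζ m))
    (ψ ψdot aψ Mψ : Time T → Ω → Vec d)
    (hψ : HasRate P ψ ψdot)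
    (hψdot : IsClassADecomp (brownianFiltration hW) P
      ψdot aψ Mψ)
    (n : Fin N) :
    let 𝓕 := brownianFiltration hW
    let Sig := σ * σ.transpose
    let B := matB Sig Λ δbar
    let TP := targetProcess Sig Λ r δbar δ ζ ψ ψdot aψ n
    -- the square root and the inverses in the explicit formula exist
    IsPrincipalSqrt (matDelta B r)
      (principalSqrt (matDelta B r)) ∧
    (∀ t : Time T, IsUnit (matK B r T t)) ∧
    (∃ ξ, IsDiscountedTarget 𝓕 P B r TP ξ) ∧
    -- existence of a solution in the class
    (∃ φ φdot M, MemWA 𝓕 P φ φdot ∧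
      SolvesFBSDE 𝓕 P B r TP φ φdot M) ∧
    -- pathwise uniqueness
    (∀ φ φdot M φ' φdot' M',
      MemWA 𝓕 P φ φdot →
      SolvesFBSDE 𝓕 P B r TP φ φdot M →
      MemWA 𝓕 P φ' φdot' →
      SolvesFBSDE 𝓕 P B r TP φ' φdot' M' →
      ∀ᵐ ω ∂P, ∀ s t : Time T,
        φ t ω = φ' t ω ∧ φdot t ω = φdot' t ω ∧ M t ω - M s ω = M' t ω - M' s ω) ∧
    -- explicit form of the solution
    (∀ φ φdot M ξ,
      MemWA 𝓕 P φ φdot →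
      SolvesFBSDE 𝓕 P B r TP φ φdot M →
      IsDiscountedTarget 𝓕 P B r TP ξ →
      ∀ᵐ ω ∂P, ∀ t : Time T,
        φ t ω = ∫ s in Set.Iic t,
          act
            (NormedSpace.exp
              (-matrixIntegral (matF B r T) s t))
            (ξ s ω)) := by
  intro 𝓕 Sig B TP
  have hnull := measurableSet_brownianFiltration_of_null hW
  obtain ⟨V, U, b, h, hb, hB⟩ := exists_matB_eq_conjDiag hσ hΛdiag hΛ hδbar
  obtain ⟨TP', hTP', hTP⟩ := exists_version_targetProcess hT.le hnull Sig Λ r δbar δ hζ hψ hψdot n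
  obtain ⟨ξ, φ, φdot, M, hξ, hφ, hsol⟩ := exists_solvesFBSDE hnull
    (hasContVersion_brownianFiltration hT hW) hT.le h hb hr hTP' hTP
  change matB Sig Λ δbar = _ at hB
  simp only [B, hB]
  refine ⟨isPrincipalSqrt_matDelta h hb, fun t => ?_, ⟨ξ, hξ⟩, ⟨φ, φdot, M, hφ, hsol⟩, ?_, ?_⟩
  · rw [matK_conjDiag h hb]
    exact isUnit_conjDiag h fun i => (scalarK_pos (hb i) hr t).ne'
  · intro φ₁ φdot₁ M₁ φ₂ φdot₂ M₂ hφ₁ hsol₁ hφ₂ hsol₂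
    exact hsol₁.ae_unique hnull hT.le h hb hr hTP' hTP hξ hφ₁ hφ₂ hsol₂
  · intro φ₁ φdot₁ M₁ ξ₁ hφ₁ hsol₁ hξ₁
    filter_upwards [hsol₁.ae_eq_feedback hnull hT.le h hb hr hTP' hTP hφ₁ hξ₁] with ω hω t
    exact (hω t).2
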